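/- Let $(X,d)$ be a proper metric space, let $G=\mathrm{Isom}(X)$ be its isometry group with the compact-open topology and a Haar measure, and let $\mu$ be a non-zero Radon measure on $X$ which is invariant under all isometries and satisfies $\mathrm{supp}(\mu)=X$. For a subgroup $\Gamma\subset G$ and $x\in X$ put $\rho(\Gamma,x)=\inf_{1\ne\gamma\in\Gamma}d(x,\gamma x)$ (with $\inf\emptyset=\infty$) and $\rho(\Gamma)=\inf_{x\in X}\rho(\Gamma,x)$. A *lattice* is a subgroup $\Gamma\subset G$ such that $\Gamma\backslash X$ is compact and $\rho(\Gamma)>0$. The spaces $\Gamma\backslash X$ and $\Gamma\backslash G$ carry the measures induced by $\mu$ and by the Haar measure (so that integrating $f$ upstairs equals integrating $\sum_{\gamma\in\Gamma}f(\gamma x)$ over the quotient). Let $P_{\Gamma\backslash X}$ and $P_{\Gamma\backslash G}$ be the corresponding probability measures, obtained by normalising. Let $\mathcal A$ be the set of all bounded operators $A$ on $L^2(X)$ which commute with all isometries, are given by a continuous integral kernel $k_A$, and have finite propagation speed, i.e. there is $r>0$ such that for every $f\in C_c(X)$ the support of $Af$ lies in the $r$-neighbourhood of the support of $f$. Let $\mathcal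 A^2$ be the linear span of all products $AB$ with $A,B\in\mathcal A$. For a lattice $\Gamma$ and $A\in\mathcal A^2$ let $A_\Gamma$ be the operator on $L^2(\Gamma\backslash X)$ induced by $A$, i.e. $A_\Gamma(f^\Gamma)=(Af)^\Gamma$ for $f\in C_c(X)$, where $f^\Gamma(x)=\sum_{\gamma\in\Gamma}f(\gamma x)$; it is of trace class. Let $$\mathcal T(A)=\frac1{\mathrm{vol}(\Gamma\backslash X)}\int_{\Gamma\backslash X}k_A(x,x)\,dx,$$ which does not depend on the lattice $\Gamma$. Let $(\Gamma_n)$ be a sequence of lattices. It is *uniformly discrete* if there is $r>0$ with $\rho(\Gamma_n)\ge r$ for all $n$. Consider the following conditions: (a) $(\Gamma_n)$ converges spectrally to $\{1\}$: for every $A\in\mathcal A^2$ one has $\frac{1}{\mathrm{vol}(\Gamma_n\backslash X)}\mathrm{tr}(A_{\Gamma_n})\to\mathcal T(A)$ as $n\to\infty$. (b) $(\Gamma_n)$ is BS-convergent (Benjamini-Schramm convergent) to $\{1\}$ in $G$: for every compact set $C\subset G$ one has $P_{\Gamma_n\backslash G}\big(\{x\in\Gamma_n\backslash G: x^{-1}(\Gamma_n\smallsetminus\{1\})x\cap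 C\ne\emptyset\}\big)\to0$ as $n\to\infty$. (c) $(\Gamma_n\backslash X)$ is BS-convergent to $X$: for every $R>0$ one has $P_{\Gamma_n\backslash X}\big(\{x\in\Gamma_n\backslash X:\rho(\Gamma_n,x)<R\}\big)\to0$ as $n\to\infty$. If $(\Gamma_n)$ is uniformly discrete, then (a), (b) and (c) are equivalent. Without the assumption of uniform discreteness, (a) implies (b), and (b) and (c) are equivalent (so (a) also implies (c)). -/

import Mathlib

open MeasureTheory Filter Topology
open scoped ENNReal

namespace BenjaminiSchramm

/-! ### The isometry group, its action and its topology -/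

section IsometryGroup

variable {X : Type*} [MetricSpace X]

/-- The isometry group of `X` acts on `X` by evaluation. -/
instance isometryAction : MulAction (X ≃ᵢ X) X where
  smul g x := g x
  one_smul _ := rfl
  mul_smul _ _ _ := rfl

theorem smul_eq_apply (g : X ≃ᵢ X) (x : X) : g • x = g x := rfl

/-- The isometry group carries the compact-open topology. -/
instance isometryTopology : TopologicalSpace (X ≃ᵢ X) :=
  TopologicalSpace.induced (fun g => (⟨g, g.continuous⟩ : C(X, X))) inferInstance

/-- The isometry group carries its Borel σ-algebra. -/
instance isometryMeasurableSpace : MeasurableSpace (X ≃ᵢ X) := borel _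

instance isometryBorelSpace : BorelSpace (X ≃ᵢ X) := ⟨rfl⟩

theorem continuous_eval (x : X) : Continuous (fun g : X ≃ᵢ X => g x) :=
  (continuous_eval_const (F := C(X, X)) x).comp
    (continuous_induced_dom (f := fun g : X ≃ᵢ X => (⟨g, g.continuous⟩ : C(X, X))))

/-- An invariant measure: a nonzero Radon measure which is invariant under all isometries. -/
structure IsInvariantMeasure [MeasurableSpace X] [BorelSpace X] (μ : Measure X) : Prop where
  ne_zero : μ ≠ 0
  finite_on_compacts : IsFiniteMeasureOnCompacts μ
  regular : μ.Regular
  measurePreserving : ∀ φ : X ≃ᵢ X, MeasurePreserving φ μ μ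

end IsometryGroup

/-! ### Quotients and quotient measures -/

/-- The orbit space `Γ \ α`, with the quotient topology and the quotient σ-algebra. -/
abbrev OrbitSpace (Γ : Type*) (α : Type*) [Group Γ] [MulAction Γ α] : Type _ :=
  Quotient (MulAction.orbitRel Γ α)

open Classical in
/-- The measure induced on `Γ \ α` by a `Γ`-invariant measure `μ` on `α`: the image of the
restriction of `μ` to a fundamental domain. For a countable group it does not depend on the
fundamental domain, and it is the measure such that integrating `f` over `α` is the same as
integrating `∑ γ, f (γ x)` over `Γ \ α`. For a lattice, fundamental domains exist, both in `X` and
in the isometry group: see `IsLattice.exists_isFundamentalDomain` and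
`IsLattice.exists_isFundamentalDomain_group`. -/
noncomputable def quotientMeasure (Γ : Type*) {α : Type*} [Group Γ] [MulAction Γ α]
    [MeasurableSpace α] (μ : Measure α) : Measure (OrbitSpace Γ α) :=
  if h : ∃ F : Set α, IsFundamentalDomain Γ F μ then
    (μ.restrict h.choose).map (Quotient.mk _)
  else 0

/-- `P(S)`, the normalised measure on `Γ \ α` of the image `S` of a set `B ⊆ α`. -/
noncomputable def quotientProb (Γ : Type*) {α : Type*} [Group Γ] [MulAction Γ α]
    [MeasurableSpace α] (μ : Measure α) (B : Set α) : ℝ≥0∞ :=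
  quotientMeasure Γ μ ((Quotient.mk (MulAction.orbitRel Γ α)) '' B) /
    quotientMeasure Γ μ Set.univ

/-! ### Lattices -/

section Lattice

variable {X : Type*} [MetricSpace X]

/-- The `Γ`-radius `ρ(Γ, x) = inf {d(x, γ x) | γ ∈ Γ, γ ≠ 1}` at `x` (it is `∞` for trivial `Γ`). -/
noncomputable def radiusAt (Γ : Subgroup (X ≃ᵢ X)) (x : X) : ℝ≥0∞ :=
  ⨅ (γ : X ≃ᵢ X) (_ : γ ∈ Γ) (_ : γ ≠ 1), edist x (γ x)

/-- The radius `ρ(Γ) = inf_x ρ(Γ, x)`. -/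
noncomputable def radius (Γ : Subgroup (X ≃ᵢ X)) : ℝ≥0∞ :=
  ⨅ x, radiusAt Γ x

/-- A (cocompact) lattice on `X`: a group of isometries of positive radius with compact quotient. -/
structure IsLattice (Γ : Subgroup (X ≃ᵢ X)) : Prop where
  cocompact : CompactSpace (OrbitSpace Γ X)
  radius_pos : 0 < radius Γ

/-- A sequence of lattices is uniformly discrete if the radii are bounded away from zero. -/
def UniformlyDiscrete (Γ : ℕ → Subgroup (X ≃ᵢ X)) : Prop :=
  ∃ r : ℝ≥0∞, 0 < r ∧ ∀ n, r ≤ radius (Γ n)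

theorem radius_le_edist {Γ : Subgroup (X ≃ᵢ X)} {γ : X ≃ᵢ X} (hγ : γ ∈ Γ) (h1 : γ ≠ 1) (x : X) :
    radius Γ ≤ edist x (γ x) :=
  (iInf_le _ x).trans ((iInf_le _ γ).trans ((iInf_le _ hγ).trans (iInf_le _ h1)))

/-- A group of positive radius has a Borel set of representatives. -/
theorem exists_representatives [ProperSpace X] [MeasurableSpace X] [BorelSpace X]
    {Γ : Subgroup (X ≃ᵢ X)} (hΓ : 0 < radius Γ) :
    ∃ F : Set X, MeasurableSet F ∧ ∀ x, ∃! γ : Γ, γ • x ∈ F := by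
  rcases isEmpty_or_nonempty X with hX | hX
  · exact ⟨∅, MeasurableSet.empty, fun x => (hX.false x).elim⟩
  obtain ⟨r, hr0, hr⟩ : ∃ r : ℝ≥0∞, 0 < r ∧ r + r ≤ radius Γ :=
    ⟨radius Γ / 2, ENNReal.half_pos hΓ.ne', (ENNReal.add_halves _).le⟩
  let c : ℕ → X := TopologicalSpace.denseSeq X
  let U : ℕ → Set X := fun i => Metric.eball (c i) r
  have hUo : ∀ i, IsOpen (U i) := fun i => Metric.isOpen_eball
  let V : ℕ → Set X := fun i => ⋃ γ : Γ, (fun x : X => γ • x) ⁻¹' U i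
  have hVo : ∀ i, IsOpen (V i) := fun i =>
    isOpen_iUnion fun γ => (hUo i).preimage (γ : X ≃ᵢ X).continuous
  have hVinv : ∀ i (γ : Γ) x, γ • x ∈ V i → x ∈ V i := by
    intro i γ x hx
    obtain ⟨δ, hδ⟩ := Set.mem_iUnion.1 hx
    refine Set.mem_iUnion.2 ⟨δ * γ, ?_⟩
    simpa [mul_smul] using hδ
  have hcov : ∀ x, ∃ i, x ∈ V i := by
    intro x
    obtain ⟨i, hi⟩ := (TopologicalSpace.denseRange_denseSeq X).exists_mem_open
      (Metric.isOpen_eball (x := x) (ε := r)) ⟨x, Metric.mem_eball_self hr0⟩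
    refine ⟨i, Set.mem_iUnion.2 ⟨1, ?_⟩⟩
    simpa [U, c, edist_comm] using hi
  refine ⟨⋃ i, U i \ ⋃ j < i, V j, ?_, ?_⟩
  · exact MeasurableSet.iUnion fun i => (hUo i).measurableSet.diff
      (MeasurableSet.biUnion (Set.to_countable _) fun j _ => (hVo j).measurableSet)
  · intro x
    classical
    have hmem : ∀ i (γ : Γ), γ • x ∈ V i ↔ x ∈ V i := fun i γ =>
      ⟨hVinv i γ x, fun h => hVinv i γ⁻¹ _ (by simpa using h)⟩
    obtain ⟨γ, hγ⟩ := Set.mem_iUnion.1 (Nat.find_spec (hcov x))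
    refine ⟨γ, Set.mem_iUnion.2 ⟨Nat.find (hcov x), hγ, ?_⟩, ?_⟩
    · simp only [Set.mem_iUnion, not_exists, hmem]
      exact fun j hj => Nat.find_min (hcov x) hj
    · intro δ hδ
      obtain ⟨i, hi, hi'⟩ := Set.mem_iUnion.1 hδ
      have hxi : x ∈ V i := Set.mem_iUnion.2 ⟨δ, hi⟩
      have hii : i = Nat.find (hcov x) := by
        refine le_antisymm ?_ (Nat.find_min' _ hxi)
        by_contra hlt
        refine hi' (Set.mem_biUnion (not_le.1 hlt) ((hmem _ δ).2 (Nat.find_spec (hcov x))))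
      rw [← hii] at hγ
      by_contra hne
      have h1 : ((δ * γ⁻¹ : Γ) : X ≃ᵢ X) ≠ 1 := fun h => hne (mul_inv_eq_one.1 (Subtype.ext h))
      have h2 := radius_le_edist (δ * γ⁻¹).2 h1 (γ • x)
      have h3 : ((δ * γ⁻¹ : Γ) : X ≃ᵢ X) (γ • x) = δ • x := by
        change (δ * γ⁻¹) • (γ • x) = δ • x
        rw [smul_smul, inv_mul_cancel_right]
      rw [h3] at h2
      have hγ' : edist (γ • x) (c i) < r := hγ
      have hδ' : edist (c i) (δ • x) < r := by rw [edist_comm]; exact hi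
      exact absurd (h2.trans (edist_triangle _ (c i) _))
        (not_le.2 ((ENNReal.add_lt_add hγ' hδ').trans_le hr))

theorem IsLattice.exists_isFundamentalDomain [ProperSpace X] [MeasurableSpace X] [BorelSpace X]
    {Γ : Subgroup (X ≃ᵢ X)} (hΓ : IsLattice Γ) (μ : Measure X) :
    ∃ F : Set X, IsFundamentalDomain Γ F μ :=
  let ⟨F, hF, h⟩ := exists_representatives hΓ.radius_pos
  ⟨F, IsFundamentalDomain.mk' hF.nullMeasurableSet h⟩

theorem IsLattice.exists_isFundamentalDomain_group [ProperSpace X]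
    {Γ : Subgroup (X ≃ᵢ X)} (hΓ : IsLattice Γ) [Nonempty X] (η : Measure (X ≃ᵢ X)) :
    ∃ F : Set (X ≃ᵢ X), IsFundamentalDomain Γ F η := by
  borelize X
  obtain ⟨F, hF, h⟩ := exists_representatives hΓ.radius_pos
  let x₀ : X := Classical.arbitrary X
  exact ⟨(fun g : X ≃ᵢ X => g x₀) ⁻¹' F, IsFundamentalDomain.mk'
    ((continuous_eval x₀).measurable hF).nullMeasurableSet fun g => h (g x₀)⟩

end Lattice

/-! ### Benjamini-Schramm convergence -/

section BenjaminiSchrammConvergence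

variable {X : Type*} [MetricSpace X]

/-- `(Γ_n \ X)` is BS-convergent to `X`: for every `R > 0`, the probability
`P({x ∈ Γ_n \ X | ρ(Γ_n, x) < R})` tends to zero. -/
def BSConvergesToSpace [MeasurableSpace X] (μ : Measure X) (Γ : ℕ → Subgroup (X ≃ᵢ X)) : Prop :=
  ∀ R : ℝ, 0 < R → Tendsto
    (fun n => quotientProb (Γ n) μ {x : X | radiusAt (Γ n) x < ENNReal.ofReal R}) atTop (𝓝 0)

/-- `(Γ_n)` is BS-convergent to `{1}` in the isometry group `G`: for every compact `C ⊆ G`, the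
probability `P({x ∈ Γ_n \ G | x⁻¹ (Γ_n ∖ {1}) x ∩ C ≠ ∅})` tends to zero. Here `η` is a Haar
measure on `G` and `Γ_n` acts on `G` by left multiplication. -/
def BSConvergesToOne (η : Measure (X ≃ᵢ X)) (Γ : ℕ → Subgroup (X ≃ᵢ X)) : Prop :=
  ∀ C : Set (X ≃ᵢ X), IsCompact C → Tendsto
    (fun n => quotientProb (Γ n) η {x : X ≃ᵢ X | ∃ γ ∈ Γ n, γ ≠ 1 ∧ x⁻¹ * γ * x ∈ C})
    atTop (𝓝 0)

end BenjaminiSchrammConvergence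

/-! ### Invariant operators and spectral convergence -/

section Spectral

/-- `T` is of trace class with trace `t`: for every orthonormal basis `b` the series
`∑ ⟨b i, T (b i)⟩` converges unconditionally, with sum `t`. -/
def HasTrace {H : Type*} [NormedAddCommGroup H] [InnerProductSpace ℂ H] (T : H →L[ℂ] H)
    (t : ℂ) : Prop :=
  ∀ (ι : Set H) (b : HilbertBasis ι ℂ H), HasSum (fun i => inner ℂ (b i) (T (b i))) t

variable {X : Type*} [MetricSpace X] [MeasurableSpace X] [BorelSpace X]

/-- `A` commutes with all `L_φ`, where `L_φ f = f ∘ φ⁻¹` for an isometry `φ`. -/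
def IsInvariantOperator (μ : Measure X) (A : Lp ℂ 2 μ →L[ℂ] Lp ℂ 2 μ) : Prop :=
  ∀ (φ : X ≃ᵢ X) (f g : Lp ℂ 2 μ), g =ᵐ[μ] (fun x => f (φ⁻¹ • x)) →
    A g =ᵐ[μ] fun x => A f (φ⁻¹ • x)

/-- `k` is a continuous integral kernel of `A`: `A f (x) = ∫ k(x, y) f(y) dy` for `f ∈ C_c(X)`. -/
def IsContinuousKernel (μ : Measure X) (A : Lp ℂ 2 μ →L[ℂ] Lp ℂ 2 μ) (k : X → X → ℂ) : Prop :=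
  Continuous (Function.uncurry k) ∧
    ∀ f : X → ℂ, Continuous f → HasCompactSupport f → ∀ u : Lp ℂ 2 μ, u =ᵐ[μ] f →
      A u =ᵐ[μ] fun x => ∫ y, k x y * f y ∂μ

/-- `A` has finite propagation speed: for some `r > 0`, the support of `A f` lies in the
`r`-neighbourhood of the support of `f`, for all `f ∈ C_c(X)`. -/
def HasFinitePropagationSpeed (μ : Measure X) (A : Lp ℂ 2 μ →L[ℂ] Lp ℂ 2 μ) : Prop :=
  ∃ r : ℝ, 0 < r ∧ ∀ f : X → ℂ, Continuous f → HasCompactSupport f →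
    ∀ u : Lp ℂ 2 μ, u =ᵐ[μ] f → ∀ᵐ x ∂μ, x ∉ Metric.thickening r (tsupport f) → A u x = 0

/-- The algebra `𝒜` of all operators on `L²(X)` which are invariant under all isometries, are given
by a continuous integral kernel, and have finite propagation speed. -/
def kernelAlgebra (μ : Measure X) : Set (Lp ℂ 2 μ →L[ℂ] Lp ℂ 2 μ) :=
  {A | IsInvariantOperator μ A ∧ (∃ k, IsContinuousKernel μ A k) ∧ HasFinitePropagationSpeed μ A}

/-- The algebra `𝒜²` of all linear combinations of operators `A B` with `A, B ∈ 𝒜`. -/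
noncomputable def kernelAlgebraSq (μ : Measure X) : Submodule ℂ (Lp ℂ 2 μ →L[ℂ] Lp ℂ 2 μ) :=
  Submodule.span ℂ {C | ∃ A ∈ kernelAlgebra μ, ∃ B ∈ kernelAlgebra μ, C = A.comp B}

/-- For a function `f` on `X`, the function `f^Γ (x) = ∑_{γ ∈ Γ} f(γ x)` on `Γ \ X`. -/
noncomputable def periodize (Γ : Subgroup (X ≃ᵢ X)) (f : X → ℂ) : OrbitSpace Γ X → ℂ :=
  Quotient.lift (fun x => ∑' γ : Γ, f (γ • x)) (by
    rintro x y ⟨δ, rfl⟩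
    have h := (Equiv.mulRight δ).tsum_eq (fun γ : Γ => f (γ • y))
    simpa [mul_smul] using h)

/-- `T` is the operator `A_Γ` on `L²(Γ \ X)` induced by `A`, that is, the bounded operator with
`A_Γ (f^Γ) = (A f)^Γ` for all `f ∈ C_c(X)`. For a lattice, the functions `f^Γ` are all continuous
functions on `Γ \ X`, so there is at most one such operator. -/
def IsInducedOperator (μ : Measure X) (A : Lp ℂ 2 μ →L[ℂ] Lp ℂ 2 μ) (Γ : Subgroup (X ≃ᵢ X))
    (T : Lp ℂ 2 (quotientMeasure Γ μ) →L[ℂ] Lp ℂ 2 (quotientMeasure Γ μ)) : Prop :=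
  ∀ f : X → ℂ, Continuous f → HasCompactSupport f → ∀ u : Lp ℂ 2 μ, u =ᵐ[μ] f →
    ∀ v : Lp ℂ 2 (quotientMeasure Γ μ), v =ᵐ[quotientMeasure Γ μ] periodize Γ f →
      T v =ᵐ[quotientMeasure Γ μ] periodize Γ (A u)

/-- The volume of `Γ \ X`. -/
noncomputable def covolume (μ : Measure X) (Γ : Subgroup (X ≃ᵢ X)) : ℝ :=
  (quotientMeasure Γ μ).real Set.univ

/-- `(1 / vol(Γ \ X)) ∫_{Γ \ X} k(x, x) dx`, for a kernel `k` invariant under all isometries. The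
function `x ↦ k(x, x)` is constant on orbits, so any representative of an orbit can be used. -/
noncomputable def kernelMean (μ : Measure X) (Γ : Subgroup (X ≃ᵢ X)) (k : X → X → ℂ) : ℂ :=
  (∫ q : OrbitSpace Γ X, k q.out q.out ∂(quotientMeasure Γ μ)) / (covolume μ Γ : ℂ)

/-- `(Γ_n)` converges spectrally to `{1}`: for every `A ∈ 𝒜²`, with continuous kernel `k`, the
operators `A_{Γ_n}` are of trace class and `tr(A_{Γ_n}) / vol(Γ_n \ X)` tends to
`𝒯(A) = (1 / vol(Λ \ X)) ∫_{Λ \ X} k(x, x) dx`, a number which is the same for all lattices `Λ`. -/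
def SpectrallyConvergesToOne (μ : Measure X) (Γ : ℕ → Subgroup (X ≃ᵢ X)) : Prop :=
  ∀ A ∈ kernelAlgebraSq μ, ∃ k : X → X → ℂ, IsContinuousKernel μ A k ∧
    ∃ (T : ∀ n, Lp ℂ 2 (quotientMeasure (Γ n) μ) →L[ℂ] Lp ℂ 2 (quotientMeasure (Γ n) μ))
      (t : ℕ → ℂ),
      (∀ n, IsInducedOperator μ A (Γ n) (T n) ∧ HasTrace (T n) (t n)) ∧
      ∀ Λ : Subgroup (X ≃ᵢ X), IsLattice Λ →
        Tendsto (fun n => t n / (covolume μ (Γ n) : ℂ)) atTop (𝓝 (kernelMean μ Λ k))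

end Spectral

end BenjaminiSchramm

/-!
Write `G` for the isometry group of the proper space `X`, `F` for a fundamental domain of a lattice
`Γ` in `X`, and `E` for one in `G`.

*Comparison of the two quotients.* Fix `x₀ : X`. A function on `G × X` which is invariant under the
diagonal action of `Γ` may be integrated over `E × X` or over `G × F`
(`lintegral_diagonal_unfold`). Applied to the indicator function of `{(g, y) | d(g x₀, y) < S}`
times a `Γ`-invariant function of `y`, this gives `lintegral_ball_eq`: averaging over balls centred
at `g x₀`, `g ∈ Γ \ G`, is integration over `Γ \ X` against the weight `orbitMass`, the Haar measure
of `{g | d(g x₀, y) < S}`. A cocompact group moves `x₀` within bounded distance of every point, so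
this weight is bounded above and below, with bounds that do not involve `Γ`. Hence the probability
in `Γ \ G` of the points where a nontrivial element has short displacement at `g x₀` and the
probability in `Γ \ X` of the points of small radius bound each other up to constants and a change
of the cutoff. Compact subsets of `G` are exactly the closed sets of isometries moving `x₀` by a
bounded amount, which gives the equivalence of the two notions of Benjamini-Schramm convergence
(`bsConvergesToOne_iff`). The same unfolding, with the weight inverted, shows that the mean of a
`G`-invariant function over `Γ \ X` does not depend on `Γ` (`kernelMean_eq_kernelMean`); only left
invariance of the Haar measure is used.

*Trace formula.* The kernel `k` of an operator in `𝒜` is invariant and of finite range, since a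
continuous kernel is determined by its operator. For a lattice, the periodised kernel
`∑ γ, k(x, γ y)` is a finite sum, it is bounded, and its integral operator is the induced operator,
the only one because periodised test functions are dense in `L²(Γ \ X)`. For a product of two
operators, Parseval's identity followed by integration term by term shows that the trace is the
integral of the periodised kernel over the diagonal (`hasTrace_of_isKernelOperator`,
`exists_inducedOperator_hasTrace`). Therefore the normalised trace minus `𝒯(A)` is the normalised
integral over `F` of `∑ γ ≠ 1, k(x, γ x)`.

*Benjamini-Schramm convergence and uniform discreteness imply spectral convergence.* If `k` vanishes
at distances beyond `r < R`, the integrand is supported on the points of radius less than `R`. There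
it is bounded by `‖k‖` times a number of lattice elements which, by a packing argument
(`exists_card_le`), depends only on a lower bound for the radius of `Γ`.

*Spectral convergence implies Benjamini-Schramm convergence.* For the square of the operator whose
kernel is a nonnegative cutoff function of the distance, the integrand is nonnegative, and it is at
least a positive constant at the points of radius less than `R`. So the probability of these points
is bounded by a constant times the distance from the normalised trace to `𝒯(A)`.
-/

namespace BenjaminiSchramm

set_option linter.unusedSectionVars false

/-! ### Topology of the isometry group -/

section IsometryGroup

variable {X : Type*} [MetricSpace X]

instance continuousConstSMul_subgroup (Γ : Subgroup (X ≃ᵢ X)) : ContinuousConstSMul Γ X :=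
  ⟨fun γ => (γ : X ≃ᵢ X).continuous⟩

/-- An isometry as an element of `C(X, X)`; by definition, this map induces the topology of the
isometry group. -/
def toContinuousMap (g : X ≃ᵢ X) : C(X, X) := ⟨g, g.continuous⟩

theorem isInducing_toContinuousMap : IsInducing (toContinuousMap (X := X)) := ⟨rfl⟩

/-- Left translations are continuous, which is all that the action of a lattice on the isometry
group requires. -/
theorem continuous_mul_left_isometry (h : X ≃ᵢ X) : Continuous fun g : X ≃ᵢ X => h * g := by
  rw [isInducing_toContinuousMap.continuous_iff]
  exact (ContinuousMap.continuous_postcomp (toContinuousMap h)).comp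
    isInducing_toContinuousMap.continuous

instance continuousConstSMul_group (Γ : Subgroup (X ≃ᵢ X)) :
    ContinuousConstSMul Γ (X ≃ᵢ X) :=
  ⟨fun γ => continuous_mul_left_isometry (γ : X ≃ᵢ X)⟩

/-- Pointwise convergence of isometries implies convergence in the compact-open topology. -/
theorem tendsto_isometry_of_pointwise {ι : Type*} {l : Filter ι} {u : ι → X ≃ᵢ X} {g : X ≃ᵢ X}
    (h : ∀ x, Tendsto (fun i => u i x) l (𝓝 (g x))) : Tendsto u l (𝓝 g) := by
  rw [isInducing_toContinuousMap.tendsto_nhds_iff]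
  apply ContinuousMap.tendsto_of_tendstoLocallyUniformly
  rw [Metric.tendstoLocallyUniformly_iff]
  intro ε hε x
  refine ⟨Metric.ball x (ε / 3), Metric.ball_mem_nhds x (by positivity), ?_⟩
  filter_upwards [Metric.tendsto_nhds.1 (h x) (ε / 3) (by positivity)] with i hi y hy
  have h1 : dist (g y) (g x) < ε / 3 := by rw [g.dist_eq]; exact hy
  have h2 : dist (u i x) (u i y) < ε / 3 := by
    rw [(u i).dist_eq, dist_comm]; exact hy
  have h3 : dist (g x) (u i x) < ε / 3 := by rw [dist_comm]; exact hi
  change dist (g y) (u i y) < ε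
  linarith [dist_triangle (g y) (g x) (u i y), dist_triangle (g x) (u i x) (u i y)]

/-- Compact sets of isometries move a point by a bounded amount. -/
theorem exists_dist_le_of_isCompact {C : Set (X ≃ᵢ X)} (hC : IsCompact C) (x₀ : X) :
    ∃ R : ℝ, ∀ g ∈ C, dist (g x₀) x₀ ≤ R := by
  obtain ⟨R, hR⟩ := (hC.image (continuous_eval x₀)).isBounded.subset_closedBall x₀
  exact ⟨R, fun g hg => hR ⟨g, hg, rfl⟩⟩

variable [ProperSpace X]

/-- In a proper space, the isometries which move a given point by a bounded amount form a compact
set: a limit of isometries along an ultrafilter exists pointwise, and the limit of the inverses is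
its inverse. -/
theorem isCompact_setOf_dist_le (x₀ y₀ : X) (R : ℝ) :
    IsCompact {g : X ≃ᵢ X | dist (g x₀) y₀ ≤ R} := by
  rw [isCompact_iff_ultrafilter_le_nhds]
  intro U hU
  have hU' : ∀ᶠ g : X ≃ᵢ X in U, dist (g x₀) y₀ ≤ R := le_principal_iff.1 hU
  have key : ∀ (F : (X ≃ᵢ X) → X) (c : X) (r : ℝ), (∀ᶠ g in (U : Filter (X ≃ᵢ X)),
      dist (F g) c ≤ r) → ∃ y, Tendsto F U (𝓝 y) := by
    intro F c r hF
    obtain ⟨y, -, hy⟩ := isCompact_iff_ultrafilter_le_nhds.1 (isCompact_closedBall c r)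
      (U.map F) (le_principal_iff.2 hF)
    exact ⟨y, hy⟩
  have h1 : ∀ x, ∃ y, Tendsto (fun g : X ≃ᵢ X => g x) U (𝓝 y) := by
    intro x
    refine key _ y₀ (dist x x₀ + R) ?_
    filter_upwards [hU'] with g hg
    calc dist (g x) y₀ ≤ dist (g x) (g x₀) + dist (g x₀) y₀ := dist_triangle _ _ _
      _ ≤ _ := by rw [g.dist_eq]; gcongr
  have h2 : ∀ x, ∃ y, Tendsto (fun g : X ≃ᵢ X => g.symm x) U (𝓝 y) := by
    intro x
    refine key _ x₀ (dist x y₀ + R) ?_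
    filter_upwards [hU'] with g hg
    have : dist (g.symm x) x₀ = dist x (g x₀) := by
      rw [← g.dist_eq, g.apply_symm_apply]
    rw [this]
    have := dist_triangle x y₀ (g x₀)
    rw [dist_comm y₀] at this
    linarith
  choose f hf using h1
  choose k hk using h2
  have hfi : Isometry f := Isometry.of_dist_eq fun x y => by
    refine tendsto_nhds_unique ((hf x).dist (hf y)) ?_
    simp only [IsometryEquiv.dist_eq]
    exact tendsto_const_nhds
  have hfk : ∀ y, f (k y) = y := by
    intro y
    have : Tendsto (fun g : X ≃ᵢ X => dist (g (k y)) (g (g.symm y))) U (𝓝 (dist (k y) (k y))) := by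
      simp only [IsometryEquiv.dist_eq]
      exact tendsto_const_nhds.dist (hk y)
    simp only [IsometryEquiv.apply_symm_apply] at this
    have h3 := tendsto_nhds_unique this ((hf (k y)).dist tendsto_const_nhds)
    rw [dist_self] at h3
    exact (dist_eq_zero.1 h3.symm)
  let φ : X ≃ᵢ X := IsometryEquiv.mk' f k hfk hfi
  refine ⟨φ, ?_, tendsto_isometry_of_pointwise (u := id) hf⟩
  exact le_of_tendsto ((hf x₀).dist tendsto_const_nhds) hU'

instance sigmaCompact_isometry : SigmaCompactSpace (X ≃ᵢ X) := by
  rcases isEmpty_or_nonempty X with hX | ⟨⟨x₀⟩⟩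
  · have : Subsingleton (X ≃ᵢ X) := ⟨fun f g => IsometryEquiv.ext fun x => (hX.false x).elim⟩
    infer_instance
  · refine ⟨⟨fun n => {g : X ≃ᵢ X | dist (g x₀) x₀ ≤ n}, fun n => isCompact_setOf_dist_le _ _ _,
      ?_⟩⟩
    refine Set.eq_univ_of_forall fun g => Set.mem_iUnion.2 ?_
    exact exists_nat_ge (dist (g x₀) x₀)

end IsometryGroup

section Invariance

variable {X : Type*} [MetricSpace X]

theorem IsInvariantMeasure.smulInvariantMeasure [MeasurableSpace X] [BorelSpace X] {μ : Measure X}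
    (hμ : IsInvariantMeasure μ) (Γ : Subgroup (X ≃ᵢ X)) : SMulInvariantMeasure Γ X μ :=
  ⟨fun γ _ hs => (hμ.measurePreserving (γ : X ≃ᵢ X)).measure_preimage hs.nullMeasurableSet⟩

theorem smulInvariantMeasure_group (η : Measure (X ≃ᵢ X)) [η.IsHaarMeasure]
    (Γ : Subgroup (X ≃ᵢ X)) : SMulInvariantMeasure Γ (X ≃ᵢ X) η :=
  ⟨fun γ s hs => by
    have h := map_mul_left_eq_self η (γ : X ≃ᵢ X)
    conv_rhs => rw [← h]
    rw [Measure.map_apply (continuous_mul_left_isometry _).measurable hs]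
    rfl⟩

/-- A cocompact group of isometries acts coarsely transitively. -/
theorem IsLattice.exists_dist_le {Γ : Subgroup (X ≃ᵢ X)} (hΓ : IsLattice Γ) (x₀ : X) :
    ∃ D : ℝ, ∀ x, ∃ γ : Γ, dist (γ • x₀) x ≤ D := by
  have := hΓ.cocompact
  have hop : ∀ n : ℕ, IsOpen (Quotient.mk (MulAction.orbitRel Γ X) '' Metric.ball x₀ n) :=
    fun n => isOpenMap_quotient_mk'_mul _ Metric.isOpen_ball
  obtain ⟨n, hn⟩ := isCompact_univ.elim_directed_cover _ hop
    (fun q _ => by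
      induction q using Quotient.inductionOn with
      | h x =>
      obtain ⟨n, hn⟩ := exists_nat_gt (dist x x₀)
      exact Set.mem_iUnion.2 ⟨n, x, hn, rfl⟩)
    (directed_of_isDirected_le fun m n hmn => Set.image_mono
      (Metric.ball_subset_ball (by exact_mod_cast hmn)))
  refine ⟨n, fun x => ?_⟩
  obtain ⟨y, hy, hxy⟩ := hn (Set.mem_univ (Quotient.mk _ x))
  obtain ⟨γ, hγ⟩ := Quotient.exact hxy
  refine ⟨γ⁻¹, ?_⟩
  change γ • x = y at hγ
  have : dist (γ⁻¹ • x₀) x = dist x₀ (γ • x) := by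
    rw [← (γ : X ≃ᵢ X).dist_eq]
    congr 1
    exact smul_inv_smul γ x₀
  rw [this, hγ, dist_comm]
  exact (Metric.mem_ball.1 hy).le

variable [ProperSpace X]

/-- Packing bound: if each point lies within `D` of the orbit of `x₀`, then the number of elements
`γ` of `Γ` with `d(x, γ y) ≤ r` is bounded in terms of the radius of `Γ` only. -/
theorem exists_card_le (x₀ : X) {D : ℝ} (hD : ∀ x, ∃ g : X ≃ᵢ X, dist (g x₀) x ≤ D)
    {ε : ℝ≥0∞} (hε : 0 < ε) (r : ℝ) :
    ∃ N : ℕ, ∀ Γ : Subgroup (X ≃ᵢ X), ε ≤ radius Γ → ∀ x y : X,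
      {γ : Γ | dist x (γ • y) ≤ r}.Finite ∧ {γ : Γ | dist x (γ • y) ≤ r}.ncard ≤ N := by
  obtain ⟨δ, hδ0, hδ⟩ : ∃ δ : ℝ, 0 < δ ∧ ENNReal.ofReal (δ + δ) ≤ ε := by
    obtain ⟨e, he0, he⟩ := ENNReal.lt_iff_exists_nnreal_btwn.1 hε
    refine ⟨e / 2, by simpa using he0, ?_⟩
    rw [add_halves, ENNReal.ofReal_coe_nnreal]
    exact he.le
  -- a ball of radius `δ` contains at most one point of `g⁻¹ Γ y`
  obtain ⟨t, -, htf, ht⟩ := (isCompact_closedBall x₀ (r + D)).finite_cover_balls hδ0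
  refine ⟨t.ncard, fun Γ hΓ x y => ?_⟩
  obtain ⟨g, hg⟩ := hD x
  have hmem : ∀ γ : Γ, dist x (γ • y) ≤ r → ∃ c ∈ t, dist (g.symm (γ • y)) c < δ := by
    intro γ hγ
    have h1 : g.symm (γ • y) ∈ Metric.closedBall x₀ (r + D) := by
      rw [Metric.mem_closedBall, ← g.dist_eq, g.apply_symm_apply]
      have := dist_triangle (γ • y) x (g x₀)
      rw [dist_comm _ x, dist_comm x (g x₀)] at this
      linarith
    simpa using ht h1
  have : Nonempty X := ⟨x₀⟩
  choose! c hct hc using hmem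
  have hinj : Set.InjOn c {γ : Γ | dist x (γ • y) ≤ r} := by
    intro γ hγ γ' hγ' h
    by_contra hne
    have h1 : ((γ' * γ⁻¹ : Γ) : X ≃ᵢ X) ≠ 1 := fun h => hne (mul_inv_eq_one.1 (Subtype.ext h)).symm
    have h2 := radius_le_edist (γ' * γ⁻¹).2 h1 (γ • y)
    have h3 : ((γ' * γ⁻¹ : Γ) : X ≃ᵢ X) (γ • y) = γ' • y := by
      change (γ' * γ⁻¹) • (γ • y) = γ' • y
      rw [smul_smul, inv_mul_cancel_right]
    rw [h3, edist_dist] at h2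
    have h4 : dist (γ • y) (γ' • y) < δ + δ := by
      rw [← g.symm.dist_eq]
      have h5 := hc γ hγ
      have h6 := hc γ' hγ'
      rw [← h] at h6
      have := dist_triangle_right (g.symm (γ • y)) (g.symm (γ' • y)) (c γ)
      linarith
    exact absurd ((hδ.trans hΓ).trans h2)
      (not_le.2 ((ENNReal.ofReal_lt_ofReal_iff (by positivity)).2 h4))
  have hmaps : Set.MapsTo c {γ : Γ | dist x (γ • y) ≤ r} t := fun γ hγ => hct γ hγ
  exact ⟨Set.Finite.of_injOn hmaps hinj htf, Set.ncard_le_ncard_of_injOn c hmaps hinj htf⟩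

theorem IsLattice.countable {Γ : Subgroup (X ≃ᵢ X)} (hΓ : IsLattice Γ) [Nonempty X] :
    Countable Γ := by
  let x₀ : X := Classical.arbitrary X
  -- the orbit map of `x₀` is injective with separated image
  obtain ⟨δ, hδ0, hδ⟩ := ENNReal.lt_iff_exists_nnreal_btwn.1 hΓ.radius_pos
  have hsep : ∀ γ γ' : Γ, γ ≠ γ' → (δ : ℝ≥0∞) < edist (γ • x₀) (γ' • x₀) := by
    intro γ γ' hne
    have h1 : ((γ' * γ⁻¹ : Γ) : X ≃ᵢ X) ≠ 1 := fun h => hne (mul_inv_eq_one.1 (Subtype.ext h)).symm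
    have h2 := radius_le_edist (γ' * γ⁻¹).2 h1 (γ • x₀)
    have h3 : ((γ' * γ⁻¹ : Γ) : X ≃ᵢ X) (γ • x₀) = γ' • x₀ := by
      change (γ' * γ⁻¹) • (γ • x₀) = γ' • x₀
      rw [smul_smul, inv_mul_cancel_right]
    rw [h3] at h2
    exact hδ.trans_le h2
  have hδr : (0 : ℝ) < δ := by simpa using hδ0
  have hdisj : Pairwise (Function.onFun Disjoint fun γ : Γ => Metric.ball (γ • x₀) ((δ : ℝ) / 2)) := by
    intro γ γ' hne
    apply Metric.ball_disjoint_ball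
    have := hsep γ γ' hne
    rw [edist_nndist, ENNReal.coe_lt_coe] at this
    rw [add_halves]
    exact_mod_cast this.le
  exact hdisj.countable_of_isOpen_disjoint (fun γ => Metric.isOpen_ball)
    (fun γ => ⟨_, Metric.mem_ball_self (by positivity)⟩)

end Invariance

/-! ### Unfolding over fundamental domains -/

section FundamentalDomain

variable {Γ α β : Type*} [Group Γ] [Countable Γ]
  [MulAction Γ α] [MeasurableSpace α] [MeasurableConstSMul Γ α]
  [MulAction Γ β] [MeasurableSpace β] [MeasurableConstSMul Γ β]
  {μ : Measure α} [SMulInvariantMeasure Γ α μ] {ν : Measure β} [SMulInvariantMeasure Γ β ν]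
  {F : Set α} {E : Set β}

theorem measurable_orbitMk : Measurable (Quotient.mk (MulAction.orbitRel Γ α)) :=
  measurable_quotient_mk''

theorem quotientMeasure_eq_map (hF : IsFundamentalDomain Γ F μ) :
    quotientMeasure Γ μ = (μ.restrict F).map (Quotient.mk (MulAction.orbitRel Γ α)) := by
  have h : ∃ F : Set α, IsFundamentalDomain Γ F μ := ⟨F, hF⟩
  rw [quotientMeasure, dif_pos h]
  exact IsFundamentalDomain.quotientMeasure_eq μ h.choose_spec hF

theorem quotientMeasure_univ (hF : IsFundamentalDomain Γ F μ) :
    quotientMeasure Γ μ Set.univ = μ F := by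
  rw [quotientMeasure_eq_map hF, Measure.map_apply measurable_orbitMk MeasurableSet.univ]
  simp

/-- The normalised measure of an invariant set, computed in a fundamental domain. -/
theorem quotientProb_eq (hF : IsFundamentalDomain Γ F μ) {B : Set α} (hB : MeasurableSet B)
    (hinv : ∀ (γ : Γ) (x : α), x ∈ B → γ • x ∈ B) :
    quotientProb Γ μ B = μ (B ∩ F) / μ F := by
  have hpre : Quotient.mk (MulAction.orbitRel Γ α) ⁻¹'
      (Quotient.mk (MulAction.orbitRel Γ α) '' B) = B := by
    refine Set.Subset.antisymm ?_ (Set.subset_preimage_image _ _)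
    rintro x ⟨y, hy, hxy⟩
    obtain ⟨γ, hγ⟩ := Quotient.exact hxy
    have hγ' : γ • x = y := hγ
    have := hinv γ⁻¹ y hy
    rwa [← hγ', inv_smul_smul] at this
  rw [quotientProb, quotientMeasure_univ hF, quotientMeasure_eq_map hF,
    Measure.map_apply measurable_orbitMk (measurableSet_quotient.2 (by rw [← hpre] at hB; exact hB)),
    hpre, Measure.restrict_apply hB]

/-- The unfolding formula for Lebesgue integrals. -/
theorem lintegral_eq_setLIntegral_tsum (hF : IsFundamentalDomain Γ F μ) {f : α → ℝ≥0∞}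
    (hf : Measurable f) : ∫⁻ x, f x ∂μ = ∫⁻ x in F, ∑' γ : Γ, f (γ • x) ∂μ := by
  rw [hF.lintegral_eq_tsum'', lintegral_tsum]
  exact fun γ => (hf.comp (measurable_const_smul γ)).aemeasurable

/-- Unfolding on a product: a function on `β × α` which is invariant under the diagonal action can
be integrated over a fundamental domain in either factor. -/
theorem lintegral_diagonal_unfold [SFinite μ] [SFinite ν] (hF : IsFundamentalDomain Γ F μ)
    (hE : IsFundamentalDomain Γ E ν) {φ : β → α → ℝ≥0∞} (hφ : Measurable (Function.uncurry φ))
    (hinv : ∀ (γ : Γ) (g : β) (y : α), φ (γ • g) (γ • y) = φ g y) :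
    ∫⁻ g in E, ∫⁻ y, φ g y ∂μ ∂ν = ∫⁻ y in F, ∫⁻ g, φ g y ∂ν ∂μ := by
  have hm : ∀ γ : Γ, Measurable (Function.uncurry fun (g : β) (y : α) => φ g (γ • y)) := fun γ =>
    hφ.comp (measurable_fst.prodMk (measurable_snd.const_smul γ))
  calc ∫⁻ g in E, ∫⁻ y, φ g y ∂μ ∂ν
      = ∫⁻ g in E, ∑' γ : Γ, ∫⁻ y in F, φ g (γ • y) ∂μ ∂ν := by
        simp_rw [hF.lintegral_eq_tsum'']
    _ = ∑' γ : Γ, ∫⁻ g in E, ∫⁻ y in F, φ g (γ • y) ∂μ ∂ν :=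
        lintegral_tsum fun γ => (hm γ).lintegral_prod_right.aemeasurable
    _ = ∑' γ : Γ, ∫⁻ y in F, ∫⁻ g in E, φ g (γ • y) ∂ν ∂μ :=
        tsum_congr fun γ => lintegral_lintegral_swap (hm γ).aemeasurable
    _ = ∑' γ : Γ, ∫⁻ y in F, ∫⁻ g in E, φ (γ⁻¹ • g) y ∂ν ∂μ := by
        refine tsum_congr fun γ => ?_
        congr with y
        congr with g
        rw [← hinv γ⁻¹ g (γ • y), inv_smul_smul]
    _ = ∫⁻ y in F, ∑' γ : Γ, ∫⁻ g in E, φ (γ⁻¹ • g) y ∂ν ∂μ := by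
        refine (lintegral_tsum fun γ => ?_).symm
        have hm' : Measurable (Function.uncurry fun (g : β) (y : α) => φ (γ⁻¹ • g) y) :=
          hφ.comp ((measurable_fst.const_smul γ⁻¹).prodMk measurable_snd)
        exact hm'.lintegral_prod_left.aemeasurable
    _ = ∫⁻ y in F, ∫⁻ g, φ g y ∂ν ∂μ := by
        simp_rw [hE.lintegral_eq_tsum']

end FundamentalDomain

/-! ### Comparing measures on the two quotients -/

section Comparison

variable {X : Type*} [MetricSpace X] [ProperSpace X]

/-- The Haar measure of the set of isometries which move `x₀` into the ball of radius `S`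
around `y`. It is invariant under all isometries in `y`; it serves as the weight in the comparison
of `Γ \ G` with `Γ \ X`. -/
noncomputable def orbitMass (η : Measure (X ≃ᵢ X)) (x₀ : X) (S : ℝ) (y : X) : ℝ≥0∞ :=
  η {g : X ≃ᵢ X | dist (g x₀) y < S}

section OrbitMass

variable (η : Measure (X ≃ᵢ X)) [η.IsHaarMeasure] (x₀ : X)

theorem orbitMass_apply (S : ℝ) (h : X ≃ᵢ X) (y : X) :
    orbitMass η x₀ S (h y) = orbitMass η x₀ S y := by
  have hopen : IsOpen {g : X ≃ᵢ X | dist (g x₀) (h y) < S} :=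
    isOpen_lt ((continuous_eval x₀).dist continuous_const) continuous_const
  rw [orbitMass]
  conv_lhs => rw [← map_mul_left_eq_self η h]
  rw [Measure.map_apply (continuous_mul_left_isometry h).measurable hopen.measurableSet, orbitMass]
  congr 1
  ext g
  change dist (h (g x₀)) (h y) < S ↔ dist (g x₀) y < S
  rw [h.dist_eq]

theorem orbitMass_mono {S T : ℝ} {y z : X} (h : S + dist y z ≤ T) :
    orbitMass η x₀ S y ≤ orbitMass η x₀ T z :=
  measure_mono fun g (hg : dist (g x₀) y < S) => by
    change dist (g x₀) z < T
    linarith [dist_triangle (g x₀) y z]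

theorem orbitMass_lt_top (S : ℝ) (y : X) : orbitMass η x₀ S y < ∞ :=
  (measure_mono (t := {g : X ≃ᵢ X | dist (g x₀) y ≤ S}) fun g (hg : dist (g x₀) y < S) =>
    hg.le).trans_lt (isCompact_setOf_dist_le x₀ y S).measure_lt_top

theorem orbitMass_self_pos {S : ℝ} (hS : 0 < S) : 0 < orbitMass η x₀ S x₀ := by
  refine IsOpen.measure_pos η ?_ ⟨1, ?_⟩
  · exact isOpen_lt ((continuous_eval x₀).dist continuous_const) continuous_const
  · change dist x₀ x₀ < S
    rwa [dist_self]

theorem orbitMass_le (S : ℝ) (y : X) : orbitMass η x₀ S y ≤ orbitMass η x₀ (2 * S) x₀ := by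
  rcases Set.eq_empty_or_nonempty {g : X ≃ᵢ X | dist (g x₀) y < S} with h | ⟨g, hg⟩
  · rw [orbitMass, h, measure_empty]
    exact zero_le
  · have hg' : dist (g x₀) y < S := hg
    rw [← orbitMass_apply η x₀ (2 * S) g x₀]
    refine orbitMass_mono η x₀ ?_
    rw [dist_comm]
    linarith

theorem le_orbitMass {D : ℝ} (hD : ∀ x, ∃ g : X ≃ᵢ X, dist (g x₀) x ≤ D) (y : X) :
    orbitMass η x₀ 1 x₀ ≤ orbitMass η x₀ (D + 1) y := by
  obtain ⟨g, hg⟩ := hD y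
  rw [← orbitMass_apply η x₀ 1 g x₀]
  exact orbitMass_mono η x₀ (by linarith)

theorem measurable_orbitMass [MeasurableSpace X] [BorelSpace X] (S : ℝ) :
    Measurable (orbitMass η x₀ S) := by
  have hopen : IsOpen {p : (X ≃ᵢ X) × X | dist (p.1 x₀) p.2 < S} :=
    isOpen_lt (((continuous_eval x₀).comp continuous_fst).dist continuous_snd) continuous_const
  exact measurable_measure_prodMk_right hopen.measurableSet

end OrbitMass

variable [MeasurableSpace X] [BorelSpace X] {μ : Measure X} {Γ : Subgroup (X ≃ᵢ X)}
  {F : Set X} {E : Set (X ≃ᵢ X)}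

theorem IsInvariantMeasure.measure_ball_apply (hμ : IsInvariantMeasure μ) (g : X ≃ᵢ X) (x : X)
    (S : ℝ) : μ (Metric.ball (g x) S) = μ (Metric.ball x S) := by
  rw [← (hμ.measurePreserving g).measure_preimage Metric.isOpen_ball.measurableSet.nullMeasurableSet,
    g.preimage_ball, g.symm_apply_apply]

/-- Integrating a `Γ`-invariant function over the balls `B(g x₀, S)`, `g ∈ Γ \ G`, amounts to
integrating it over `Γ \ X` against the weight `orbitMass`. -/
theorem lintegral_ball_eq [Countable Γ] (hμ : IsInvariantMeasure μ) (η : Measure (X ≃ᵢ X))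
    [η.IsHaarMeasure] (hF : IsFundamentalDomain Γ F μ) (hE : IsFundamentalDomain Γ E η)
    (x₀ : X) (S : ℝ) {a : X → ℝ≥0∞} (ha : Measurable a) (hinv : ∀ (γ : Γ) x, a (γ • x) = a x) :
    ∫⁻ g in E, ∫⁻ y in Metric.ball (g x₀) S, a y ∂μ ∂η =
      ∫⁻ y in F, a y * orbitMass η x₀ S y ∂μ := by
  have := hμ.smulInvariantMeasure Γ
  have := smulInvariantMeasure_group η Γ
  have := hμ.finite_on_compacts
  have hopen : IsOpen {p : (X ≃ᵢ X) × X | dist (p.1 x₀) p.2 < S} :=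
    isOpen_lt (((continuous_eval x₀).comp continuous_fst).dist continuous_snd) continuous_const
  have key := lintegral_diagonal_unfold hF hE
    (φ := fun g y => {p : (X ≃ᵢ X) × X | dist (p.1 x₀) p.2 < S}.indicator (fun p => a p.2) (g, y))
    ((ha.comp measurable_snd).indicator hopen.measurableSet) (by
      intro γ g y
      have h1 : dist ((γ • g) x₀) (γ • y) = dist (g x₀) y := (γ : X ≃ᵢ X).dist_eq _ _
      simp only [Set.indicator_apply, Set.mem_ofPred_eq, h1, hinv])
  have hl : ∀ g : X ≃ᵢ X, ∫⁻ y in Metric.ball (g x₀) S, a y ∂μ = ∫⁻ y,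
      {p : (X ≃ᵢ X) × X | dist (p.1 x₀) p.2 < S}.indicator (fun p => a p.2) (g, y) ∂μ := by
    intro g
    rw [← lintegral_indicator Metric.isOpen_ball.measurableSet]
    congr with y
    by_cases hy : dist (g x₀) y < S
    · rw [Set.indicator_of_mem (by rwa [Metric.mem_ball, dist_comm]),
        Set.indicator_of_mem (by exact hy)]
    · rw [Set.indicator_of_notMem (by rwa [Metric.mem_ball, dist_comm]),
        Set.indicator_of_notMem (by exact hy)]
  have hr : ∀ y : X, a y * orbitMass η x₀ S y = ∫⁻ g,
      {p : (X ≃ᵢ X) × X | dist (p.1 x₀) p.2 < S}.indicator (fun p => a p.2) (g, y) ∂η := by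
    intro y
    rw [orbitMass, ← lintegral_indicator_const]
    · rfl
    · exact (isOpen_lt ((continuous_eval x₀).dist continuous_const)
        continuous_const).measurableSet
  simp_rw [hl, hr]
  exact key

/-- If all unit balls around the points `g x₀`, `g ∈ A`, lie in `B`, then the volume of `A` in
`Γ \ G` is controlled by the volume of `B` in `Γ \ X`. -/
theorem measure_group_le [Countable Γ] (hμ : IsInvariantMeasure μ) (η : Measure (X ≃ᵢ X))
    [η.IsHaarMeasure] (hF : IsFundamentalDomain Γ F μ) (hE : IsFundamentalDomain Γ E η)
    (x₀ : X) {A : Set (X ≃ᵢ X)} (hA : MeasurableSet A) {B : Set X} (hB : MeasurableSet B)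
    (hBinv : ∀ (γ : Γ) x, γ • x ∈ B ↔ x ∈ B) (hAB : ∀ g ∈ A, Metric.ball (g x₀) 1 ⊆ B) :
    η (A ∩ E) * μ (Metric.ball x₀ 1) ≤ orbitMass η x₀ (2 * 1) x₀ * μ (B ∩ F) := by
  have key := lintegral_ball_eq hμ η hF hE x₀ 1 (a := B.indicator 1)
    (measurable_one.indicator hB) (fun γ x => by classical simp [Set.indicator_apply, hBinv])
  calc η (A ∩ E) * μ (Metric.ball x₀ 1)
      = ∫⁻ g in E, A.indicator (fun _ => μ (Metric.ball x₀ 1)) g ∂η := by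
        rw [lintegral_indicator_const hA, Measure.restrict_apply hA, mul_comm]
    _ ≤ ∫⁻ g in E, ∫⁻ y in Metric.ball (g x₀) 1, B.indicator 1 y ∂μ ∂η := by
        refine lintegral_mono fun g => ?_
        by_cases hg : g ∈ A
        · rw [lintegral_indicator_one hB, Measure.restrict_apply hB,
            Set.inter_eq_right.2 (hAB g hg), hμ.measure_ball_apply, Set.indicator_of_mem hg]
        · rw [Set.indicator_of_notMem hg]
          exact zero_le
    _ = ∫⁻ y in F, B.indicator 1 y * orbitMass η x₀ 1 y ∂μ := key
    _ ≤ ∫⁻ y in F, B.indicator (fun _ => orbitMass η x₀ (2 * 1) x₀) y ∂μ := by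
        refine lintegral_mono fun y => ?_
        by_cases hy : y ∈ B
        · simpa [hy] using orbitMass_le η x₀ 1 y
        · simp [hy]
    _ = _ := by rw [lintegral_indicator_const hB, Measure.restrict_apply hB]

/-- If all isometries which move `x₀` to a point at distance less than `D + 1` from `B` lie in `A`,
then the volume of `B` in `Γ \ X` is controlled by the volume of `A` in `Γ \ G`. -/
theorem measure_space_le [Countable Γ] (hμ : IsInvariantMeasure μ) (η : Measure (X ≃ᵢ X))
    [η.IsHaarMeasure] (hF : IsFundamentalDomain Γ F μ) (hE : IsFundamentalDomain Γ E η)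
    {x₀ : X} {D : ℝ} (hD : ∀ x, ∃ g : X ≃ᵢ X, dist (g x₀) x ≤ D)
    {A : Set (X ≃ᵢ X)} (hA : MeasurableSet A) {B : Set X} (hB : MeasurableSet B)
    (hBinv : ∀ (γ : Γ) x, γ • x ∈ B ↔ x ∈ B)
    (hAB : ∀ y ∈ B, ∀ g : X ≃ᵢ X, dist (g x₀) y < D + 1 → g ∈ A) :
    orbitMass η x₀ 1 x₀ * μ (B ∩ F) ≤ η (A ∩ E) * μ (Metric.ball x₀ (D + 1)) := by
  have key := lintegral_ball_eq hμ η hF hE x₀ (D + 1) (a := B.indicator 1)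
    (measurable_one.indicator hB) (fun γ x => by classical simp [Set.indicator_apply, hBinv])
  calc orbitMass η x₀ 1 x₀ * μ (B ∩ F)
      = ∫⁻ y in F, B.indicator (fun _ => orbitMass η x₀ 1 x₀) y ∂μ := by
        rw [lintegral_indicator_const hB, Measure.restrict_apply hB]
    _ ≤ ∫⁻ y in F, B.indicator 1 y * orbitMass η x₀ (D + 1) y ∂μ := by
        refine lintegral_mono fun y => ?_
        by_cases hy : y ∈ B
        · simpa [hy] using le_orbitMass η x₀ hD y
        · simp [hy]
    _ = ∫⁻ g in E, ∫⁻ y in Metric.ball (g x₀) (D + 1), B.indicator 1 y ∂μ ∂η := key.symm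
    _ ≤ ∫⁻ g in E, A.indicator (fun _ => μ (Metric.ball x₀ (D + 1))) g ∂η := by
        refine lintegral_mono fun g => ?_
        rw [lintegral_indicator_one hB, Measure.restrict_apply hB]
        by_cases hg : g ∈ A
        · rw [Set.indicator_of_mem hg, ← hμ.measure_ball_apply g]
          exact measure_mono Set.inter_subset_right
        · rw [Set.indicator_of_notMem hg, nonpos_iff_eq_zero]
          convert measure_empty (μ := μ)
          refine Set.eq_empty_of_forall_notMem fun y hy => hg (hAB y hy.1 g ?_)
          rw [dist_comm]
          exact hy.2
    _ = _ := by rw [lintegral_indicator_const hA, Measure.restrict_apply hA, mul_comm]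

/-- The covolume of a lattice is finite, because the translates of a ball cover the space. -/
theorem IsLattice.measure_lt_top [Countable Γ] (hΓ : IsLattice Γ) (hμ : IsInvariantMeasure μ)
    (hF : IsFundamentalDomain Γ F μ) : μ F < ∞ := by
  have := hμ.smulInvariantMeasure Γ
  have := hμ.finite_on_compacts
  rcases isEmpty_or_nonempty X with hX | ⟨⟨x₀⟩⟩
  · simp [Set.eq_empty_of_isEmpty F]
  obtain ⟨D, hD⟩ := hΓ.exists_dist_le x₀
  have hK : MeasurableSet (Metric.closedBall x₀ D) := Metric.isClosed_closedBall.measurableSet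
  refine lt_of_le_of_lt ?_ ((isCompact_closedBall x₀ D).measure_lt_top (μ := μ))
  have := lintegral_eq_setLIntegral_tsum (μ := μ) hF
    (f := (Metric.closedBall x₀ D).indicator 1) (measurable_one.indicator hK)
  rw [lintegral_indicator_one hK] at this
  rw [this, ← setLIntegral_one]
  refine lintegral_mono fun x => ?_
  obtain ⟨γ, hγ⟩ := hD x
  refine le_trans ?_ (ENNReal.le_tsum γ⁻¹)
  have : γ⁻¹ • x ∈ Metric.closedBall x₀ D := by
    rw [Metric.mem_closedBall]
    have h2 : dist (γ⁻¹ • x) x₀ = dist x (γ • x₀) := by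
      rw [← (γ : X ≃ᵢ X).dist_eq]
      congr 1
      exact smul_inv_smul γ x
    rw [h2, dist_comm]
    exact hγ
  simp [this]

theorem IsInvariantMeasure.measure_ne_zero [Countable Γ] (hμ : IsInvariantMeasure μ)
    (hF : IsFundamentalDomain Γ F μ) : μ F ≠ 0 := by
  have := hμ.smulInvariantMeasure Γ
  exact hF.measure_ne_zero hμ.ne_zero

theorem IsInvariantMeasure.nonempty (hμ : IsInvariantMeasure μ) : Nonempty X := by
  by_contra h
  have := not_nonempty_iff.1 h
  exact hμ.ne_zero (Measure.eq_zero_of_isEmpty μ)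

end Comparison

/-! ### The two notions of Benjamini-Schramm convergence agree -/

section BSEquivalence

variable {X : Type*} [MetricSpace X] [ProperSpace X] [MeasurableSpace X] [BorelSpace X]
  {μ : Measure X} {Γ : Subgroup (X ≃ᵢ X)} {F : Set X} {E : Set (X ≃ᵢ X)}

theorem radiusAt_lt_iff (Γ : Subgroup (X ≃ᵢ X)) (x : X) (R : ℝ) :
    radiusAt Γ x < ENNReal.ofReal R ↔ ∃ γ ∈ Γ, γ ≠ 1 ∧ dist x (γ x) < R := by
  simp only [radiusAt, iInf_lt_iff, exists_prop]
  refine exists_congr fun γ => and_congr_right fun _ => and_congr_right fun _ => ?_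
  rw [edist_dist, ENNReal.ofReal_lt_ofReal_iff']
  exact ⟨fun h => h.1, fun h => ⟨h, dist_nonneg.trans_lt h⟩⟩

theorem measurableSet_radiusAt_lt (Γ : Subgroup (X ≃ᵢ X)) (R : ℝ) :
    MeasurableSet {x : X | radiusAt Γ x < ENNReal.ofReal R} := by
  have : {x : X | radiusAt Γ x < ENNReal.ofReal R} =
      ⋃ γ ∈ {γ : X ≃ᵢ X | γ ∈ Γ ∧ γ ≠ 1}, {x | dist x (γ x) < R} := by
    ext x
    simp only [Set.mem_ofPred_eq, radiusAt_lt_iff, Set.mem_iUnion, exists_prop, and_assoc]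
  rw [this]
  exact (isOpen_biUnion fun γ _ =>
    isOpen_lt (continuous_id.dist γ.continuous) continuous_const).measurableSet

/-- Conjugation by `γ` shows that the radius at a point is invariant. -/
theorem radiusAt_smul_lt (Γ : Subgroup (X ≃ᵢ X)) (R : ℝ) (γ : Γ) (x : X)
    (h : radiusAt Γ x < ENNReal.ofReal R) : radiusAt Γ (γ • x) < ENNReal.ofReal R := by
  rw [radiusAt_lt_iff] at h ⊢
  obtain ⟨δ, hδ, h1, h2⟩ := h
  refine ⟨γ * δ * γ⁻¹, Γ.mul_mem (Γ.mul_mem γ.2 hδ) (Γ.inv_mem γ.2), ?_, ?_⟩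
  · intro h
    exact h1 (by simpa [mul_inv_eq_iff_eq_mul] using h)
  · have : ((γ : X ≃ᵢ X) * δ * ((γ⁻¹ : Γ) : X ≃ᵢ X)) (γ • x) = (γ : X ≃ᵢ X) (δ x) := by
      change (γ : X ≃ᵢ X) (δ ((γ : X ≃ᵢ X)⁻¹ ((γ : X ≃ᵢ X) x))) = _
      congr 2
      exact (γ : X ≃ᵢ X).symm_apply_apply x
    rw [this]
    exact ((γ : X ≃ᵢ X).dist_eq _ _).trans_lt h2

theorem radiusAt_smul_lt_iff (Γ : Subgroup (X ≃ᵢ X)) (R : ℝ) (γ : Γ) (x : X) :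
    γ • x ∈ {x : X | radiusAt Γ x < ENNReal.ofReal R} ↔
      x ∈ {x : X | radiusAt Γ x < ENNReal.ofReal R} :=
  ⟨fun h => by simpa using radiusAt_smul_lt Γ R γ⁻¹ _ h, radiusAt_smul_lt Γ R γ x⟩

/-- The isometries `g` for which some nontrivial element of `Γ` moves `g x₀` by at most `R`. The
definition has the form of the sets in `BSConvergesToOne`; `mem_shortSet_iff` gives the
description in terms of displacements. -/
def shortSet (Γ : Subgroup (X ≃ᵢ X)) (x₀ : X) (R : ℝ) : Set (X ≃ᵢ X) :=
  {g | ∃ γ ∈ Γ, γ ≠ 1 ∧ g⁻¹ * γ * g ∈ {h : X ≃ᵢ X | dist (h x₀) x₀ ≤ R}}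

theorem mem_shortSet_iff {Γ : Subgroup (X ≃ᵢ X)} {x₀ : X} {R : ℝ} {g : X ≃ᵢ X} :
    g ∈ shortSet Γ x₀ R ↔ ∃ γ ∈ Γ, γ ≠ 1 ∧ dist (γ (g x₀)) (g x₀) ≤ R := by
  refine exists_congr fun γ => and_congr_right fun _ => and_congr_right fun _ => ?_
  change dist (g⁻¹ (γ (g x₀))) x₀ ≤ R ↔ _
  rw [← g.dist_eq]
  change dist (g (g.symm (γ (g x₀)))) (g x₀) ≤ R ↔ _
  rw [g.apply_symm_apply]

theorem measurableSet_shortSet (Γ : Subgroup (X ≃ᵢ X)) [Countable Γ] (x₀ : X) (R : ℝ) :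
    MeasurableSet (shortSet Γ x₀ R) := by
  have : shortSet Γ x₀ R = ⋃ γ ∈ {γ : X ≃ᵢ X | γ ∈ Γ ∧ γ ≠ 1},
      {g : X ≃ᵢ X | dist (γ (g x₀)) (g x₀) ≤ R} := by
    ext g
    simp only [mem_shortSet_iff, Set.mem_iUnion, exists_prop, and_assoc, Set.mem_ofPred_eq]
  rw [this]
  have hc : {γ : X ≃ᵢ X | γ ∈ Γ ∧ γ ≠ 1}.Countable :=
    (Set.to_countable (Γ : Set (X ≃ᵢ X))).mono fun γ h => h.1
  exact MeasurableSet.biUnion hc fun γ _ => (isClosed_le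
    ((γ.continuous.comp (continuous_eval x₀)).dist (continuous_eval x₀))
    continuous_const).measurableSet

theorem smul_mem_shortSet {Γ : Subgroup (X ≃ᵢ X)} {x₀ : X} {R : ℝ} (γ : Γ) (g : X ≃ᵢ X)
    (h : g ∈ shortSet Γ x₀ R) : γ • g ∈ shortSet Γ x₀ R := by
  obtain ⟨δ, hδ, h1, h2⟩ := h
  refine ⟨γ * δ * γ⁻¹, Γ.mul_mem (Γ.mul_mem γ.2 hδ) (Γ.inv_mem γ.2), ?_, ?_⟩
  · intro h
    exact h1 (by simpa [mul_inv_eq_iff_eq_mul] using h)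
  · convert h2 using 1
    change ((γ : X ≃ᵢ X) * g)⁻¹ * ((γ : X ≃ᵢ X) * δ * (γ : X ≃ᵢ X)⁻¹) * ((γ : X ≃ᵢ X) * g) = _
    group

/-- Two volume comparisons, one for a subset and one for the whole space, combine to a comparison
of probabilities. -/
theorem div_le_mul_div_of_comparison {a b A B c c' d d' : ℝ≥0∞} (h1 : a * c ≤ d * b)
    (h2 : c' * B ≤ A * d') (hc : c ≠ 0) (hc_top : c ≠ ∞) (hc' : c' ≠ 0) (hc'_top : c' ≠ ∞)
    (hB : B ≠ 0) (hB_top : B ≠ ∞) : a / A ≤ (d * d' / (c * c')) * (b / B) := by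
  refine ENNReal.div_le_of_le_mul ?_
  have h3 : a * (c * c' * B) ≤ d * d' * b * A := by
    calc a * (c * c' * B) = (a * c) * (c' * B) := by ring
      _ ≤ (d * b) * (A * d') := mul_le_mul' h1 h2
      _ = _ := by ring
  have h4 : (d * d' / (c * c')) * (b / B) * A = (d * d' * b * A) / (c * c' * B) := by
    rw [div_eq_mul_inv, div_eq_mul_inv, div_eq_mul_inv,
      ENNReal.mul_inv (a := c * c') (Or.inr hB_top) (Or.inr hB)]
    ring
  rw [h4, ENNReal.le_div_iff_mul_le]
  · exact h3
  · exact Or.inl (mul_ne_zero (mul_ne_zero hc hc') hB)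
  · exact Or.inl (ENNReal.mul_ne_top (ENNReal.mul_ne_top hc_top hc'_top) hB_top)

section Comparison

variable [Countable Γ] (hΓ : IsLattice Γ) (hμ : IsInvariantMeasure μ) [μ.IsOpenPosMeasure]
  (η : Measure (X ≃ᵢ X)) [η.IsHaarMeasure] {x₀ : X} {D : ℝ}
  (hD : ∀ x, ∃ g : X ≃ᵢ X, dist (g x₀) x ≤ D)

include hΓ hμ hD

theorem IsLattice.measure_group_pos_lt_top (hE : IsFundamentalDomain Γ E η) :
    η E ≠ 0 ∧ η E ≠ ∞ := by
  have := hμ.finite_on_compacts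
  obtain ⟨F, hF⟩ := hΓ.exists_isFundamentalDomain μ
  have hm : μ (Metric.ball x₀ 1) ≠ 0 := (Metric.measure_ball_pos μ x₀ one_pos).ne'
  have h1 := measure_group_le hμ η hF hE x₀ MeasurableSet.univ MeasurableSet.univ
    (fun _ _ => by simp) (fun _ _ => Set.subset_univ _)
  have h2 := measure_space_le hμ η hF hE hD MeasurableSet.univ MeasurableSet.univ
    (fun _ _ => by simp) (fun _ _ _ _ => Set.mem_univ _)
  rw [Set.univ_inter, Set.univ_inter] at h1 h2
  constructor
  · intro h
    rw [h, zero_mul, nonpos_iff_eq_zero] at h2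
    exact mul_ne_zero (orbitMass_self_pos η x₀ one_pos).ne' (hμ.measure_ne_zero hF) h2
  · intro h
    rw [h, ENNReal.top_mul hm] at h1
    exact (ENNReal.mul_lt_top (orbitMass_lt_top η x₀ _ x₀)
      (hΓ.measure_lt_top hμ hF)).not_ge h1

/-- If `γ` moves `g x₀` by at most `R`, then it moves all points of the unit ball around `g x₀` by
less than `R + 3`. The constant does not involve `Γ`. -/
theorem quotientProb_shortSet_le (R : ℝ) :
    quotientProb Γ η (shortSet Γ x₀ R) ≤
      (orbitMass η x₀ (2 * 1) x₀ * μ (Metric.ball x₀ (D + 1)) /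
        (μ (Metric.ball x₀ 1) * orbitMass η x₀ 1 x₀)) *
      quotientProb Γ μ {x : X | radiusAt Γ x < ENNReal.ofReal (R + 3)} := by
  have := hμ.finite_on_compacts
  have := hμ.smulInvariantMeasure Γ
  have := smulInvariantMeasure_group η Γ
  have : Nonempty X := ⟨x₀⟩
  obtain ⟨F, hF⟩ := hΓ.exists_isFundamentalDomain μ
  obtain ⟨E, hE⟩ := hΓ.exists_isFundamentalDomain_group η
  rw [quotientProb_eq hE (measurableSet_shortSet Γ x₀ R) smul_mem_shortSet,
    quotientProb_eq hF (measurableSet_radiusAt_lt Γ _) (radiusAt_smul_lt Γ _)]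
  have h1 := measure_group_le hμ η hF hE x₀ (measurableSet_shortSet Γ x₀ R)
    (measurableSet_radiusAt_lt Γ (R + 3)) (radiusAt_smul_lt_iff Γ _) (by
      intro g hg y hy
      obtain ⟨γ, hγ, h1, h2⟩ := mem_shortSet_iff.1 hg
      refine (radiusAt_lt_iff Γ y _).2 ⟨γ, hγ, h1, ?_⟩
      have h3 : dist (γ y) (γ (g x₀)) < 1 := by rw [γ.dist_eq]; exact hy
      have h4 : dist y (g x₀) < 1 := hy
      have h5 := dist_triangle4 y (g x₀) (γ (g x₀)) (γ y)
      rw [dist_comm (g x₀) (γ (g x₀)), dist_comm (γ (g x₀)) (γ y)] at h5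
      linarith)
  have h2 := measure_space_le hμ η hF hE hD MeasurableSet.univ MeasurableSet.univ
    (fun _ _ => by simp) (fun _ _ _ _ => Set.mem_univ _)
  rw [Set.univ_inter, Set.univ_inter] at h2
  exact div_le_mul_div_of_comparison h1 h2 (Metric.measure_ball_pos μ x₀ one_pos).ne'
    measure_ball_lt_top.ne (orbitMass_self_pos η x₀ one_pos).ne' (orbitMass_lt_top η x₀ 1 x₀).ne
    (hμ.measure_ne_zero hF) (hΓ.measure_lt_top hμ hF).ne

/-- If `γ` moves `y` by less than `R`, then it moves all points `g x₀` at distance less than `D + 1`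
from `y` by at most `R + 2 (D + 1)`. The constant does not involve `Γ`. -/
theorem quotientProb_radiusAt_le (R : ℝ) :
    quotientProb Γ μ {x : X | radiusAt Γ x < ENNReal.ofReal R} ≤
      (μ (Metric.ball x₀ (D + 1)) * orbitMass η x₀ (2 * 1) x₀ /
        (orbitMass η x₀ 1 x₀ * μ (Metric.ball x₀ 1))) *
      quotientProb Γ η (shortSet Γ x₀ (R + 2 * (D + 1))) := by
  have := hμ.finite_on_compacts
  have := hμ.smulInvariantMeasure Γ
  have := smulInvariantMeasure_group η Γ
  have : Nonempty X := ⟨x₀⟩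
  obtain ⟨F, hF⟩ := hΓ.exists_isFundamentalDomain μ
  obtain ⟨E, hE⟩ := hΓ.exists_isFundamentalDomain_group η
  rw [quotientProb_eq hE (measurableSet_shortSet Γ x₀ _) smul_mem_shortSet,
    quotientProb_eq hF (measurableSet_radiusAt_lt Γ _) (radiusAt_smul_lt Γ _)]
  have h1 := measure_space_le hμ η hF hE hD (measurableSet_shortSet Γ x₀ (R + 2 * (D + 1)))
    (measurableSet_radiusAt_lt Γ R) (radiusAt_smul_lt_iff Γ _) (by
      intro y hy g hg
      obtain ⟨γ, hγ, h1, h2⟩ := (radiusAt_lt_iff Γ y _).1 hy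
      refine mem_shortSet_iff.2 ⟨γ, hγ, h1, ?_⟩
      have h3 : dist (γ (g x₀)) (γ y) < D + 1 := by rw [γ.dist_eq]; exact hg
      have h5 := dist_triangle4 (γ (g x₀)) (γ y) y (g x₀)
      rw [dist_comm (γ y) y, dist_comm y (g x₀)] at h5
      linarith)
  have h2 := measure_group_le hμ η hF hE x₀ MeasurableSet.univ MeasurableSet.univ
    (fun _ _ => by simp) (fun _ _ => Set.subset_univ _)
  rw [Set.univ_inter, Set.univ_inter] at h2
  obtain ⟨h3, h4⟩ := hΓ.measure_group_pos_lt_top hμ η hD hE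
  rw [mul_comm, mul_comm (η _) (μ _)] at h1
  rw [mul_comm (η _), mul_comm (orbitMass _ _ _ _)] at h2
  exact div_le_mul_div_of_comparison h1 h2 (orbitMass_self_pos η x₀ one_pos).ne'
    (orbitMass_lt_top η x₀ 1 x₀).ne (Metric.measure_ball_pos μ x₀ one_pos).ne'
    measure_ball_lt_top.ne h3 h4

end Comparison

theorem quotientProb_mono {G α : Type*} [Group G] [MulAction G α] [MeasurableSpace α]
    {ν : Measure α} {A B : Set α} (h : A ⊆ B) : quotientProb G ν A ≤ quotientProb G ν B :=
  ENNReal.div_le_div_right (measure_mono (Set.image_mono h)) _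

/-- The two notions of Benjamini-Schramm convergence agree for every sequence of lattices. -/
theorem bsConvergesToOne_iff [μ.IsOpenPosMeasure] (hμ : IsInvariantMeasure μ)
    (η : Measure (X ≃ᵢ X)) [η.IsHaarMeasure] (Γ : ℕ → Subgroup (X ≃ᵢ X))
    (hΓ : ∀ n, IsLattice (Γ n)) : BSConvergesToOne η Γ ↔ BSConvergesToSpace μ Γ := by
  have := hμ.finite_on_compacts
  obtain ⟨x₀⟩ := hμ.nonempty
  have : Nonempty X := ⟨x₀⟩
  have hcount : ∀ n, Countable (Γ n) := fun n => (hΓ n).countable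
  obtain ⟨D, hD'⟩ := (hΓ 0).exists_dist_le x₀
  have hD : ∀ x, ∃ g : X ≃ᵢ X, dist (g x₀) x ≤ D := fun x =>
    let ⟨γ, hγ⟩ := hD' x
    ⟨γ, hγ⟩
  have hw0 := (orbitMass_self_pos η x₀ one_pos).ne'
  have hm0 : μ (Metric.ball x₀ 1) ≠ 0 := (Metric.measure_ball_pos μ x₀ one_pos).ne'
  have hm : μ (Metric.ball x₀ (D + 1)) ≠ ∞ := measure_ball_lt_top.ne
  have hw := (orbitMass_lt_top η x₀ (2 * 1) x₀).ne
  constructor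
  · intro h R _
    have h1 : Tendsto (fun n => quotientProb (Γ n) η (shortSet (Γ n) x₀ (R + 2 * (D + 1))))
        atTop (𝓝 0) := h _ (isCompact_setOf_dist_le x₀ x₀ (R + 2 * (D + 1)))
    refine tendsto_of_tendsto_of_tendsto_of_le_of_le tendsto_const_nhds ?_ (fun n => zero_le)
      (fun n => quotientProb_radiusAt_le (hΓ n) hμ η hD R)
    simpa only [mul_zero] using ENNReal.Tendsto.const_mul h1
      (Or.inr (ENNReal.div_ne_top (ENNReal.mul_ne_top hm hw) (mul_ne_zero hw0 hm0)))
  · intro h C hC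
    obtain ⟨R, hR⟩ := exists_dist_le_of_isCompact hC x₀
    have h1 := h (max R 0 + 3) (by positivity)
    refine tendsto_of_tendsto_of_tendsto_of_le_of_le tendsto_const_nhds ?_ (fun n => zero_le)
      (fun n => (quotientProb_mono ?_).trans
        (quotientProb_shortSet_le (hΓ n) hμ η hD (max R 0)))
    · simpa only [mul_zero] using ENNReal.Tendsto.const_mul h1
        (Or.inr (ENNReal.div_ne_top (ENNReal.mul_ne_top hw hm) (mul_ne_zero hm0 hw0)))
    · rintro g ⟨γ, hγ, h1, h2⟩
      exact ⟨γ, hγ, h1, (hR _ h2).trans (le_max_left _ _)⟩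

end BSEquivalence

/-! ### The mean of an invariant kernel on the diagonal -/

section KernelMean

variable {X : Type*} [MetricSpace X] [ProperSpace X] [MeasurableSpace X] [BorelSpace X]
  {μ : Measure X} {Γ : Subgroup (X ≃ᵢ X)} {F : Set X} {E : Set (X ≃ᵢ X)}

/-- A measure on `X` which, on sets invariant under all isometries, is proportional to the measure
of the intersection with a fundamental domain of any lattice, see `measure_inter_eq`. Its definition
does not involve a lattice. -/
noncomputable def invariantPart (μ : Measure X) (η : Measure (X ≃ᵢ X)) (x₀ : X) (S : ℝ) :
    Measure X :=
  (μ.restrict (Metric.ball x₀ S)).withDensity fun y => (orbitMass η x₀ S y)⁻¹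

/-- The constant `η E`, the volume of `Γ \ G`, is the same for all sets `B`. -/
theorem measure_inter_eq [Countable Γ] (hμ : IsInvariantMeasure μ) (η : Measure (X ≃ᵢ X))
    [η.IsHaarMeasure] (hF : IsFundamentalDomain Γ F μ) (hE : IsFundamentalDomain Γ E η)
    {x₀ : X} {D : ℝ} (hD : ∀ x, ∃ g : X ≃ᵢ X, dist (g x₀) x ≤ D) {B : Set X}
    (hB : MeasurableSet B) (hinv : ∀ (g : X ≃ᵢ X) x, g x ∈ B ↔ x ∈ B) :
    μ (B ∩ F) = η E * invariantPart μ η x₀ (D + 1) B := by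
  have hmeas : Measurable (B.indicator fun y => (orbitMass η x₀ (D + 1) y)⁻¹) :=
    (measurable_orbitMass η x₀ (D + 1)).inv.indicator hB
  have hainv : ∀ (g : X ≃ᵢ X) x, B.indicator (fun y => (orbitMass η x₀ (D + 1) y)⁻¹) (g x) =
      B.indicator (fun y => (orbitMass η x₀ (D + 1) y)⁻¹) x := fun g x => by
    classical simp [Set.indicator_apply, hinv, orbitMass_apply]
  have key := lintegral_ball_eq hμ η hF hE x₀ (D + 1) hmeas (fun γ => hainv γ)
  have h1 : ∀ g : X ≃ᵢ X, ∫⁻ y in Metric.ball (g x₀) (D + 1),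
      B.indicator (fun y => (orbitMass η x₀ (D + 1) y)⁻¹) y ∂μ =
      invariantPart μ η x₀ (D + 1) B := by
    intro g
    rw [invariantPart, withDensity_apply _ hB, ← lintegral_indicator hB,
      ← (hμ.measurePreserving g).setLIntegral_comp_preimage Metric.isOpen_ball.measurableSet hmeas]
    rw [g.preimage_ball, g.symm_apply_apply]
    simp_rw [hainv]
  have h2 : ∀ y, B.indicator (fun y => (orbitMass η x₀ (D + 1) y)⁻¹) y *
      orbitMass η x₀ (D + 1) y = B.indicator 1 y := by
    intro y
    by_cases hy : y ∈ B
    · simp only [Set.indicator_of_mem hy, Pi.one_apply]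
      exact ENNReal.inv_mul_cancel
        ((orbitMass_self_pos η x₀ one_pos).trans_le (le_orbitMass η x₀ hD y)).ne'
        (orbitMass_lt_top η x₀ _ y).ne
    · simp [hy]
  simp_rw [h1, h2] at key
  rw [lintegral_const, lintegral_indicator_one hB, Measure.restrict_apply hB,
    Measure.restrict_apply_univ, mul_comm] at key
  exact key.symm

/-- An invariant function takes the same value at any representative of an orbit. -/
theorem apply_section {φ : X → ℂ} (hinv : ∀ (γ : Γ) x, φ (γ • x) = φ x) {s : OrbitSpace Γ X → X}
    (hs : ∀ q, Quotient.mk (MulAction.orbitRel Γ X) (s q) = q) (x : X) :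
    φ (s (Quotient.mk _ x)) = φ x := by
  obtain ⟨γ, hγ⟩ := Quotient.exact (hs (Quotient.mk _ x))
  rw [← hγ]
  exact hinv γ x

theorem measurable_apply_section {φ : X → ℂ} (hφ : Measurable φ)
    (hinv : ∀ (γ : Γ) x, φ (γ • x) = φ x) {s : OrbitSpace Γ X → X}
    (hs : ∀ q, Quotient.mk (MulAction.orbitRel Γ X) (s q) = q) : Measurable fun q => φ (s q) :=
  measurable_from_quotient.2 (by
    convert hφ using 1
    exact funext (apply_section hinv hs))

/-- Integrals over `Γ \ X` can be computed in a fundamental domain. -/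
theorem integral_orbitSpace_section [Countable Γ] [SMulInvariantMeasure Γ X μ]
    (hF : IsFundamentalDomain Γ F μ) {φ : X → ℂ} (hφ : Measurable φ)
    (hinv : ∀ (γ : Γ) x, φ (γ • x) = φ x) {s : OrbitSpace Γ X → X}
    (hs : ∀ q, Quotient.mk (MulAction.orbitRel Γ X) (s q) = q) :
    ∫ q : OrbitSpace Γ X, φ (s q) ∂(quotientMeasure Γ μ) = ∫ x in F, φ x ∂μ := by
  rw [quotientMeasure_eq_map hF, integral_map measurable_orbitMk.aemeasurable
    (measurable_apply_section hφ hinv hs).aestronglyMeasurable]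
  simp_rw [apply_section hinv hs]

/-- The mean over `Γ \ X` of a function invariant under all isometries is the same for all
lattices. -/
theorem setIntegral_div_eq [Countable Γ] (hΓ : IsLattice Γ) [μ.IsOpenPosMeasure]
    (hμ : IsInvariantMeasure μ) (η : Measure (X ≃ᵢ X)) [η.IsHaarMeasure]
    (hF : IsFundamentalDomain Γ F μ) {x₀ : X} {D : ℝ}
    (hD : ∀ x, ∃ g : X ≃ᵢ X, dist (g x₀) x ≤ D) {φ : X → ℂ} (hφ : Measurable φ)
    (hinv : ∀ (g : X ≃ᵢ X) x, φ (g x) = φ x) :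
    (∫ x in F, φ x ∂μ) / ((μ.real F : ℝ) : ℂ) =
      (∫ x, φ x ∂(invariantPart μ η x₀ (D + 1))) /
        (((invariantPart μ η x₀ (D + 1)).real Set.univ : ℝ) : ℂ) := by
  have : Nonempty X := ⟨x₀⟩
  obtain ⟨E, hE⟩ := hΓ.exists_isFundamentalDomain_group η
  obtain ⟨h0, h1⟩ := hΓ.measure_group_pos_lt_top hμ η hD hE
  have hmap : (μ.restrict F).map φ = η E • (invariantPart μ η x₀ (D + 1)).map φ := by
    ext B hB
    rw [Measure.map_apply hφ hB, Measure.restrict_apply (hφ hB), Measure.smul_apply,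
      Measure.map_apply hφ hB, smul_eq_mul]
    exact measure_inter_eq hμ η hF hE hD (hφ hB) fun g x => by
      simp only [Set.mem_preimage, hinv]
  have h2 : ∫ x in F, φ x ∂μ = (η E).toReal • ∫ x, φ x ∂(invariantPart μ η x₀ (D + 1)) := by
    have h3 := integral_map (μ := μ.restrict F) hφ.aemeasurable
      (f := fun z : ℂ => z) measurable_id.aestronglyMeasurable
    have h4 := integral_map (μ := invariantPart μ η x₀ (D + 1)) hφ.aemeasurable
      (f := fun z : ℂ => z) measurable_id.aestronglyMeasurable
    rw [← h3, ← h4, hmap, integral_smul_measure]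
  have h5 := measure_inter_eq hμ η hF hE hD MeasurableSet.univ (fun _ _ => by simp)
  rw [Set.univ_inter] at h5
  have h6 : (η E).toReal ≠ 0 := (ENNReal.toReal_pos h0 h1).ne'
  rw [h2, measureReal_def, h5, ENNReal.toReal_mul, measureReal_def]
  push_cast
  rw [Complex.real_smul, mul_div_mul_left _ _ (by exact_mod_cast h6)]

theorem kernelMean_eq_setIntegral [Countable Γ] [SMulInvariantMeasure Γ X μ]
    (hF : IsFundamentalDomain Γ F μ) {k : X → X → ℂ} (hk : Continuous (Function.uncurry k))
    (hinv : ∀ (g : X ≃ᵢ X) x y, k (g x) (g y) = k x y) :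
    kernelMean μ Γ k = (∫ x in F, k x x ∂μ) / ((μ.real F : ℝ) : ℂ) := by
  have hm : Measurable fun x => k x x :=
    (hk.comp (continuous_id.prodMk continuous_id)).measurable
  rw [kernelMean, integral_orbitSpace_section hF (φ := fun x => k x x) hm (fun γ x => hinv γ x x)
    (fun q => q.out_eq),
    covolume, measureReal_def, quotientMeasure_univ hF, measureReal_def]

/-- The mean of an invariant kernel on the diagonal is the same for all lattices. -/
theorem kernelMean_eq_kernelMean [μ.IsOpenPosMeasure] (hμ : IsInvariantMeasure μ)
    (η : Measure (X ≃ᵢ X)) [η.IsHaarMeasure] {Γ Λ : Subgroup (X ≃ᵢ X)} (hΓ : IsLattice Γ)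
    (hΛ : IsLattice Λ) {k : X → X → ℂ} (hk : Continuous (Function.uncurry k))
    (hinv : ∀ (g : X ≃ᵢ X) x y, k (g x) (g y) = k x y) :
    kernelMean μ Γ k = kernelMean μ Λ k := by
  obtain ⟨x₀⟩ := hμ.nonempty
  have : Nonempty X := ⟨x₀⟩
  have := hΓ.countable
  have := hΛ.countable
  have := hμ.smulInvariantMeasure Γ
  have := hμ.smulInvariantMeasure Λ
  obtain ⟨D, hD'⟩ := hΓ.exists_dist_le x₀
  have hD : ∀ x, ∃ g : X ≃ᵢ X, dist (g x₀) x ≤ D := fun x =>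
    let ⟨γ, hγ⟩ := hD' x
    ⟨γ, hγ⟩
  obtain ⟨F, hF⟩ := hΓ.exists_isFundamentalDomain μ
  obtain ⟨F', hF'⟩ := hΛ.exists_isFundamentalDomain μ
  have hm : Measurable fun x => k x x :=
    (hk.comp (continuous_id.prodMk continuous_id)).measurable
  rw [kernelMean_eq_setIntegral hF hk hinv, kernelMean_eq_setIntegral hF' hk hinv,
    setIntegral_div_eq hΓ hμ η hF hD hm (fun g x => hinv g x x),
    setIntegral_div_eq hΛ hμ η hF' hD hm (fun g x => hinv g x x)]

end KernelMean

/-! ### Integral operators on `L²` -/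

section KernelOperator

variable {α : Type*} [MeasurableSpace α] {μ : Measure α}

/-- `T` is the integral operator on `L²(μ)` with kernel `K`. Integrability of `K x y * f y` in `y`
is not part of the definition; it holds almost everywhere for the kernels considered here. -/
def IsKernelOperator (μ : Measure α) (K : α → α → ℂ) (T : Lp ℂ 2 μ →L[ℂ] Lp ℂ 2 μ) : Prop :=
  ∀ f : Lp ℂ 2 μ, T f =ᵐ[μ] fun x => ∫ y, K x y * f y ∂μ

theorem IsKernelOperator.unique {K : α → α → ℂ} {S T : Lp ℂ 2 μ →L[ℂ] Lp ℂ 2 μ}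
    (hS : IsKernelOperator μ K S) (hT : IsKernelOperator μ K T) : S = T :=
  ContinuousLinearMap.ext fun f => Lp.ext ((hS f).trans (hT f).symm)

/-- The weighted Cauchy-Schwarz inequality. -/
theorem sq_lintegral_mul_le {a b : α → ℝ≥0∞} (ha : Measurable a) (hb : Measurable b) :
    (∫⁻ y, a y * b y ∂μ) ^ 2 ≤ (∫⁻ y, a y ∂μ) * ∫⁻ y, a y * b y ^ 2 ∂μ := by
  have hr : ∀ t : ℝ≥0∞, (t ^ (1 / 2 : ℝ)) ^ 2 = t := fun t => by
    rw [← ENNReal.rpow_natCast, ← ENNReal.rpow_mul]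
    norm_num
  have h := ENNReal.lintegral_mul_le_Lp_mul_Lq μ (p := 2) (q := 2)
    Real.HolderConjugate.two_two
    (f := fun y => a y ^ (1 / 2 : ℝ)) (g := fun y => a y ^ (1 / 2 : ℝ) * b y)
    (ha.pow_const _).aemeasurable ((ha.pow_const _).mul hb).aemeasurable
  have h2 : ∀ y, ((fun y => a y ^ (1 / 2 : ℝ)) * fun y => a y ^ (1 / 2 : ℝ) * b y) y =
      a y * b y := fun y => by
    simp only [Pi.mul_apply]
    rw [← mul_assoc, ← sq, hr]
  simp_rw [h2] at h
  calc (∫⁻ y, a y * b y ∂μ) ^ 2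
      ≤ ((∫⁻ y, (a y ^ (1 / 2 : ℝ)) ^ (2 : ℝ) ∂μ) ^ (1 / 2 : ℝ) *
        (∫⁻ y, (a y ^ (1 / 2 : ℝ) * b y) ^ (2 : ℝ) ∂μ) ^ (1 / 2 : ℝ)) ^ 2 := by gcongr
    _ = _ := by
        rw [mul_pow, hr, hr]
        congr 2
        · ext y
          rw [ENNReal.rpow_two, hr]
        · ext y
          rw [ENNReal.rpow_two, mul_pow, hr]

theorem eLpNorm_two_sq (f : α → ℂ) : eLpNorm f 2 μ ^ 2 = ∫⁻ x, ‖f x‖ₑ ^ 2 ∂μ := by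
  have := eLpNorm_nnreal_pow_eq_lintegral (μ := μ) (f := f) (p := 2) two_ne_zero
  simpa using this

/-- The Schur test: a kernel whose rows and columns have bounded `L¹` norm defines a bounded
operator on `L²`. -/
theorem exists_isKernelOperator [SFinite μ] {K : α → α → ℂ}
    (hK : Measurable (Function.uncurry K)) (C : NNReal)
    (hrow : ∀ x, ∫⁻ y, ‖K x y‖ₑ ∂μ ≤ C) (hcol : ∀ y, ∫⁻ x, ‖K x y‖ₑ ∂μ ≤ C) :
    ∃ T : Lp ℂ 2 μ →L[ℂ] Lp ℂ 2 μ, IsKernelOperator μ K T := by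
  have hKx : ∀ x, Measurable (K x) := fun x => hK.comp measurable_prodMk_left
  have hKe : Measurable fun p : α × α => ‖K p.1 p.2‖ₑ := hK.enorm
  have hfm : ∀ f : Lp ℂ 2 μ, Measurable fun y => f y := fun f =>
    (Lp.stronglyMeasurable f).measurable
  have hsq : ∀ f : Lp ℂ 2 μ, ∫⁻ x, (∫⁻ y, ‖K x y‖ₑ * ‖f y‖ₑ ∂μ) ^ 2 ∂μ ≤
      (C * eLpNorm f 2 μ) ^ 2 := by
    intro f
    calc ∫⁻ x, (∫⁻ y, ‖K x y‖ₑ * ‖f y‖ₑ ∂μ) ^ 2 ∂μ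
        ≤ ∫⁻ x, C * ∫⁻ y, ‖K x y‖ₑ * ‖f y‖ₑ ^ 2 ∂μ ∂μ := by
          refine lintegral_mono fun x => ?_
          exact (sq_lintegral_mul_le (hKx x).enorm (hfm f).enorm).trans
            (mul_le_mul_left (hrow x) _)
      _ = C * ∫⁻ x, ∫⁻ y, ‖K x y‖ₑ * ‖f y‖ₑ ^ 2 ∂μ ∂μ := by
          rw [lintegral_const_mul]
          exact (hKe.mul (((hfm f).comp measurable_snd).enorm.pow_const 2)).lintegral_prod_right'
      _ = C * ∫⁻ y, ∫⁻ x, ‖K x y‖ₑ * ‖f y‖ₑ ^ 2 ∂μ ∂μ := by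
          rw [lintegral_lintegral_swap]
          exact (hKe.mul (((hfm f).comp measurable_snd).enorm.pow_const 2)).aemeasurable
      _ ≤ C * ∫⁻ y, C * ‖f y‖ₑ ^ 2 ∂μ := by
          gcongr with y
          have hy : Measurable fun x => ‖K x y‖ₑ := hKe.comp measurable_prodMk_right
          rw [lintegral_mul_const _ hy]
          gcongr
          exact hcol y
      _ = (C * eLpNorm f 2 μ) ^ 2 := by
          rw [lintegral_const_mul _ ((hfm f).enorm.pow_const 2), mul_pow, eLpNorm_two_sq]
          ring
  have hint : ∀ f : Lp ℂ 2 μ, ∀ᵐ x ∂μ, Integrable (fun y => K x y * f y) μ := by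
    intro f
    have hm : Measurable fun x => (∫⁻ y, ‖K x y‖ₑ * ‖f y‖ₑ ∂μ) ^ 2 :=
      ((hKe.mul ((hfm f).comp measurable_snd).enorm).lintegral_prod_right').pow_const 2
    have := ae_lt_top hm ((hsq f).trans_lt
      (ENNReal.pow_lt_top (ENNReal.mul_lt_top ENNReal.coe_lt_top (Lp.eLpNorm_lt_top f)))).ne
    filter_upwards [this] with x hx
    refine ⟨((hKx x).mul (hfm f)).aestronglyMeasurable, ?_⟩
    rw [HasFiniteIntegral]
    simp_rw [enorm_mul]
    rw [ENNReal.pow_lt_top_iff] at hx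
    simpa using hx
  have hTm : ∀ f : Lp ℂ 2 μ, StronglyMeasurable fun x => ∫ y, K x y * f y ∂μ := fun f =>
    (hK.mul ((hfm f).comp measurable_snd)).stronglyMeasurable.integral_prod_right'
  have hnorm : ∀ f : Lp ℂ 2 μ,
      eLpNorm (fun x => ∫ y, K x y * f y ∂μ) 2 μ ≤ C * eLpNorm f 2 μ := by
    intro f
    rw [← ENNReal.pow_le_pow_left_iff two_ne_zero, eLpNorm_two_sq]
    refine le_trans (lintegral_mono fun x => ?_) (hsq f)
    gcongr
    refine (enorm_integral_le_lintegral_enorm _).trans (le_of_eq ?_)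
    simp_rw [enorm_mul]
  have hmem : ∀ f : Lp ℂ 2 μ, MemLp (fun x => ∫ y, K x y * f y ∂μ) 2 μ := fun f =>
    ⟨(hTm f).aestronglyMeasurable, (hnorm f).trans_lt
      (ENNReal.mul_lt_top ENNReal.coe_lt_top (Lp.eLpNorm_lt_top f))⟩
  let T₀ : Lp ℂ 2 μ →ₗ[ℂ] Lp ℂ 2 μ :=
    { toFun := fun f => (hmem f).toLp _
      map_add' := fun f g => by
        apply Lp.ext
        filter_upwards [(hmem (f + g)).coeFn_toLp, (hmem f).coeFn_toLp, (hmem g).coeFn_toLp,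
          Lp.coeFn_add ((hmem f).toLp _) ((hmem g).toLp _), hint f, hint g] with x h1 h2 h3 h4 h5 h6
        rw [h1, h4, Pi.add_apply, h2, h3, ← integral_add h5 h6]
        refine integral_congr_ae ?_
        filter_upwards [Lp.coeFn_add f g] with y hy
        rw [hy, Pi.add_apply, mul_add]
      map_smul' := fun c f => by
        apply Lp.ext
        filter_upwards [(hmem (c • f)).coeFn_toLp, (hmem f).coeFn_toLp,
          Lp.coeFn_smul c ((hmem f).toLp _)] with x h1 h2 h3
        rw [h1, RingHom.id_apply, h3, Pi.smul_apply, h2, smul_eq_mul, ← integral_const_mul]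
        refine integral_congr_ae ?_
        filter_upwards [Lp.coeFn_smul c f] with y hy
        rw [hy, Pi.smul_apply, smul_eq_mul]
        ring }
  refine ⟨T₀.mkContinuous C fun f => ?_, fun f => (hmem f).coeFn_toLp⟩
  change ‖(hmem f).toLp _‖ ≤ _
  rw [Lp.norm_toLp, Lp.norm_def]
  have := ENNReal.toReal_mono
    (ENNReal.mul_lt_top ENNReal.coe_lt_top (Lp.eLpNorm_lt_top f)).ne (hnorm f)
  simpa using this

theorem exists_isKernelOperator_of_bounded [IsFiniteMeasure μ] {K : α → α → ℂ}
    (hK : Measurable (Function.uncurry K)) {M : ℝ} (hM : ∀ x y, ‖K x y‖ ≤ M) :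
    ∃ T : Lp ℂ 2 μ →L[ℂ] Lp ℂ 2 μ, IsKernelOperator μ K T := by
  have hfin : ENNReal.ofReal M * μ Set.univ ≠ ∞ :=
    ENNReal.mul_ne_top ENNReal.ofReal_ne_top (measure_ne_top μ _)
  have hle : ∀ x y, ‖K x y‖ₑ ≤ ENNReal.ofReal M := fun x y => by
    rw [← ofReal_norm]
    exact ENNReal.ofReal_le_ofReal (hM x y)
  refine exists_isKernelOperator hK (ENNReal.ofReal M * μ Set.univ).toNNReal
    (fun x => ?_) (fun y => ?_)
  · rw [ENNReal.coe_toNNReal hfin, ← lintegral_const]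
    exact lintegral_mono fun y => hle x y
  · rw [ENNReal.coe_toNNReal hfin, ← lintegral_const]
    exact lintegral_mono fun x => hle x y

/-! ### The trace of a product of two integral operators -/

/-- Distinct elements of an orthonormal basis have distance `√2`. -/
theorem _root_.HilbertBasis.countable_of_secondCountable {ι H : Type*} [NormedAddCommGroup H]
    [InnerProductSpace ℂ H] [SecondCountableTopology H] (b : HilbertBasis ι ℂ H) :
    Countable ι := by
  refine Pairwise.countable_of_isOpen_disjoint (s := fun i => Metric.ball (b i) (1 / 2)) ?_
    (fun i => Metric.isOpen_ball) (fun i => ⟨_, Metric.mem_ball_self (by norm_num)⟩)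
  intro i j hij
  apply Metric.ball_disjoint_ball
  have h1 : ‖b i - b j‖ ^ 2 = 2 := by
    rw [@norm_sub_sq ℂ, b.orthonormal.1 i, b.orthonormal.1 j, b.orthonormal.2 hij]
    norm_num
  rw [dist_eq_norm]
  nlinarith [norm_nonneg (b i - b j)]

/-- Parseval's identity. -/
theorem _root_.HilbertBasis.hasSum_norm_inner_sq {ι H : Type*} [NormedAddCommGroup H]
    [InnerProductSpace ℂ H] (b : HilbertBasis ι ℂ H) (v : H) :
    HasSum (fun i => ‖inner ℂ v (b i)‖ ^ 2) (‖v‖ ^ 2) := by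
  have h := Complex.hasSum_re (b.hasSum_inner_mul_inner v v)
  have h1 : ∀ i, (inner ℂ v (b i) * inner ℂ (b i) v).re = ‖inner ℂ v (b i)‖ ^ 2 := fun i => by
    have := inner_mul_symm_re_eq_norm (𝕜 := ℂ) v (b i)
    rw [norm_mul, norm_inner_symm (b i) v, ← sq] at this
    exact this
  have h2 : (inner ℂ v v).re = ‖v‖ ^ 2 := inner_self_eq_norm_sq (𝕜 := ℂ) v
  simpa only [h1, h2] using h

/-- A product of a bounded kernel with two integrable functions of one variable is integrable. -/
theorem integrable_kernel_mul [SFinite μ] {K : α → α → ℂ}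
    (hK : Measurable (Function.uncurry K)) {M : ℝ} (hM : ∀ x y, ‖K x y‖ ≤ M) {u v : α → ℂ}
    (hu : Integrable u μ) (hv : Integrable v μ) :
    Integrable (Function.uncurry fun x y => K x y * (u x * v y)) (μ.prod μ) :=
  (hu.mul_prod hv).bdd_mul hK.aestronglyMeasurable (ae_of_all _ fun p => hM p.1 p.2)

/-- The trace of the integral operator whose kernel is the composition `K` of two bounded kernels
`K₁` and `K₂` is the integral of `K` over the diagonal: for each `z` Parseval's identity expands the
inner product of the conjugate of `K₂ z ·` with `K₁ · z`, and the resulting series may be integrated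
over `z` term by term. -/
theorem hasTrace_of_isKernelOperator [IsFiniteMeasure μ] [SecondCountableTopology (Lp ℂ 2 μ)]
    {K₁ K₂ K : α → α → ℂ} (hK₁ : Measurable (Function.uncurry K₁))
    (hK₂ : Measurable (Function.uncurry K₂)) {M : ℝ} (hM₁ : ∀ x y, ‖K₁ x y‖ ≤ M)
    (hM₂ : ∀ x y, ‖K₂ x y‖ ≤ M) (hK : ∀ x y, K x y = ∫ z, K₁ x z * K₂ z y ∂μ)
    {T : Lp ℂ 2 μ →L[ℂ] Lp ℂ 2 μ} (hT : IsKernelOperator μ K T) :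
    HasTrace T (∫ x, K x x ∂μ) := by
  intro ι b
  have : Countable ι := b.countable_of_secondCountable
  have hK₁' : ∀ z, Measurable fun x => K₁ x z := fun z => hK₁.comp measurable_prodMk_right
  have hK₂' : ∀ z, Measurable fun y => K₂ z y := fun z => hK₂.comp measurable_prodMk_left
  have hβ : ∀ z, MemLp (fun x => K₁ x z) 2 μ := fun z =>
    MemLp.of_bound (hK₁' z).aestronglyMeasurable M (ae_of_all _ fun x => hM₁ x z)
  have hγ : ∀ z, MemLp (fun y => (starRingEnd ℂ) (K₂ z y)) 2 μ := fun z =>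
    MemLp.of_bound (Complex.continuous_conj.measurable.comp (hK₂' z)).aestronglyMeasurable M
      (ae_of_all _ fun y => by rw [RCLike.norm_conj]; exact hM₂ z y)
  let β : α → Lp ℂ 2 μ := fun z => (hβ z).toLp _
  let γ : α → Lp ℂ 2 μ := fun z => (hγ z).toLp _
  have hbm : ∀ i, Measurable fun x => b i x := fun i => (Lp.stronglyMeasurable (b i)).measurable
  have hb : ∀ i, Integrable (fun x => b i x) μ := fun i =>
    (Lp.memLp (b i)).integrable one_le_two
  have hbc : ∀ i, Integrable (fun x => (starRingEnd ℂ) (b i x)) μ := fun i =>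
    (Complex.conjCLE.toContinuousLinearMap.integrable_comp (hb i))
  have hγb : ∀ z i, inner ℂ (γ z) (b i) = ∫ y, K₂ z y * b i y ∂μ := by
    intro z i
    rw [L2.inner_def]
    refine integral_congr_ae ?_
    filter_upwards [(hγ z).coeFn_toLp] with y hy
    rw [RCLike.inner_apply, hy, Complex.conj_conj, mul_comm]
  have hbβ : ∀ z i, inner ℂ (b i) (β z) = ∫ x, K₁ x z * (starRingEnd ℂ) (b i x) ∂μ := by
    intro z i
    rw [L2.inner_def]
    refine integral_congr_ae ?_
    filter_upwards [(hβ z).coeFn_toLp] with y hy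
    rw [RCLike.inner_apply, hy]
  have hγβ : ∀ z, inner ℂ (γ z) (β z) = ∫ x, K₁ x z * K₂ z x ∂μ := by
    intro z
    rw [L2.inner_def]
    refine integral_congr_ae ?_
    filter_upwards [(hβ z).coeFn_toLp, (hγ z).coeFn_toLp] with y hy hy'
    rw [RCLike.inner_apply, hy, hy', Complex.conj_conj]
  have hnβ : ∀ z, (‖β z‖ ^ 2 : ℝ) = ∫ x, ‖K₁ x z‖ ^ 2 ∂μ := by
    intro z
    rw [← inner_self_eq_norm_sq (𝕜 := ℂ), L2.inner_def, ← integral_re (L2.integrable_inner _ _)]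
    refine integral_congr_ae ?_
    filter_upwards [(hβ z).coeFn_toLp] with y hy
    rw [inner_self_eq_norm_sq (𝕜 := ℂ), hy]
  have hnγ : ∀ z, (‖γ z‖ ^ 2 : ℝ) = ∫ y, ‖K₂ z y‖ ^ 2 ∂μ := by
    intro z
    rw [← inner_self_eq_norm_sq (𝕜 := ℂ), L2.inner_def, ← integral_re (L2.integrable_inner _ _)]
    refine integral_congr_ae ?_
    filter_upwards [(hγ z).coeFn_toLp] with y hy
    rw [inner_self_eq_norm_sq (𝕜 := ℂ), hy, RCLike.norm_conj]
  have hγbm : ∀ i, StronglyMeasurable fun z => inner ℂ (γ z) (b i) := fun i => by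
    simp_rw [hγb]
    exact (hK₂.mul ((hbm i).comp measurable_snd)).stronglyMeasurable.integral_prod_right'
  have hbβm : ∀ i, StronglyMeasurable fun z => inner ℂ (b i) (β z) := fun i => by
    simp_rw [hbβ]
    exact (hK₁.mul (Complex.continuous_conj.measurable.comp
      ((hbm i).comp measurable_fst))).stronglyMeasurable.integral_prod_left'
  -- the diagonal matrix coefficients of `T`
  have hcoef : ∀ i, inner ℂ (b i) (T (b i)) =
      ∫ z, inner ℂ (γ z) (b i) * inner ℂ (b i) (β z) ∂μ := by
    intro i
    have hh : Integrable (fun z => ∫ y, K₂ z y * b i y ∂μ) μ := by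
      refine Integrable.of_bound ?_ (∫ y, M * ‖b i y‖ ∂μ) (ae_of_all _ fun z => ?_)
      · simp_rw [← hγb]
        exact (hγbm i).aestronglyMeasurable
      · refine norm_integral_le_of_norm_le ((hb i).norm.const_mul M) (ae_of_all _ fun y => ?_)
        rw [norm_mul]
        exact mul_le_mul_of_nonneg_right (hM₂ z y) (norm_nonneg _)
    have hTb : ∀ x, ∫ y, K x y * b i y ∂μ = ∫ z, K₁ x z * ∫ y, K₂ z y * b i y ∂μ ∂μ := by
      intro x
      have hKx : Integrable (fun z => K₁ x z) μ :=
        Integrable.of_bound (hK₁.comp measurable_prodMk_left).aestronglyMeasurable M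
          (ae_of_all _ fun z => hM₁ x z)
      have hsw := integral_integral_swap (integrable_kernel_mul hK₂ hM₂ hKx (hb i))
      calc ∫ y, K x y * b i y ∂μ = ∫ y, ∫ z, K₂ z y * (K₁ x z * b i y) ∂μ ∂μ := by
            refine integral_congr_ae (ae_of_all _ fun y => ?_)
            simp only [hK]
            rw [← integral_mul_const]
            refine integral_congr_ae (ae_of_all _ fun z => ?_)
            ring
        _ = ∫ z, ∫ y, K₂ z y * (K₁ x z * b i y) ∂μ ∂μ := hsw.symm
        _ = _ := by
            refine integral_congr_ae (ae_of_all _ fun z => ?_)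
            simp only
            rw [← integral_const_mul]
            refine integral_congr_ae (ae_of_all _ fun y => ?_)
            ring
    have hsw := integral_integral_swap (integrable_kernel_mul hK₁ hM₁ (hbc i) hh)
    calc inner ℂ (b i) (T (b i))
        = ∫ x, ∫ z, K₁ x z * ((starRingEnd ℂ) (b i x) * ∫ y, K₂ z y * b i y ∂μ) ∂μ ∂μ := by
          rw [L2.inner_def]
          refine integral_congr_ae ?_
          filter_upwards [hT (b i)] with x hx
          rw [RCLike.inner_apply, hx, hTb, ← integral_mul_const]
          refine integral_congr_ae (ae_of_all _ fun z => ?_)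
          ring
      _ = _ := hsw
      _ = _ := by
          refine integral_congr_ae (ae_of_all _ fun z => ?_)
          simp only
          rw [hγb, hbβ, ← integral_const_mul]
          refine integral_congr_ae (ae_of_all _ fun y => ?_)
          ring
  have htot : ∫ x, K x x ∂μ = ∫ z, inner ℂ (γ z) (β z) ∂μ := by
    simp_rw [hγβ, hK]
    refine integral_integral_swap (f := fun x z => K₁ x z * K₂ z x) ?_
    refine Integrable.of_bound (hK₁.mul (hK₂.comp measurable_swap)).aestronglyMeasurable (M * M)
      (ae_of_all _ fun p => ?_)
    rw [Function.uncurry, norm_mul]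
    exact mul_le_mul (hM₁ _ _) (hM₂ _ _) (norm_nonneg _) ((norm_nonneg _).trans (hM₁ p.1 p.2))
  rw [htot]
  simp_rw [hcoef]
  have hbound : ∀ z, HasSum (fun i => (‖inner ℂ (γ z) (b i)‖ ^ 2 + ‖inner ℂ (β z) (b i)‖ ^ 2) / 2)
      ((‖γ z‖ ^ 2 + ‖β z‖ ^ 2) / 2) := fun z =>
    ((b.hasSum_norm_inner_sq (γ z)).add (b.hasSum_norm_inner_sq (β z))).div_const 2
  refine hasSum_integral_of_dominated_convergence
    (fun i z => (‖inner ℂ (γ z) (b i)‖ ^ 2 + ‖inner ℂ (β z) (b i)‖ ^ 2) / 2)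
    (fun i => ((hγbm i).mul (hbβm i)).aestronglyMeasurable)
    (fun i => ae_of_all _ fun z => ?_) (ae_of_all _ fun z => (hbound z).summable) ?_
    (ae_of_all _ fun z => b.hasSum_inner_mul_inner (γ z) (β z))
  -- the dominating function comes from the inequality of arithmetic and geometric means
  · rw [norm_mul, norm_inner_symm (b i) (β z)]
    nlinarith [sq_nonneg (‖inner ℂ (γ z) (b i)‖ - ‖inner ℂ (β z) (b i)‖)]
  · simp_rw [fun z => (hbound z).tsum_eq, hnβ, hnγ]
    have hsq : ∀ {t : ℝ}, 0 ≤ t → t ≤ M → ‖t ^ 2‖ ≤ M ^ 2 := fun {t} h0 h1 => by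
      rw [Real.norm_of_nonneg (sq_nonneg t)]
      exact pow_le_pow_left₀ h0 h1 2
    refine Integrable.div_const (Integrable.add ?_ ?_) 2
    · exact (Integrable.of_bound (μ := μ.prod μ) (f := fun p : α × α => ‖K₂ p.1 p.2‖ ^ 2)
        (hK₂.norm.pow_const 2).aestronglyMeasurable (M ^ 2)
        (ae_of_all _ fun p => hsq (norm_nonneg _) (hM₂ _ _))).integral_prod_left
    · exact (Integrable.of_bound (μ := μ.prod μ) (f := fun p : α × α => ‖K₁ p.1 p.2‖ ^ 2)
        (hK₁.norm.pow_const 2).aestronglyMeasurable (M ^ 2)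
        (ae_of_all _ fun p => hsq (norm_nonneg _) (hM₁ _ _))).integral_prod_right

end KernelOperator

/-! ### Continuous kernels on `X` -/

section Kernels

variable {X : Type*} [MetricSpace X] [ProperSpace X] [MeasurableSpace X] [BorelSpace X]
  {μ : Measure X}

theorem continuous_integral_of_eq_zero_off_compact [IsFiniteMeasureOnCompacts μ] {P : Type*}
    [TopologicalSpace P] [FirstCountableTopology P] [LocallyCompactSpace P] {g : P → X → ℂ}
    (hg : Continuous (Function.uncurry g)) {s : Set X} (hs : IsCompact s)
    (h : ∀ p, ∀ y ∉ s, g p y = 0) : Continuous fun p => ∫ y, g p y ∂μ := by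
  have h1 : (fun p => ∫ y, g p y ∂μ) = fun p => ∫ y in s, g p y ∂μ := by
    ext p
    exact (setIntegral_eq_integral_of_forall_compl_eq_zero fun y hy => h p y hy).symm
  rw [h1]
  exact continuous_parametric_integral_of_continuous hg hs

theorem continuous_integral_kernel_mul [IsFiniteMeasureOnCompacts μ] {k : X → X → ℂ}
    (hk : Continuous (Function.uncurry k)) {f : X → ℂ} (hf : Continuous f)
    (hfc : HasCompactSupport f) : Continuous fun x => ∫ y, k x y * f y ∂μ := by
  refine continuous_integral_of_eq_zero_off_compact (g := fun x y => k x y * f y) ?_ hfc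
    fun x y hy => ?_
  · exact hk.mul (hf.comp continuous_snd)
  · simp only [image_eq_zero_of_notMem_tsupport hy, mul_zero]

theorem continuous_kernel_left {k : X → X → ℂ} (hk : Continuous (Function.uncurry k)) (x : X) :
    Continuous (k x) := hk.comp (continuous_const.prodMk continuous_id)

theorem integrable_kernel_mul_of_hasCompactSupport [IsFiniteMeasureOnCompacts μ] {k : X → X → ℂ}
    (hk : Continuous (Function.uncurry k)) {f : X → ℂ} (hf : Continuous f)
    (hfc : HasCompactSupport f) (x : X) : Integrable (fun y => k x y * f y) μ :=
  ((continuous_kernel_left hk x).mul hf).integrable_of_hasCompactSupport hfc.mul_left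

/-- A continuous kernel whose integrals against test functions supported in `V` vanish almost
everywhere on `U` vanishes on `U × V`: test against the conjugate of the kernel itself. -/
theorem kernel_eq_zero_of_integral_eq_zero [IsFiniteMeasureOnCompacts μ] [μ.IsOpenPosMeasure]
    {k : X → X → ℂ} (hk : Continuous (Function.uncurry k)) {U V : Set X} (hU : IsOpen U)
    (hV : IsOpen V)
    (h : ∀ f : X → ℂ, Continuous f → HasCompactSupport f → tsupport f ⊆ V →
      ∀ᵐ x ∂μ, x ∈ U → ∫ y, k x y * f y ∂μ = 0) {x₀ y₀ : X} (hx₀ : x₀ ∈ U) (hy₀ : y₀ ∈ V) :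
    k x₀ y₀ = 0 := by
  by_contra hne
  obtain ⟨ε, hε, hεV⟩ := Metric.nhds_basis_closedBall.mem_iff.1 (hV.mem_nhds hy₀)
  let χ : X → ℝ := fun z => max 0 (ε - dist z y₀)
  have hχc : Continuous χ := continuous_const.max (continuous_const.sub
    (continuous_id.dist continuous_const))
  have hχ0 : ∀ z, 0 ≤ χ z := fun z => le_max_left _ _
  have hχs : Function.support χ ⊆ Metric.closedBall y₀ ε := by
    intro z hz
    by_contra hz'
    rw [Metric.mem_closedBall, not_le] at hz'
    exact hz (max_eq_left (by linarith))
  let f : X → ℂ := fun z => χ z * (starRingEnd ℂ) (k x₀ z)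
  have hf : Continuous f := (Complex.continuous_ofReal.comp hχc).mul
    (Complex.continuous_conj.comp (continuous_kernel_left hk x₀))
  have hfs : tsupport f ⊆ Metric.closedBall y₀ ε := by
    refine closure_minimal ?_ Metric.isClosed_closedBall
    intro z hz
    refine hχs fun h0 => hz ?_
    simp [f, h0]
  have hfc : HasCompactSupport f :=
    (isCompact_closedBall y₀ ε).of_isClosed_subset (isClosed_tsupport f) hfs
  have h1 := Measure.eqOn_open_of_ae_eq (μ := μ) (f := fun x => ∫ y, k x y * f y ∂μ)
    (g := fun _ => 0) ((ae_restrict_iff' hU.measurableSet).2 (h f hf hfc (hfs.trans hεV))) hU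
    (continuous_integral_kernel_mul hk hf hfc).continuousOn continuousOn_const hx₀
  have h2 : ∀ y, k x₀ y * f y = ((χ y * ‖k x₀ y‖ ^ 2 : ℝ) : ℂ) := fun y => by
    simp only [f]
    rw [mul_left_comm, Complex.mul_conj, Complex.normSq_eq_norm_sq]
    push_cast
    ring
  simp only [h2, integral_complex_ofReal] at h1
  have h3 : ∫ y, χ y * ‖k x₀ y‖ ^ 2 ∂μ = 0 := by exact_mod_cast h1
  refine absurd h3 (ne_of_gt ?_)
  refine Continuous.integral_pos_of_hasCompactSupport_nonneg_nonzero (x := y₀)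
    (hχc.mul ((continuous_kernel_left hk x₀).norm.pow 2)) ?_
    (fun y => mul_nonneg (hχ0 y) (sq_nonneg _)) ?_
  · have : HasCompactSupport χ := (isCompact_closedBall y₀ ε).of_isClosed_subset
      (isClosed_tsupport χ) (closure_minimal hχs Metric.isClosed_closedBall)
    exact this.mul_right
  · have : χ y₀ = ε := by simp [χ, hε.le]
    rw [this]
    positivity

theorem memLp_of_hasCompactSupport [IsFiniteMeasureOnCompacts μ] {f : X → ℂ} (hf : Continuous f)
    (hfc : HasCompactSupport f) : MemLp f 2 μ :=
  hf.memLp_of_hasCompactSupport hfc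

theorem IsContinuousKernel.unique [IsFiniteMeasureOnCompacts μ] [μ.IsOpenPosMeasure]
    {A : Lp ℂ 2 μ →L[ℂ] Lp ℂ 2 μ} {k k' : X → X → ℂ} (hk : IsContinuousKernel μ A k)
    (hk' : IsContinuousKernel μ A k') : k = k' := by
  ext x y
  rw [← sub_eq_zero]
  refine kernel_eq_zero_of_integral_eq_zero (μ := μ) (k := fun x y => k x y - k' x y)
    (hk.1.sub hk'.1) isOpen_univ isOpen_univ (fun f hf hfc _ => ?_) (Set.mem_univ x)
    (Set.mem_univ y)
  have hm := (memLp_of_hasCompactSupport (μ := μ) hf hfc)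
  filter_upwards [hk.2 f hf hfc _ hm.coeFn_toLp, hk'.2 f hf hfc _ hm.coeFn_toLp] with x h1 h2 _
  simp_rw [sub_mul]
  rw [integral_sub (integrable_kernel_mul_of_hasCompactSupport hk.1 hf hfc x)
    (integrable_kernel_mul_of_hasCompactSupport hk'.1 hf hfc x), ← h1, ← h2, sub_self]

/-- A continuous kernel which is invariant under all isometries and vanishes at large distances. -/
structure IsInvariantKernel (k : X → X → ℂ) : Prop where
  continuous : Continuous (Function.uncurry k)
  invariant : ∀ (g : X ≃ᵢ X) (x y : X), k (g x) (g y) = k x y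
  finite_range : ∃ r : ℝ, ∀ x y, r < dist x y → k x y = 0

theorem isInvariantKernel_zero : IsInvariantKernel (0 : X → X → ℂ) :=
  ⟨continuous_const, fun _ _ _ => rfl, 0, fun _ _ _ => rfl⟩

theorem IsInvariantKernel.add {k₁ k₂ : X → X → ℂ} (h₁ : IsInvariantKernel k₁)
    (h₂ : IsInvariantKernel k₂) : IsInvariantKernel (k₁ + k₂) := by
  obtain ⟨r₁, hr₁⟩ := h₁.finite_range
  obtain ⟨r₂, hr₂⟩ := h₂.finite_range
  refine ⟨h₁.continuous.add h₂.continuous, fun g x y => ?_, max r₁ r₂, fun x y h => ?_⟩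
  · simp only [Pi.add_apply, h₁.invariant, h₂.invariant]
  · simp only [Pi.add_apply, hr₁ x y ((le_max_left _ _).trans_lt h),
      hr₂ x y ((le_max_right _ _).trans_lt h), add_zero]

theorem IsInvariantKernel.smul {k : X → X → ℂ} (h : IsInvariantKernel k) (c : ℂ) :
    IsInvariantKernel (c • k) := by
  obtain ⟨r, hr⟩ := h.finite_range
  refine ⟨h.continuous.const_smul c, fun g x y => ?_, r, fun x y h => ?_⟩
  · simp only [Pi.smul_apply, h.invariant]
  · simp only [Pi.smul_apply, hr x y h, smul_zero]

/-- Isometries move each pair of points at bounded distance into a fixed compact set. -/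
theorem IsInvariantKernel.exists_bound {k : X → X → ℂ} (h : IsInvariantKernel k) {x₀ : X} {D : ℝ}
    (hD : ∀ x, ∃ g : X ≃ᵢ X, dist (g x₀) x ≤ D) : ∃ M : ℝ, ∀ x y, ‖k x y‖ ≤ M := by
  obtain ⟨r, hr⟩ := h.finite_range
  obtain ⟨M, hM⟩ := (((isCompact_closedBall x₀ D).prod
    (isCompact_closedBall x₀ (D + r))).bddAbove_image h.continuous.norm.continuousOn)
  refine ⟨max M 0, fun x y => ?_⟩
  rcases lt_or_ge r (dist x y) with hxy | hxy
  · rw [hr x y hxy, norm_zero]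
    exact le_max_right _ _
  · obtain ⟨g, hg⟩ := hD x
    refine le_trans ?_ (le_max_left _ _)
    rw [← h.invariant g.symm x y]
    refine hM ⟨(g.symm x, g.symm y), ⟨?_, ?_⟩, rfl⟩
    · rw [Metric.mem_closedBall, ← g.dist_eq, g.apply_symm_apply, dist_comm]
      exact hg
    · rw [Metric.mem_closedBall, ← g.dist_eq, g.apply_symm_apply]
      have := dist_triangle (g x₀) x y
      rw [dist_comm y]
      linarith

theorem integral_comp_isometry (hμ : IsInvariantMeasure μ) (g : X ≃ᵢ X) (f : X → ℂ) :
    ∫ x, f (g x) ∂μ = ∫ x, f x ∂μ :=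
  (hμ.measurePreserving g).integral_comp g.toHomeomorph.measurableEmbedding f

/-- The kernel of an operator in `𝒜` is invariant and vanishes at distances beyond the propagation
speed. -/
theorem exists_isInvariantKernel_of_mem_kernelAlgebra [μ.IsOpenPosMeasure]
    (hμ : IsInvariantMeasure μ) {A : Lp ℂ 2 μ →L[ℂ] Lp ℂ 2 μ} (hA : A ∈ kernelAlgebra μ) :
    ∃ k, IsContinuousKernel μ A k ∧ IsInvariantKernel k := by
  have := hμ.finite_on_compacts
  obtain ⟨hinv, ⟨k, hk⟩, r, hr0, hr⟩ := hA
  refine ⟨k, hk, hk.1, fun g x y => ?_, r, fun x₁ y₁ hxy => ?_⟩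
  · rw [← sub_eq_zero]
    have hkg : Continuous (Function.uncurry fun x y => k (g x) (g y)) :=
      hk.1.comp ((g.continuous.comp continuous_fst).prodMk (g.continuous.comp continuous_snd))
    refine kernel_eq_zero_of_integral_eq_zero (μ := μ) (k := fun x y => k (g x) (g y) - k x y)
      (hkg.sub hk.1) isOpen_univ isOpen_univ (fun f hf hfc _ => ?_) (Set.mem_univ x)
      (Set.mem_univ y)
    have hf' : Continuous fun x => f (g⁻¹ x) := hf.comp (g⁻¹).continuous
    have hfc' : HasCompactSupport fun x => f (g⁻¹ x) :=
      hfc.comp_homeomorph (g⁻¹).toHomeomorph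
    have hm := memLp_of_hasCompactSupport (μ := μ) hf hfc
    have hm' := memLp_of_hasCompactSupport (μ := μ) hf' hfc'
    have hq : ∀ h : X ≃ᵢ X, ∀ {p : X → Prop}, (∀ᵐ x ∂μ, p x) → ∀ᵐ x ∂μ, p (h x) := fun h p hp =>
      (hμ.measurePreserving h).quasiMeasurePreserving.ae hp
    have h1 : (hm'.toLp _ : X → ℂ) =ᵐ[μ] fun x => hm.toLp f (g⁻¹ • x) := by
      filter_upwards [hm'.coeFn_toLp, hq g⁻¹ hm.coeFn_toLp] with x h1 h2
      rw [h1]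
      exact h2.symm
    have h2 := hinv g (hm.toLp f) (hm'.toLp _) h1
    have h3 := hk.2 _ hf' hfc' _ hm'.coeFn_toLp
    have h4 := hk.2 _ hf hfc _ hm.coeFn_toLp
    filter_upwards [hq g h2, hq g h3, h4] with x h5 h6 h7 _
    have h8 : g⁻¹ • g x = x := g.symm_apply_apply x
    rw [h6, h8, h7] at h5
    simp_rw [sub_mul]
    rw [integral_sub (integrable_kernel_mul_of_hasCompactSupport hkg hf hfc x)
      (integrable_kernel_mul_of_hasCompactSupport hk.1 hf hfc x), ← h5,
      ← integral_comp_isometry hμ g (fun y => k (g x) y * f (g⁻¹ y)), sub_eq_zero]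
    refine integral_congr_ae (ae_of_all _ fun y => ?_)
    have h9 : g⁻¹ (g y) = y := g.symm_apply_apply y
    simp only [h9]
  · have hε : 0 < (dist x₁ y₁ - r) / 2 := by linarith
    have hU : IsOpen {x | r + (dist x₁ y₁ - r) / 2 < dist x y₁} :=
      isOpen_lt continuous_const (continuous_id.dist continuous_const)
    refine kernel_eq_zero_of_integral_eq_zero (μ := μ) hk.1 hU
      (Metric.isOpen_ball (x := y₁) (ε := (dist x₁ y₁ - r) / 2)) (fun f hf hfc hfV => ?_) ?_
      (Metric.mem_ball_self hε)
    · have hm := memLp_of_hasCompactSupport (μ := μ) hf hfc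
      filter_upwards [hk.2 _ hf hfc _ hm.coeFn_toLp, hr f hf hfc _ hm.coeFn_toLp] with x h1 h2 hx
      rw [← h1]
      refine h2 fun hx' => ?_
      obtain ⟨z, hz, hxz⟩ := Metric.mem_thickening_iff.1 hx'
      have h3 : dist z y₁ < (dist x₁ y₁ - r) / 2 := hfV hz
      have h4 : r + (dist x₁ y₁ - r) / 2 < dist x y₁ := hx
      linarith [dist_triangle x z y₁]
    · change r + (dist x₁ y₁ - r) / 2 < dist x₁ y₁
      linarith

/-! ### Composition of kernels -/

/-- The kernel of the product of the operators with kernels `k₁` and `k₂`. -/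
noncomputable def compKernel (μ : Measure X) (k₁ k₂ : X → X → ℂ) (x y : X) : ℂ :=
  ∫ z, k₁ x z * k₂ z y ∂μ

theorem continuous_compKernel_integrand {k₁ k₂ : X → X → ℂ}
    (h₁ : Continuous (Function.uncurry k₁)) (h₂ : Continuous (Function.uncurry k₂)) :
    Continuous (Function.uncurry fun (p : X × X) z => k₁ p.1 z * k₂ z p.2) :=
  (h₁.comp ((continuous_fst.comp continuous_fst).prodMk continuous_snd)).mul
    (h₂.comp (continuous_snd.prodMk (continuous_snd.comp continuous_fst)))

theorem IsInvariantKernel.comp (hμ : IsInvariantMeasure μ) {k₁ k₂ : X → X → ℂ}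
    (h₁ : IsInvariantKernel k₁) (h₂ : IsInvariantKernel k₂) :
    IsInvariantKernel (compKernel μ k₁ k₂) := by
  have := hμ.finite_on_compacts
  obtain ⟨r₁, hr₁⟩ := h₁.finite_range
  obtain ⟨r₂, hr₂⟩ := h₂.finite_range
  refine ⟨?_, fun g x y => ?_, r₁ + r₂, fun x y h => ?_⟩
  · rw [continuous_iff_continuousAt]
    rintro ⟨x₀, y₀⟩
    have hc : Continuous fun p : X × X => ∫ z in Metric.closedBall x₀ (r₁ + 1),
        k₁ p.1 z * k₂ z p.2 ∂μ :=
      continuous_parametric_integral_of_continuous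
        (continuous_compKernel_integrand h₁.continuous h₂.continuous) (isCompact_closedBall _ _)
    refine hc.continuousAt.congr ?_
    have hn : {p : X × X | dist p.1 x₀ < 1} ∈ 𝓝 (x₀, y₀) :=
      (isOpen_lt (continuous_fst.dist continuous_const) continuous_const).mem_nhds (by simp)
    filter_upwards [hn] with p hp
    refine setIntegral_eq_integral_of_forall_compl_eq_zero fun z hz => ?_
    rw [hr₁ p.1 z, zero_mul]
    rw [Metric.mem_closedBall, not_le] at hz
    have hp' : dist p.1 x₀ < 1 := hp
    have := dist_triangle z p.1 x₀
    rw [dist_comm z p.1] at this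
    linarith
  · rw [compKernel, ← integral_comp_isometry hμ g]
    simp_rw [h₁.invariant, h₂.invariant]
    rfl
  · rw [compKernel]
    refine integral_eq_zero_of_ae (ae_of_all _ fun z => ?_)
    rcases lt_or_ge r₁ (dist x z) with hz | hz
    · simp [hr₁ x z hz]
    · simp [hr₂ z y (by linarith [dist_triangle x z y])]

/-- The image of a test function under a kernel of finite range is a test function. -/
theorem hasCompactSupport_integral_kernel_mul {k : X → X → ℂ} (hk : IsInvariantKernel k)
    {f : X → ℂ} (hfc : HasCompactSupport f) :
    HasCompactSupport fun x => ∫ y, k x y * f y ∂μ := by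
  obtain ⟨r, hr⟩ := hk.finite_range
  refine HasCompactSupport.intro (hfc.cthickening (r := max r 0)) fun x hx => ?_
  refine integral_eq_zero_of_ae (ae_of_all _ fun y => ?_)
  by_cases hy : y ∈ tsupport f
  · simp only [Pi.zero_apply]
    rw [hr x y, zero_mul]
    by_contra hxy
    exact hx (Metric.mem_cthickening_of_dist_le x y _ _ hy ((not_lt.1 hxy).trans (le_max_left _ _)))
  · simp [image_eq_zero_of_notMem_tsupport hy]

/-- The kernel of a product of operators is the composition of their kernels. -/
theorem IsContinuousKernel.comp (hμ : IsInvariantMeasure μ) {A B : Lp ℂ 2 μ →L[ℂ] Lp ℂ 2 μ}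
    {k₁ k₂ : X → X → ℂ} (hA : IsContinuousKernel μ A k₁) (hB : IsContinuousKernel μ B k₂)
    (h₁ : IsInvariantKernel k₁) (h₂ : IsInvariantKernel k₂) :
    IsContinuousKernel μ (A.comp B) (compKernel μ k₁ k₂) := by
  have := hμ.finite_on_compacts
  refine ⟨(h₁.comp hμ h₂).continuous, fun f hf hfc u hu => ?_⟩
  have hBu := hB.2 f hf hfc u hu
  have hA' := hA.2 _ (continuous_integral_kernel_mul (μ := μ) hB.1 hf hfc)
    (hasCompactSupport_integral_kernel_mul h₂ hfc) _ hBu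
  filter_upwards [hA'] with x hx
  rw [ContinuousLinearMap.comp_apply, hx]
  obtain ⟨r₁, hr₁⟩ := h₁.finite_range
  have hint : Integrable (Function.uncurry fun z y => k₁ x z * (k₂ z y * f y)) (μ.prod μ) := by
    have hc : Continuous (Function.uncurry fun z y => k₁ x z * (k₂ z y * f y)) :=
      ((continuous_kernel_left h₁.continuous x).comp continuous_fst).mul
        (h₂.continuous.mul (hf.comp continuous_snd))
    refine hc.integrable_of_hasCompactSupport (HasCompactSupport.intro
      ((isCompact_closedBall x r₁).prod hfc) fun p hp => ?_)
    simp only [Function.uncurry]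
    by_cases h : p.2 ∈ tsupport f
    · rw [hr₁ x p.1, zero_mul]
      by_contra h'
      exact hp ⟨by rw [Metric.mem_closedBall, dist_comm]; exact not_lt.1 h', h⟩
    · rw [image_eq_zero_of_notMem_tsupport h, mul_zero, mul_zero]
  have hsw := integral_integral_swap hint
  calc ∫ z, k₁ x z * ∫ y, k₂ z y * f y ∂μ ∂μ
      = ∫ z, ∫ y, k₁ x z * (k₂ z y * f y) ∂μ ∂μ := by simp_rw [integral_const_mul]
    _ = ∫ y, ∫ z, k₁ x z * (k₂ z y * f y) ∂μ ∂μ := hsw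
    _ = ∫ y, compKernel μ k₁ k₂ x y * f y ∂μ := by
        simp_rw [compKernel, ← integral_mul_const, mul_assoc]

theorem isContinuousKernel_zero : IsContinuousKernel μ 0 (0 : X → X → ℂ) :=
  ⟨continuous_const, fun f _ _ u _ => by
    filter_upwards [Lp.coeFn_zero ℂ 2 μ] with x hx
    simpa using hx⟩

theorem IsContinuousKernel.add [IsFiniteMeasureOnCompacts μ] {A B : Lp ℂ 2 μ →L[ℂ] Lp ℂ 2 μ}
    {k₁ k₂ : X → X → ℂ} (hA : IsContinuousKernel μ A k₁) (hB : IsContinuousKernel μ B k₂) :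
    IsContinuousKernel μ (A + B) (k₁ + k₂) :=
  ⟨hA.1.add hB.1, fun f hf hfc u hu => by
    filter_upwards [hA.2 f hf hfc u hu, hB.2 f hf hfc u hu, Lp.coeFn_add (A u) (B u)]
      with x h1 h2 h3
    rw [add_apply, h3, Pi.add_apply, h1, h2, ← integral_add
      (integrable_kernel_mul_of_hasCompactSupport hA.1 hf hfc x)
      (integrable_kernel_mul_of_hasCompactSupport hB.1 hf hfc x)]
    simp_rw [Pi.add_apply, add_mul]⟩

theorem IsContinuousKernel.smul {A : Lp ℂ 2 μ →L[ℂ] Lp ℂ 2 μ}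
    {k : X → X → ℂ} (hA : IsContinuousKernel μ A k) (c : ℂ) :
    IsContinuousKernel μ (c • A) (c • k) :=
  ⟨hA.1.const_smul c, fun f hf hfc u hu => by
    filter_upwards [hA.2 f hf hfc u hu, Lp.coeFn_smul c (A u)] with x h1 h2
    rw [smul_apply, h2, Pi.smul_apply, h1, smul_eq_mul, ← integral_const_mul]
    simp_rw [Pi.smul_apply, smul_eq_mul, mul_assoc]⟩

/-! ### Operators with a prescribed invariant kernel -/

/-- Every invariant kernel of finite range belongs to an operator in `𝒜`. -/
theorem IsInvariantKernel.exists_mem_kernelAlgebra (hμ : IsInvariantMeasure μ) {k : X → X → ℂ}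
    (hk : IsInvariantKernel k) {x₀ : X} {D : ℝ}
    (hD : ∀ x, ∃ g : X ≃ᵢ X, dist (g x₀) x ≤ D) :
    ∃ A ∈ kernelAlgebra μ, IsContinuousKernel μ A k := by
  have := hμ.finite_on_compacts
  obtain ⟨M, hM⟩ := hk.exists_bound hD
  obtain ⟨r, hr⟩ := hk.finite_range
  have hball : ∀ x, μ (Metric.closedBall x r) ≤ μ (Metric.closedBall x₀ (r + D)) := by
    intro x
    obtain ⟨g, hg⟩ := hD x
    rw [← (hμ.measurePreserving g).measure_preimage
      Metric.isClosed_closedBall.measurableSet.nullMeasurableSet]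
    refine measure_mono fun z hz => ?_
    have hz' : dist (g z) x ≤ r := hz
    rw [Metric.mem_closedBall, ← g.dist_eq]
    have := dist_triangle (g z) x (g x₀)
    rw [dist_comm x] at this
    linarith
  have hle : ∀ x y, ‖k x y‖ₑ ≤ ENNReal.ofReal M := fun x y => by
    rw [← ofReal_norm]
    exact ENNReal.ofReal_le_ofReal (hM x y)
  have hfin : ENNReal.ofReal M * μ (Metric.closedBall x₀ (r + D)) ≠ ∞ :=
    ENNReal.mul_ne_top ENNReal.ofReal_ne_top (isCompact_closedBall _ _).measure_lt_top.ne
  have hbd : ∀ (F : X → ℂ) (x : X), (∀ y, ‖F y‖ₑ ≤ ENNReal.ofReal M) →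
      (∀ y, r < dist x y → F y = 0) → ∫⁻ y, ‖F y‖ₑ ∂μ ≤
        (ENNReal.ofReal M * μ (Metric.closedBall x₀ (r + D))).toNNReal := by
    intro F x h1 h2
    rw [ENNReal.coe_toNNReal hfin]
    refine le_trans ?_ (mul_le_mul_right (hball x) _)
    rw [← lintegral_indicator_const Metric.isClosed_closedBall.measurableSet]
    refine lintegral_mono fun y => ?_
    by_cases hy : y ∈ Metric.closedBall x r
    · simpa [Set.indicator_of_mem hy] using h1 y
    · rw [h2 y]
      · simp
      · rw [Metric.mem_closedBall, not_le, dist_comm] at hy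
        exact hy
  obtain ⟨A, hA⟩ := exists_isKernelOperator (μ := μ) hk.continuous.measurable
    (ENNReal.ofReal M * μ (Metric.closedBall x₀ (r + D))).toNNReal
    (fun x => hbd _ x (fun y => hle x y) (fun y => hr x y))
    (fun y => hbd _ y (fun x => hle x y) (fun x h => hr x y (by rwa [dist_comm])))
  have hcont : IsContinuousKernel μ A k := by
    refine ⟨hk.continuous, fun f hf hfc u hu => ?_⟩
    filter_upwards [hA u] with x hx
    rw [hx]
    refine integral_congr_ae ?_
    filter_upwards [hu] with y hy
    rw [hy]
  refine ⟨A, ⟨fun φ f g hfg => ?_, ⟨k, hcont⟩, max r 0 + 1, by positivity,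
    fun f hf hfc u hu => ?_⟩, hcont⟩
  · have hAf := (hμ.measurePreserving φ⁻¹).quasiMeasurePreserving.ae (hA f)
    filter_upwards [hA g, hAf] with x h1 h2
    rw [h1]
    refine Eq.trans ?_ h2.symm
    rw [← integral_comp_isometry hμ φ⁻¹ (fun y => k (φ⁻¹ x) y * f y)]
    refine integral_congr_ae ?_
    filter_upwards [hfg] with y hy
    rw [hy, hk.invariant]
    rfl
  · filter_upwards [hcont.2 f hf hfc u hu] with x hx hx'
    rw [hx]
    refine integral_eq_zero_of_ae (ae_of_all _ fun y => ?_)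
    by_cases hy : y ∈ tsupport f
    · simp only [Pi.zero_apply]
      rw [hr x y, zero_mul]
      by_contra h
      refine hx' (Metric.mem_thickening_iff.2 ⟨y, hy, ?_⟩)
      linarith [not_lt.1 h, le_max_left r 0]
    · simp [image_eq_zero_of_notMem_tsupport hy]

end Kernels

/-! ### Periodic kernels -/

section PeriodicKernel

variable {X : Type*} [MetricSpace X] [ProperSpace X] [MeasurableSpace X] [BorelSpace X]
  {μ : Measure X} {Γ : Subgroup (X ≃ᵢ X)} {F : Set X}

/-- The kernel `∑ γ, k(x, γ y)` of the operator induced on `L²(Γ \ X)`. For a lattice and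
a kernel of finite range, the sum has only finitely many nonzero terms. -/
noncomputable def periodicKernel (Γ : Subgroup (X ≃ᵢ X)) (k : X → X → ℂ) (x y : X) : ℂ :=
  ∑' γ : Γ, k x (γ • y)

theorem isometry_smul_dist (γ : Γ) (x y : X) : dist (γ • x) (γ • y) = dist x y :=
  (γ : X ≃ᵢ X).dist_eq x y

theorem IsLattice.exists_card_le (hΓ : IsLattice Γ) (r : ℝ) :
    ∃ N : ℕ, ∀ x y : X,
      {γ : Γ | dist x (γ • y) ≤ r}.Finite ∧ {γ : Γ | dist x (γ • y) ≤ r}.ncard ≤ N := by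
  rcases isEmpty_or_nonempty X with hX | ⟨⟨x₀⟩⟩
  · exact ⟨0, fun x => (hX.false x).elim⟩
  obtain ⟨D, hD⟩ := hΓ.exists_dist_le x₀
  obtain ⟨N, hN⟩ := BenjaminiSchramm.exists_card_le x₀
    (fun x => let ⟨γ, hγ⟩ := hD x; ⟨(γ : X ≃ᵢ X), hγ⟩) hΓ.radius_pos r
  exact ⟨N, hN Γ le_rfl⟩

theorem IsLattice.finite_setOf_dist_le (hΓ : IsLattice Γ) (r : ℝ) (x y : X) :
    {γ : Γ | dist x (γ • y) ≤ r}.Finite :=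
  let ⟨_, hN⟩ := hΓ.exists_card_le r
  (hN x y).1

/-- A sum with at most `N` terms, each bounded by `M`. -/
theorem norm_tsum_le_of_ncard_le {ι : Type*} {a : ι → ℂ} {S : Set ι} (hS : S.Finite) {N : ℕ}
    (hN : S.ncard ≤ N) {M : ℝ} (hM0 : 0 ≤ M) (hM : ∀ i, ‖a i‖ ≤ M) (h0 : ∀ i ∉ S, a i = 0) :
    ‖∑' i, a i‖ ≤ N * M := by
  rw [tsum_eq_sum (s := hS.toFinset) fun i hi => h0 i (by simpa using hi)]
  refine (norm_sum_le_of_le _ fun i _ => hM i).trans ?_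
  rw [Finset.sum_const, nsmul_eq_mul, ← Set.ncard_eq_toFinset_card _ hS]
  gcongr

theorem periodicKernel_add (hΓ : IsLattice Γ) {k₁ k₂ : X → X → ℂ} (h₁ : IsInvariantKernel k₁)
    (h₂ : IsInvariantKernel k₂) (x y : X) :
    periodicKernel Γ (k₁ + k₂) x y = periodicKernel Γ k₁ x y + periodicKernel Γ k₂ x y := by
  have hs : ∀ {k : X → X → ℂ}, IsInvariantKernel k → Summable fun γ : Γ => k x (γ • y) := by
    intro k hk
    obtain ⟨r, hr⟩ := hk.finite_range
    refine summable_of_hasFiniteSupport ((hΓ.finite_setOf_dist_le r x y).subset fun γ hγ => ?_)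
    by_contra h
    exact hγ (hr _ _ (not_le.1 h))
  exact (hs h₁).tsum_add (hs h₂)

theorem periodicKernel_smul (c : ℂ) (k : X → X → ℂ) (x y : X) :
    periodicKernel Γ (c • k) x y = c * periodicKernel Γ k x y := tsum_mul_left

theorem periodicKernel_zero (x y : X) : periodicKernel Γ (0 : X → X → ℂ) x y = 0 := tsum_zero

theorem periodicKernel_smul_right (k : X → X → ℂ)
    (δ : Γ) (x y : X) : periodicKernel Γ k x (δ • y) = periodicKernel Γ k x y := by
  rw [periodicKernel, periodicKernel, ← (Equiv.mulRight δ).tsum_eq fun γ : Γ => k x (γ • y)]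
  simp [mul_smul]

theorem IsInvariantKernel.apply_smul_left {k : X → X → ℂ} (hk : IsInvariantKernel k)
    (δ : Γ) (x y : X) : k (δ • x) y = k x (δ⁻¹ • y) := by
  have := hk.invariant (δ : X ≃ᵢ X) x (δ⁻¹ • y)
  rw [← this]
  congr 1
  exact (smul_inv_smul δ y).symm

theorem IsInvariantKernel.periodicKernel_smul_left {k : X → X → ℂ} (hk : IsInvariantKernel k)
    (δ : Γ) (x y : X) : periodicKernel Γ k (δ • x) y = periodicKernel Γ k x y := by
  rw [periodicKernel, periodicKernel, ← (Equiv.mulLeft δ⁻¹).tsum_eq fun γ : Γ => k x (γ • y)]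
  simp [mul_smul, hk.apply_smul_left]

theorem IsInvariantKernel.measurable_periodicKernel [Countable Γ] {k : X → X → ℂ}
    (hk : IsInvariantKernel k) : Measurable (Function.uncurry (periodicKernel Γ k)) := by
  refine Measurable.tsum fun γ : Γ => ?_
  exact (hk.continuous.comp (continuous_fst.prodMk (continuous_snd.const_smul γ))).measurable

theorem IsInvariantKernel.exists_bound_of_isLattice (hΓ : IsLattice Γ) {k : X → X → ℂ}
    (hk : IsInvariantKernel k) : ∃ M : ℝ, ∀ x y, ‖k x y‖ ≤ M := by
  rcases isEmpty_or_nonempty X with hX | ⟨⟨x₀⟩⟩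
  · exact ⟨0, fun x => (hX.false x).elim⟩
  obtain ⟨D, hD⟩ := hΓ.exists_dist_le x₀
  exact hk.exists_bound (fun x => let ⟨γ, hγ⟩ := hD x; ⟨(γ : X ≃ᵢ X), hγ⟩)

theorem IsInvariantKernel.exists_bound_periodicKernel (hΓ : IsLattice Γ) {k : X → X → ℂ}
    (hk : IsInvariantKernel k) : ∃ M : ℝ, ∀ x y, ‖periodicKernel Γ k x y‖ ≤ M := by
  obtain ⟨M, hM⟩ := hk.exists_bound_of_isLattice hΓ
  obtain ⟨r, hr⟩ := hk.finite_range
  obtain ⟨N, hN⟩ := hΓ.exists_card_le r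
  refine ⟨N * max M 0, fun x y => ?_⟩
  refine norm_tsum_le_of_ncard_le (hN x y).1 (hN x y).2 (le_max_right _ _)
    (fun γ => (hM _ _).trans (le_max_left _ _)) fun γ hγ => hr _ _ (not_le.1 hγ)

theorem tsum_integral_of_finite {ι : Type*} {S : Set ι} (hS : S.Finite) {a : ι → X → ℂ}
    (ha : ∀ i, Integrable (a i) μ) (h0 : ∀ i ∉ S, ∀ x, a i x = 0) :
    ∑' i, ∫ x, a i x ∂μ = ∫ x, ∑' i, a i x ∂μ := by
  have h1 : ∀ x, ∑' i, a i x = ∑ i ∈ hS.toFinset, a i x := fun x =>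
    tsum_eq_sum fun i hi => h0 i (by simpa using hi) x
  simp_rw [h1]
  rw [integral_finsetSum _ fun i _ => ha i, tsum_eq_sum fun i hi => ?_]
  simp only [h0 i (by simpa using hi), integral_zero]

theorem integrable_tsum_of_finite {ι : Type*} {S : Set ι} (hS : S.Finite) {a : ι → X → ℂ}
    (ha : ∀ i, Integrable (a i) μ) (h0 : ∀ i ∉ S, ∀ x, a i x = 0) :
    Integrable (fun x => ∑' i, a i x) μ := by
  have h1 : (fun x => ∑' i, a i x) = fun x => ∑ i ∈ hS.toFinset, a i x := funext fun x =>
    tsum_eq_sum fun i hi => h0 i (by simpa using hi) x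
  rw [h1]
  exact integrable_finsetSum _ fun i _ => ha i

/-- The unfolding formula for Bochner integrals. -/
theorem integral_eq_setIntegral_tsum [Countable Γ] [SMulInvariantMeasure Γ X μ]
    (hF : IsFundamentalDomain Γ F μ) {f : X → ℂ} (hf : Measurable f) (hfi : Integrable f μ) :
    ∫ x, f x ∂μ = ∫ x in F, ∑' γ : Γ, f (γ • x) ∂μ := by
  rw [hF.integral_eq_tsum'' f hfi, integral_tsum]
  · exact fun γ => (hf.comp (measurable_const_smul γ)).aestronglyMeasurable
  · rw [← hF.lintegral_eq_tsum'' fun x => ‖f x‖ₑ]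
    exact hfi.2.ne

/-- Periodisation turns composition over `X` into composition over `Γ \ X`. -/
theorem periodicKernel_compKernel (hΓ : IsLattice Γ) (hμ : IsInvariantMeasure μ)
    (hF : IsFundamentalDomain Γ F μ) {k₁ k₂ : X → X → ℂ} (h₁ : IsInvariantKernel k₁)
    (h₂ : IsInvariantKernel k₂) (x y : X) :
    periodicKernel Γ (compKernel μ k₁ k₂) x y =
      ∫ z in F, periodicKernel Γ k₁ x z * periodicKernel Γ k₂ z y ∂μ := by
  have := hμ.finite_on_compacts
  have := hμ.smulInvariantMeasure Γ
  have := hμ.nonempty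
  have := hΓ.countable
  obtain ⟨r₁, hr₁⟩ := h₁.finite_range
  obtain ⟨r₂, hr₂⟩ := h₂.finite_range
  have hfin := hΓ.finite_setOf_dist_le (r₁ + r₂) x y
  have hint : ∀ γ : Γ, Integrable (fun z => k₁ x z * k₂ z (γ • y)) μ := fun γ => by
    refine Continuous.integrable_of_hasCompactSupport
      ((continuous_kernel_left h₁.continuous x).mul
        (h₂.continuous.comp (continuous_id.prodMk continuous_const)))
      (HasCompactSupport.intro (isCompact_closedBall x r₁) fun z hz => ?_)
    rw [Metric.mem_closedBall, not_le, dist_comm] at hz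
    rw [hr₁ x z hz, zero_mul]
  have h0 : ∀ γ ∉ {γ : Γ | dist x (γ • y) ≤ r₁ + r₂}, ∀ z, k₁ x z * k₂ z (γ • y) = 0 := by
    intro γ hγ z
    have hγ' : r₁ + r₂ < dist x (γ • y) := not_le.1 hγ
    rcases lt_or_ge r₁ (dist x z) with hz | hz
    · rw [hr₁ x z hz, zero_mul]
    · rw [hr₂ z (γ • y) (by linarith [dist_triangle x z (γ • y)]), mul_zero]
  have hP : ∀ z, ∑' γ : Γ, k₁ x z * k₂ z (γ • y) = k₁ x z * periodicKernel Γ k₂ z y :=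
    fun z => tsum_mul_left
  calc periodicKernel Γ (compKernel μ k₁ k₂) x y
      = ∫ z, ∑' γ : Γ, k₁ x z * k₂ z (γ • y) ∂μ := tsum_integral_of_finite hfin hint h0
    _ = ∫ z, k₁ x z * periodicKernel Γ k₂ z y ∂μ := by simp_rw [hP]
    _ = ∫ z in F, ∑' δ : Γ, k₁ x (δ • z) * periodicKernel Γ k₂ (δ • z) y ∂μ := by
        refine integral_eq_setIntegral_tsum hF
          (f := fun z => k₁ x z * periodicKernel Γ k₂ z y) ?_ ?_
        · exact (continuous_kernel_left h₁.continuous x).measurable.mul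
            (h₂.measurable_periodicKernel.comp measurable_prodMk_right)
        · simp_rw [← hP]
          exact integrable_tsum_of_finite hfin hint h0
    _ = _ := by
        simp_rw [h₂.periodicKernel_smul_left, tsum_mul_right]
        rfl

/-! ### Induced operators -/

/-- The Borel set of representatives for a lattice gives a measurable section of the orbit map. -/
theorem IsLattice.exists_measurable_section (hΓ : IsLattice Γ) :
    ∃ s : OrbitSpace Γ X → X, Measurable s ∧
      ∀ q, Quotient.mk (MulAction.orbitRel Γ X) (s q) = q := by
  rcases isEmpty_or_nonempty X with hX | hX
  · have : IsEmpty (OrbitSpace Γ X) := ⟨fun q => (hX.false q.out).elim⟩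
    exact ⟨fun q => q.out, measurable_of_empty _, fun q => (this.false q).elim⟩
  have := hΓ.countable
  obtain ⟨F, hF, h⟩ := exists_representatives hΓ.radius_pos
  have hex : ∀ q : OrbitSpace Γ X, ∃ y ∈ F, Quotient.mk (MulAction.orbitRel Γ X) y = q := by
    intro q
    induction q using Quotient.inductionOn with
    | h x =>
    obtain ⟨γ, hγ, -⟩ := h x
    exact ⟨γ • x, hγ, Quotient.sound ⟨γ, rfl⟩⟩
  choose s hsF hs using hex
  refine ⟨s, fun B hB => ?_, hs⟩
  rw [measurableSet_quotient]
  have : Quotient.mk'' ⁻¹' (s ⁻¹' B) = ⋃ γ : Γ, (fun x : X => γ • x) ⁻¹' (F ∩ B) := by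
    ext x
    simp only [Set.mem_preimage, Set.mem_iUnion]
    obtain ⟨γ, hγ⟩ := Quotient.exact (hs (Quotient.mk'' x))
    have hγ' : γ • x = s (Quotient.mk'' x) := hγ
    constructor
    · intro hx
      exact ⟨γ, by rw [hγ']; exact ⟨hsF _, hx⟩⟩
    · rintro ⟨δ, hδ⟩
      have hδF : δ • x ∈ F := hδ.1
      have : δ = γ := (h x).unique hδF (by rw [hγ']; exact hsF _)
      rw [← hγ', ← this]
      exact hδ.2
  rw [this]
  exact MeasurableSet.iUnion fun γ => (hF.inter hB).preimage (measurable_const_smul γ)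

theorem IsLattice.isFiniteMeasure_quotientMeasure (hΓ : IsLattice Γ) (hμ : IsInvariantMeasure μ) :
    IsFiniteMeasure (quotientMeasure Γ μ) := by
  have := hμ.smulInvariantMeasure Γ
  have := hμ.nonempty
  have := hΓ.countable
  obtain ⟨F, hF⟩ := hΓ.exists_isFundamentalDomain μ
  exact ⟨by rw [quotientMeasure_univ hF]; exact hΓ.measure_lt_top hμ hF⟩

/-- `L²(Γ \ X)` embeds isometrically into `L²` of a fundamental domain, so it is separable. -/
theorem IsLattice.secondCountable_Lp (hΓ : IsLattice Γ) (hμ : IsInvariantMeasure μ) :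
    SecondCountableTopology (Lp ℂ 2 (quotientMeasure Γ μ)) := by
  have := hμ.finite_on_compacts
  have := hμ.smulInvariantMeasure Γ
  have := hμ.nonempty
  have := hΓ.countable
  obtain ⟨F, hF⟩ := hΓ.exists_isFundamentalDomain μ
  have hmp : MeasurePreserving (Quotient.mk (MulAction.orbitRel Γ X)) (μ.restrict F)
      (quotientMeasure Γ μ) := ⟨measurable_orbitMk, (quotientMeasure_eq_map hF).symm⟩
  have : Fact ((2 : ℝ≥0∞) ≠ ∞) := ⟨ENNReal.ofNat_ne_top⟩
  exact (Lp.isometry_compMeasurePreserving (E := ℂ) (p := 2)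
    hmp).isEmbedding.secondCountableTopology

/-- A property of orbits which holds almost everywhere upstairs holds almost everywhere on the
quotient. -/
theorem ae_quotientMeasure_of_ae [Countable Γ] [SMulInvariantMeasure Γ X μ]
    (hF : IsFundamentalDomain Γ F μ) {p : OrbitSpace Γ X → Prop} (hp : MeasurableSet {q | p q})
    (h : ∀ᵐ x ∂μ, p (Quotient.mk _ x)) : ∀ᵐ q ∂(quotientMeasure Γ μ), p q := by
  rw [quotientMeasure_eq_map hF, ae_map_iff measurable_orbitMk.aemeasurable hp]
  exact ae_restrict_of_ae h

theorem periodize_mk (f : X → ℂ) (x : X) :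
    periodize Γ f (Quotient.mk _ x) = ∑' γ : Γ, f (γ • x) := rfl

theorem periodize_apply_section (f : X → ℂ) {s : OrbitSpace Γ X → X}
    (hs : ∀ q, Quotient.mk (MulAction.orbitRel Γ X) (s q) = q) (q : OrbitSpace Γ X) :
    periodize Γ f q = ∑' γ : Γ, f (γ • s q) := by
  conv_lhs => rw [← hs q]
  rfl

theorem measurable_periodize [Countable Γ] {f : X → ℂ} (hf : Measurable f) :
    Measurable (periodize Γ f) :=
  measurable_from_quotient.2 (Measurable.tsum fun γ : Γ => hf.comp (measurable_const_smul γ))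

/-- The integral operator on `L²(Γ \ X)` with the periodised kernel is the operator induced
by `A`. -/
theorem isInducedOperator_of_isKernelOperator (hΓ : IsLattice Γ) (hμ : IsInvariantMeasure μ)
    {A : Lp ℂ 2 μ →L[ℂ] Lp ℂ 2 μ} {k : X → X → ℂ} (hA : IsContinuousKernel μ A k)
    (hk : IsInvariantKernel k) {s : OrbitSpace Γ X → X}
    (hs : ∀ q, Quotient.mk (MulAction.orbitRel Γ X) (s q) = q)
    {T : Lp ℂ 2 (quotientMeasure Γ μ) →L[ℂ] Lp ℂ 2 (quotientMeasure Γ μ)}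
    (hT : IsKernelOperator (quotientMeasure Γ μ)
      (fun q q' => periodicKernel Γ k (s q) (s q')) T) :
    IsInducedOperator μ A Γ T := by
  have := hμ.finite_on_compacts
  have := hμ.smulInvariantMeasure Γ
  obtain ⟨y₀⟩ := hμ.nonempty
  have : Nonempty X := ⟨y₀⟩
  have := hΓ.countable
  obtain ⟨F, hF⟩ := hΓ.exists_isFundamentalDomain μ
  intro f hf hfc u hu v hv
  obtain ⟨r, hr⟩ := hk.finite_range
  obtain ⟨ρ, hρ⟩ := hfc.isBounded.subset_closedBall y₀
  -- only finitely many elements of `Γ` contribute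
  have hint : ∀ (x : X) (γ : Γ), Integrable (fun y => k x (γ • y) * f y) μ := fun x γ =>
    integrable_kernel_mul_of_hasCompactSupport (k := fun x y => k x (γ • y))
      (hk.continuous.comp (continuous_fst.prodMk (continuous_snd.const_smul γ))) hf hfc x
  have h0 : ∀ x : X, ∀ γ ∉ {γ : Γ | dist x (γ • y₀) ≤ r + ρ}, ∀ y, k x (γ • y) * f y = 0 := by
    intro x γ hγ y
    have hγ' : r + ρ < dist x (γ • y₀) := not_le.1 hγ
    by_cases hy : y ∈ tsupport f
    · rw [hr, zero_mul]
      have h1 : dist (γ • y) (γ • y₀) ≤ ρ := by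
        rw [isometry_smul_dist]
        exact hρ hy
      linarith [dist_triangle x (γ • y) (γ • y₀)]
    · rw [image_eq_zero_of_notMem_tsupport hy, mul_zero]
  have hsum : ∀ x y : X, ∑' γ : Γ, k x (γ • y) * f y = periodicKernel Γ k x y * f y :=
    fun x y => tsum_mul_right
  have hleft : ∀ q : OrbitSpace Γ X,
      ∫ q', periodicKernel Γ k (s q) (s q') * v q' ∂(quotientMeasure Γ μ) =
        ∫ y, periodicKernel Γ k (s q) y * f y ∂μ := by
    intro q
    have hPm : Measurable fun y => periodicKernel Γ k (s q) y :=
      hk.measurable_periodicKernel.comp measurable_prodMk_left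
    calc ∫ q', periodicKernel Γ k (s q) (s q') * v q' ∂(quotientMeasure Γ μ)
        = ∫ q', periodicKernel Γ k (s q) (s q') * ∑' γ : Γ, f (γ • s q')
            ∂(quotientMeasure Γ μ) := by
          refine integral_congr_ae ?_
          filter_upwards [hv] with q' hq'
          rw [hq', periodize_apply_section f hs]
      _ = ∫ y in F, periodicKernel Γ k (s q) y * ∑' γ : Γ, f (γ • y) ∂μ := by
          refine integral_orbitSpace_section hF
            (φ := fun y => periodicKernel Γ k (s q) y * ∑' γ : Γ, f (γ • y)) ?_ ?_ hs
          · exact hPm.mul (Measurable.tsum fun γ : Γ =>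
              hf.measurable.comp (measurable_const_smul γ))
          · intro γ y
            simp only [periodicKernel_smul_right]
            congr 1
            change periodize Γ f (Quotient.mk _ (γ • y)) = periodize Γ f (Quotient.mk _ y)
            congr 1
            exact Quotient.sound ⟨γ, rfl⟩
      _ = ∫ y in F, ∑' γ : Γ, periodicKernel Γ k (s q) (γ • y) * f (γ • y) ∂μ := by
          simp_rw [periodicKernel_smul_right, tsum_mul_left]
      _ = ∫ y, periodicKernel Γ k (s q) y * f y ∂μ := by
          refine (integral_eq_setIntegral_tsum hF
            (f := fun y => periodicKernel Γ k (s q) y * f y) (hPm.mul hf.measurable) ?_).symm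
          simp_rw [← hsum]
          exact integrable_tsum_of_finite (hΓ.finite_setOf_dist_le _ _ _) (hint _) (h0 _)
  have hright : ∀ᵐ q ∂(quotientMeasure Γ μ), periodize Γ (A u) q =
      periodize Γ (fun x => ∫ y, k x y * f y ∂μ) q := by
    have hm1 : Measurable fun x => A u x := (Lp.stronglyMeasurable (A u)).measurable
    have hm2 : Measurable fun x => ∫ y, k x y * f y ∂μ :=
      (continuous_integral_kernel_mul hk.continuous hf hfc).measurable
    refine ae_quotientMeasure_of_ae hF
      (measurableSet_eq_fun (measurable_periodize hm1) (measurable_periodize hm2)) ?_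
    have hall : ∀ᵐ x ∂μ, ∀ γ : Γ, A u (γ • x) = ∫ y, k (γ • x) y * f y ∂μ := by
      rw [ae_all_iff]
      intro γ
      exact (hμ.measurePreserving (γ : X ≃ᵢ X)).quasiMeasurePreserving.ae (hA.2 f hf hfc u hu)
    filter_upwards [hall] with x hx
    rw [periodize_mk, periodize_mk]
    exact tsum_congr hx
  filter_upwards [hT v, hright] with q h1 h2
  rw [h1, h2, hleft, periodize_apply_section _ hs]
  simp_rw [hk.apply_smul_left, ← hsum]
  rw [← tsum_integral_of_finite (hΓ.finite_setOf_dist_le _ _ _) (hint _) (h0 _)]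
  exact ((Equiv.inv Γ).tsum_eq fun γ : Γ => ∫ y, k (s q) (γ • y) * f y ∂μ).symm

end PeriodicKernel

/-! ### Uniqueness of induced operators -/

section Uniqueness

variable {X : Type*} [MetricSpace X] [ProperSpace X] [MeasurableSpace X] [BorelSpace X]
  {μ : Measure X} {Γ : Subgroup (X ≃ᵢ X)} {F : Set X}

/-- A locally integrable function which is orthogonal to all test functions vanishes almost
everywhere. -/
theorem ae_eq_zero_of_integral_mul_eq_zero {w : X → ℂ} (hw : LocallyIntegrable w μ)
    (h : ∀ f : X → ℂ, Continuous f → HasCompactSupport f → ∫ x, f x * w x ∂μ = 0) :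
    w =ᵐ[μ] 0 := by
  refine ae_eq_zero_of_forall_setIntegral_isCompact_eq_zero' hw fun s hs => ?_
  rcases s.eq_empty_or_nonempty with rfl | hne
  · simp
  -- approximate the indicator function of `s` by tent functions on shrinking neighbourhoods
  let χ : ℕ → X → ℝ := fun n x => max 0 (1 - (n + 1) * Metric.infDist x s)
  have hχc : ∀ n, Continuous (χ n) := fun n =>
    continuous_const.max (continuous_const.sub (continuous_const.mul (Metric.continuous_infDist_pt s)))
  have hχ0 : ∀ n x, 0 ≤ χ n x := fun n x => le_max_left _ _
  have hχ1 : ∀ n x, χ n x ≤ 1 := fun n x => by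
    refine max_le zero_le_one ?_
    have : 0 ≤ ((n : ℝ) + 1) * Metric.infDist x s := mul_nonneg (by positivity) Metric.infDist_nonneg
    linarith
  have hK : IsCompact (Metric.cthickening 1 s) := hs.cthickening
  have hχK : ∀ n, ∀ x ∉ Metric.cthickening 1 s, χ n x = 0 := by
    intro n x hx
    rw [Metric.cthickening_eq_preimage_infEDist, Set.mem_preimage, Set.mem_Iic, not_le] at hx
    have h1 : 1 < Metric.infDist x s := by
      have := (ENNReal.toReal_lt_toReal ENNReal.ofReal_ne_top (Metric.infEDist_ne_top hne)).2 hx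
      simpa [Metric.infDist] using this
    refine max_eq_left ?_
    have : (0 : ℝ) ≤ n := n.cast_nonneg
    nlinarith
  have hz : ∀ n, ∫ x, (χ n x : ℂ) * w x ∂μ = 0 := fun n =>
    h _ (Complex.continuous_ofReal.comp (hχc n))
      (HasCompactSupport.intro hK fun x hx => by simp [hχK n x hx])
  have hlim : Tendsto (fun n => ∫ x, (χ n x : ℂ) * w x ∂μ) atTop (𝓝 (∫ x in s, w x ∂μ)) := by
    rw [← integral_indicator hs.measurableSet]
    refine tendsto_integral_of_dominated_convergence
      ((Metric.cthickening 1 s).indicator fun x => ‖w x‖)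
      (fun n => (Complex.continuous_ofReal.comp (hχc n)).aestronglyMeasurable.mul
        hw.aestronglyMeasurable) ?_ (fun n => ae_of_all _ fun x => ?_) (ae_of_all _ fun x => ?_)
    · rw [integrable_indicator_iff hK.measurableSet]
      exact (hw.integrableOn_isCompact hK).norm
    · by_cases hx : x ∈ Metric.cthickening 1 s
      · rw [Set.indicator_of_mem hx, norm_mul, Complex.norm_real, Real.norm_of_nonneg (hχ0 n x)]
        exact mul_le_of_le_one_left (norm_nonneg _) (hχ1 n x)
      · simp [hχK n x hx, Set.indicator_of_notMem hx]
    · by_cases hx : x ∈ s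
      · have : ∀ n, χ n x = 1 := fun n => by
          simp [χ, Metric.infDist_zero_of_mem hx]
        simp [this, hx]
      · rw [Set.indicator_of_notMem hx]
        have hpos : 0 < Metric.infDist x s := (hs.isClosed.notMem_iff_infDist_pos hne).1 hx
        refine tendsto_const_nhds.congr' ?_
        obtain ⟨m, hm⟩ := exists_nat_gt (1 / Metric.infDist x s)
        filter_upwards [eventually_ge_atTop m] with n hn
        have h1 : 1 < (n : ℝ) * Metric.infDist x s := by
          rw [div_lt_iff₀ hpos] at hm
          exact hm.trans_le (by gcongr)
        have : χ n x = 0 := max_eq_left (by nlinarith)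
        simp [this]
  simp_rw [hz] at hlim
  exact (tendsto_nhds_unique tendsto_const_nhds hlim).symm

/-- Periodised test functions are bounded. -/
theorem exists_bound_periodize (hΓ : IsLattice Γ) {f : X → ℂ} (hf : Continuous f)
    (hfc : HasCompactSupport f) : ∃ M : ℝ, ∀ q, ‖periodize Γ f q‖ ≤ M := by
  rcases isEmpty_or_nonempty X with hX | ⟨⟨y₀⟩⟩
  · exact ⟨0, fun q => (hX.false q.out).elim⟩
  obtain ⟨ρ, hρ⟩ := hfc.isBounded.subset_closedBall y₀
  obtain ⟨M, hM⟩ := hf.bounded_above_of_compact_support hfc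
  obtain ⟨N, hN⟩ := hΓ.exists_card_le ρ
  refine ⟨N * max M 0, fun q => ?_⟩
  induction q using Quotient.inductionOn with
  | h x =>
  refine norm_tsum_le_of_ncard_le (a := fun γ : Γ => f (γ • x)) (hN y₀ x).1 (hN y₀ x).2
    (le_max_right _ _) (fun γ => (hM _).trans (le_max_left _ _)) fun γ hγ => ?_
  refine image_eq_zero_of_notMem_tsupport fun hx => hγ ?_
  have := hρ hx
  rw [Metric.mem_closedBall, dist_comm] at this
  exact this

/-- A bounded function on the finite measure space `Γ \ X` is square integrable. -/
theorem memLp_periodize (hΓ : IsLattice Γ) (hμ : IsInvariantMeasure μ) {f : X → ℂ}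
    (hf : Continuous f) (hfc : HasCompactSupport f) :
    MemLp (periodize Γ f) 2 (quotientMeasure Γ μ) := by
  have := hμ.nonempty
  have := hΓ.countable
  have := hΓ.isFiniteMeasure_quotientMeasure hμ
  obtain ⟨M, hM⟩ := exists_bound_periodize hΓ hf hfc
  exact MemLp.of_bound (measurable_periodize hf.measurable).aestronglyMeasurable M
    (ae_of_all _ hM)

/-- The lift to `X` of an integrable function on `Γ \ X` is locally integrable. -/
theorem locallyIntegrable_comp_mk (hΓ : IsLattice Γ) (hμ : IsInvariantMeasure μ)
    {w : OrbitSpace Γ X → ℂ} (hwm : Measurable w) (hw : Integrable w (quotientMeasure Γ μ)) :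
    LocallyIntegrable (fun x => w (Quotient.mk _ x)) μ := by
  have := hμ.smulInvariantMeasure Γ
  obtain ⟨y₀⟩ := hμ.nonempty
  have : Nonempty X := ⟨y₀⟩
  have := hΓ.countable
  obtain ⟨F, hF⟩ := hΓ.exists_isFundamentalDomain μ
  have hwm' : Measurable fun x : X => w (Quotient.mk _ x) := hwm.comp measurable_orbitMk
  have hfin : ∫⁻ x in F, ‖w (Quotient.mk _ x)‖ₑ ∂μ < ∞ := by
    have := hw.2
    rwa [HasFiniteIntegral, quotientMeasure_eq_map hF,
      lintegral_map hwm.enorm measurable_orbitMk] at this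
  rw [locallyIntegrable_iff]
  intro K hK
  refine ⟨hwm'.aestronglyMeasurable, ?_⟩
  obtain ⟨ρ, hρ⟩ := hK.isBounded.subset_closedBall y₀
  obtain ⟨N, hN⟩ := hΓ.exists_card_le ρ
  rw [HasFiniteIntegral, ← lintegral_indicator hK.measurableSet,
    lintegral_eq_setLIntegral_tsum hF (hwm'.enorm.indicator hK.measurableSet)]
  refine lt_of_le_of_lt ?_ (ENNReal.mul_lt_top (ENNReal.natCast_lt_top N) hfin)
  rw [← lintegral_const_mul _ hwm'.enorm]
  refine lintegral_mono fun x => ?_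
  have hterm : ∀ γ : Γ, K.indicator (fun x => ‖w (Quotient.mk _ x)‖ₑ) (γ • x) ≤
      ‖w (Quotient.mk _ x)‖ₑ := by
    intro γ
    refine Set.indicator_le_self' (fun _ _ => zero_le) _ |>.trans (le_of_eq ?_)
    congr 2
    exact Quotient.sound ⟨γ, rfl⟩
  have hsupp : ∀ γ ∉ (hN y₀ x).1.toFinset,
      K.indicator (fun x => ‖w (Quotient.mk _ x)‖ₑ) (γ • x) = 0 := by
    intro γ hγ
    refine Set.indicator_of_notMem (fun hx => hγ ?_) _
    have := hρ hx
    rw [Metric.mem_closedBall, dist_comm] at this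
    simpa using this
  simp only
  rw [tsum_eq_sum hsupp]
  refine (Finset.sum_le_sum fun γ _ => hterm γ).trans ?_
  rw [Finset.sum_const, nsmul_eq_mul, ← Set.ncard_eq_toFinset_card _ (hN y₀ x).1]
  gcongr
  exact (hN y₀ x).2

/-- The periodisations of test functions are dense in `L²(Γ \ X)`, so there is at most one induced
operator. -/
theorem IsInducedOperator.unique (hΓ : IsLattice Γ) (hμ : IsInvariantMeasure μ)
    {A : Lp ℂ 2 μ →L[ℂ] Lp ℂ 2 μ}
    {S T : Lp ℂ 2 (quotientMeasure Γ μ) →L[ℂ] Lp ℂ 2 (quotientMeasure Γ μ)}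
    (hS : IsInducedOperator μ A Γ S) (hT : IsInducedOperator μ A Γ T) : S = T := by
  have := hμ.finite_on_compacts
  have := hμ.smulInvariantMeasure Γ
  have := hμ.nonempty
  have := hΓ.countable
  have := hΓ.isFiniteMeasure_quotientMeasure hμ
  obtain ⟨F, hF⟩ := hΓ.exists_isFundamentalDomain μ
  obtain ⟨s, -, hs⟩ := hΓ.exists_measurable_section
  -- the subspace where `S` and `T` agree contains the periodised test functions
  let V : Submodule ℂ (Lp ℂ 2 (quotientMeasure Γ μ)) := (S - T).ker
  have hV : ∀ (f : X → ℂ) (hf : Continuous f) (hfc : HasCompactSupport f),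
      (memLp_periodize hΓ hμ hf hfc).toLp _ ∈ V := by
    intro f hf hfc
    have hm := memLp_of_hasCompactSupport (μ := μ) hf hfc
    have hv := (memLp_periodize hΓ hμ hf hfc).coeFn_toLp
    have h1 := hS f hf hfc _ hm.coeFn_toLp _ hv
    have h2 := hT f hf hfc _ hm.coeFn_toLp _ hv
    change (S - T) _ = 0
    rw [sub_apply, sub_eq_zero]
    exact Lp.ext (h1.trans h2.symm)
  have hclosed : IsClosed (V : Set (Lp ℂ 2 (quotientMeasure Γ μ))) := (S - T).isClosed_ker
  have hperp : Vᗮ = ⊥ := by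
    rw [Submodule.eq_bot_iff]
    intro w hw
    rw [Submodule.mem_orthogonal] at hw
    have hwm : Measurable fun q => w q := (Lp.stronglyMeasurable w).measurable
    have hwi : Integrable (fun q => w q) (quotientMeasure Γ μ) :=
      (Lp.memLp w).integrable one_le_two
    have hloc := locallyIntegrable_comp_mk hΓ hμ hwm hwi
    have hzero := ae_eq_zero_of_integral_mul_eq_zero hloc (fun f hf hfc => by
      have hcf : Continuous fun x => (starRingEnd ℂ) (f x) := Complex.continuous_conj.comp hf
      have hcfc : HasCompactSupport fun x => (starRingEnd ℂ) (f x) :=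
        hfc.comp_left (g := starRingEnd ℂ) (map_zero _)
      have h1 := hw _ (hV _ hcf hcfc)
      rw [L2.inner_def] at h1
      have hint : Integrable (fun x => f x * w (Quotient.mk _ x)) μ := by
        have := hloc.integrable_smul_left_of_hasCompactSupport hf hfc
        simpa only [smul_eq_mul] using this
      rw [integral_eq_setIntegral_tsum hF (f := fun x => f x * w (Quotient.mk _ x))
        (hf.measurable.mul (hwm.comp measurable_orbitMk)) hint]
      have hinv : ∀ (γ : Γ) (x : X), (Quotient.mk (MulAction.orbitRel Γ X) (γ • x)) =
          Quotient.mk _ x := fun γ x => Quotient.sound ⟨γ, rfl⟩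
      have h2 := integral_orbitSpace_section hF
        (φ := fun x => (∑' γ : Γ, f (γ • x)) * w (Quotient.mk _ x))
        ((Measurable.tsum fun γ : Γ => hf.measurable.comp (measurable_const_smul γ)).mul
          (hwm.comp measurable_orbitMk)) (by
            intro γ x
            simp only [hinv]
            congr 1
            change periodize Γ f (Quotient.mk _ (γ • x)) = periodize Γ f (Quotient.mk _ x)
            rw [hinv]) hs
      simp_rw [hinv, tsum_mul_right]
      rw [← h2, ← h1]
      refine integral_congr_ae ?_
      filter_upwards [(memLp_periodize hΓ hμ hcf hcfc).coeFn_toLp] with q hq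
      rw [RCLike.inner_apply, hq, hs, periodize_apply_section _ hs, Complex.conj_tsum, mul_comm]
      simp only [Complex.conj_conj])
    apply Lp.ext
    refine EventuallyEq.trans ?_ (Lp.coeFn_zero ℂ 2 _).symm
    exact ae_quotientMeasure_of_ae hF (measurableSet_eq_fun hwm measurable_const) hzero
  have htop : V = ⊤ := by
    have hcomplete : IsComplete (V : Set (Lp ℂ 2 (quotientMeasure Γ μ))) := hclosed.isComplete
    have : CompleteSpace V := completeSpace_coe_iff_isComplete.2 hcomplete
    rwa [Submodule.orthogonal_eq_bot_iff] at hperp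
  ext1 v
  have : v ∈ V := htop ▸ Submodule.mem_top
  rw [← sub_eq_zero, ← sub_apply]
  exact this

end Uniqueness

/-! ### The trace formula -/

section Trace

theorem HasTrace.add {H : Type*} [NormedAddCommGroup H] [InnerProductSpace ℂ H] {S T : H →L[ℂ] H}
    {s t : ℂ} (hS : HasTrace S s) (hT : HasTrace T t) : HasTrace (S + T) (s + t) := fun ι b => by
  simpa only [add_apply, inner_add_right] using (hS ι b).add (hT ι b)

theorem HasTrace.smul {H : Type*} [NormedAddCommGroup H] [InnerProductSpace ℂ H] {T : H →L[ℂ] H}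
    {t : ℂ} (hT : HasTrace T t) (c : ℂ) : HasTrace (c • T) (c * t) := fun ι b => by
  simpa only [smul_apply, inner_smul_right] using (hT ι b).mul_left c

theorem hasTrace_zero {H : Type*} [NormedAddCommGroup H] [InnerProductSpace ℂ H] :
    HasTrace (0 : H →L[ℂ] H) 0 := fun ι b => by
  simpa only [zero_apply, inner_zero_right] using hasSum_zero

/-- There is at most one trace, because an orthonormal basis exists. -/
theorem HasTrace.unique {H : Type*} [NormedAddCommGroup H] [InnerProductSpace ℂ H]
    [CompleteSpace H] {T : H →L[ℂ] H} {s t : ℂ} (hs : HasTrace T s) (ht : HasTrace T t) :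
    s = t := by
  obtain ⟨w, b, -⟩ := exists_hilbertBasis ℂ H
  exact (hs w b).unique (ht w b)

variable {X : Type*} [MetricSpace X] [ProperSpace X] [MeasurableSpace X] [BorelSpace X]
  {μ : Measure X} {Γ : Subgroup (X ≃ᵢ X)} {F : Set X}

theorem IsInvariantKernel.exists_isKernelOperator (hΓ : IsLattice Γ) (hμ : IsInvariantMeasure μ)
    {k : X → X → ℂ} (hk : IsInvariantKernel k) {s : OrbitSpace Γ X → X} (hsm : Measurable s) :
    ∃ T, IsKernelOperator (quotientMeasure Γ μ)
      (fun q q' => periodicKernel Γ k (s q) (s q')) T := by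
  have := hμ.nonempty
  have := hΓ.countable
  have := hΓ.isFiniteMeasure_quotientMeasure hμ
  obtain ⟨M, hM⟩ := hk.exists_bound_periodicKernel hΓ
  exact exists_isKernelOperator_of_bounded
    (hk.measurable_periodicKernel.comp ((hsm.comp measurable_fst).prodMk (hsm.comp measurable_snd)))
    (fun _ _ => hM _ _)

/-- The trace formula for `A ∈ 𝒜²`: every integral operator on `L²(Γ \ X)` given by the periodised
kernel of `A` has as trace the integral of that kernel over the diagonal. -/
theorem exists_kernel_hasTrace [μ.IsOpenPosMeasure] (hμ : IsInvariantMeasure μ)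
    {A : Lp ℂ 2 μ →L[ℂ] Lp ℂ 2 μ} (hA : A ∈ kernelAlgebraSq μ) :
    ∃ k, IsContinuousKernel μ A k ∧ IsInvariantKernel k ∧
      ∀ Γ : Subgroup (X ≃ᵢ X), IsLattice Γ → ∀ s : OrbitSpace Γ X → X, Measurable s →
        (∀ q, Quotient.mk (MulAction.orbitRel Γ X) (s q) = q) →
        ∀ T, IsKernelOperator (quotientMeasure Γ μ)
          (fun q q' => periodicKernel Γ k (s q) (s q')) T →
        HasTrace T (∫ q, periodicKernel Γ k (s q) (s q) ∂(quotientMeasure Γ μ)) := by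
  have := hμ.finite_on_compacts
  have := hμ.nonempty
  induction hA using Submodule.span_induction with
  | mem A hA =>
    obtain ⟨B, hB, C, hC, rfl⟩ := hA
    obtain ⟨k₁, hk₁, h₁⟩ := exists_isInvariantKernel_of_mem_kernelAlgebra hμ hB
    obtain ⟨k₂, hk₂, h₂⟩ := exists_isInvariantKernel_of_mem_kernelAlgebra hμ hC
    refine ⟨compKernel μ k₁ k₂, hk₁.comp hμ hk₂ h₁ h₂, h₁.comp hμ h₂, fun Γ hΓ s hsm hs T hT => ?_⟩
    have := hμ.smulInvariantMeasure Γ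
    have := hΓ.countable
    have := hΓ.isFiniteMeasure_quotientMeasure hμ
    have := hΓ.secondCountable_Lp hμ
    obtain ⟨F, hF⟩ := hΓ.exists_isFundamentalDomain μ
    obtain ⟨M₁, hM₁⟩ := h₁.exists_bound_periodicKernel hΓ
    obtain ⟨M₂, hM₂⟩ := h₂.exists_bound_periodicKernel hΓ
    have hss : Measurable fun p : OrbitSpace Γ X × OrbitSpace Γ X => (s p.1, s p.2) :=
      (hsm.comp measurable_fst).prodMk (hsm.comp measurable_snd)
    refine hasTrace_of_isKernelOperator (M := max M₁ M₂)
      (K₁ := fun q q' => periodicKernel Γ k₁ (s q) (s q'))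
      (K₂ := fun q q' => periodicKernel Γ k₂ (s q) (s q'))
      (h₁.measurable_periodicKernel.comp hss) (h₂.measurable_periodicKernel.comp hss)
      (fun _ _ => (hM₁ _ _).trans (le_max_left _ _))
      (fun _ _ => (hM₂ _ _).trans (le_max_right _ _)) (fun q q' => ?_) hT
    rw [periodicKernel_compKernel hΓ hμ hF h₁ h₂]
    refine (integral_orbitSpace_section hF
      (φ := fun z => periodicKernel Γ k₁ (s q) z * periodicKernel Γ k₂ z (s q')) ?_ ?_ hs).symm
    · exact (h₁.measurable_periodicKernel.comp measurable_prodMk_left).mul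
        (h₂.measurable_periodicKernel.comp measurable_prodMk_right)
    · intro γ z
      rw [periodicKernel_smul_right, h₂.periodicKernel_smul_left]
  | zero =>
    refine ⟨0, isContinuousKernel_zero, isInvariantKernel_zero, fun Γ hΓ s hsm hs T hT => ?_⟩
    have hT0 : T = 0 := hT.unique fun f => by
      filter_upwards [Lp.coeFn_zero ℂ 2 (quotientMeasure Γ μ)] with q hq
      rw [zero_apply, hq]
      simp [periodicKernel_zero]
    simpa only [hT0, periodicKernel_zero, integral_zero] using hasTrace_zero
  | add A B _ _ hA hB =>
    obtain ⟨k₁, hk₁, h₁, ht₁⟩ := hA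
    obtain ⟨k₂, hk₂, h₂, ht₂⟩ := hB
    refine ⟨k₁ + k₂, hk₁.add hk₂, h₁.add h₂, fun Γ hΓ s hsm hs T hT => ?_⟩
    have := hΓ.countable
    have := hΓ.isFiniteMeasure_quotientMeasure hμ
    obtain ⟨T₁, hT₁⟩ := h₁.exists_isKernelOperator hΓ hμ hsm
    obtain ⟨T₂, hT₂⟩ := h₂.exists_isKernelOperator hΓ hμ hsm
    have hint : ∀ {k : X → X → ℂ}, IsInvariantKernel k → ∀ (t : OrbitSpace Γ X → X), Measurable t →
        ∀ f : OrbitSpace Γ X → ℂ, Integrable f (quotientMeasure Γ μ) →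
        Integrable (fun q => periodicKernel Γ k (t q) (s q) * f q) (quotientMeasure Γ μ) := by
      intro k hk t ht f hf
      obtain ⟨M, hM⟩ := hk.exists_bound_periodicKernel hΓ
      exact hf.bdd_mul
        (hk.measurable_periodicKernel.comp (ht.prodMk hsm)).aestronglyMeasurable
        (ae_of_all _ fun q => hM _ _)
    have hTe : T = T₁ + T₂ := hT.unique fun f => by
      have hf := (Lp.memLp f).integrable one_le_two
      filter_upwards [hT₁ f, hT₂ f, Lp.coeFn_add (T₁ f) (T₂ f)] with q e1 e2 e3
      rw [add_apply, e3, Pi.add_apply, e1, e2,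
        ← integral_add (hint h₁ (fun _ => s q) measurable_const _ hf)
          (hint h₂ (fun _ => s q) measurable_const _ hf)]
      simp_rw [periodicKernel_add hΓ h₁ h₂, add_mul]
    rw [hTe]
    simp_rw [periodicKernel_add hΓ h₁ h₂]
    rw [integral_add (by simpa using hint h₁ s hsm (fun _ => 1) (integrable_const 1))
      (by simpa using hint h₂ s hsm (fun _ => 1) (integrable_const 1))]
    exact (ht₁ Γ hΓ s hsm hs T₁ hT₁).add (ht₂ Γ hΓ s hsm hs T₂ hT₂)
  | smul c A _ hA =>
    obtain ⟨k, hk, h, ht⟩ := hA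
    refine ⟨c • k, hk.smul c, h.smul c, fun Γ hΓ s hsm hs T hT => ?_⟩
    obtain ⟨T₁, hT₁⟩ := h.exists_isKernelOperator hΓ hμ hsm
    have hTe : T = c • T₁ := hT.unique fun f => by
      filter_upwards [hT₁ f, Lp.coeFn_smul c (T₁ f)] with q e1 e2
      rw [smul_apply, e2, Pi.smul_apply, e1, smul_eq_mul, ← integral_const_mul]
      simp_rw [periodicKernel_smul, mul_assoc]
    rw [hTe]
    simp_rw [periodicKernel_smul]
    rw [integral_const_mul]
    exact (ht Γ hΓ s hsm hs T₁ hT₁).smul c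

/-- For `A ∈ 𝒜²` with kernel `k` and a lattice `Γ`, the induced operator exists, it is of trace
class, and its trace is the integral of `∑ γ, k(x, γ x)` over a fundamental domain. -/
theorem exists_inducedOperator_hasTrace [μ.IsOpenPosMeasure] (hμ : IsInvariantMeasure μ)
    {A : Lp ℂ 2 μ →L[ℂ] Lp ℂ 2 μ} (hA : A ∈ kernelAlgebraSq μ) :
    ∃ k, IsContinuousKernel μ A k ∧ IsInvariantKernel k ∧
      ∀ Γ : Subgroup (X ≃ᵢ X), IsLattice Γ → ∀ F : Set X, IsFundamentalDomain Γ F μ →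
        ∃ T, IsInducedOperator μ A Γ T ∧ HasTrace T (∫ x in F, periodicKernel Γ k x x ∂μ) := by
  obtain ⟨k, hk, h, ht⟩ := exists_kernel_hasTrace hμ hA
  refine ⟨k, hk, h, fun Γ hΓ F hF => ?_⟩
  have := hμ.nonempty
  have := hμ.smulInvariantMeasure Γ
  have := hΓ.countable
  obtain ⟨s, hsm, hs⟩ := hΓ.exists_measurable_section
  obtain ⟨T, hT⟩ := h.exists_isKernelOperator hΓ hμ hsm
  refine ⟨T, isInducedOperator_of_isKernelOperator hΓ hμ hk h hs hT, ?_⟩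
  rw [← integral_orbitSpace_section hF (φ := fun x => periodicKernel Γ k x x)
    (h.measurable_periodicKernel.comp (measurable_id.prodMk measurable_id))
    (fun γ x => by rw [periodicKernel_smul_right, h.periodicKernel_smul_left]) hs]
  exact ht Γ hΓ s hsm hs T hT

end Trace

/-! ### Traces and short displacements -/

section Convergence

variable {X : Type*} [MetricSpace X] [ProperSpace X] [MeasurableSpace X] [BorelSpace X]
  {μ : Measure X} {Γ : Subgroup (X ≃ᵢ X)} {F : Set X}

theorem IsLattice.covolume_eq (hΓ : IsLattice Γ) (hμ : IsInvariantMeasure μ)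
    (hF : IsFundamentalDomain Γ F μ) : covolume μ Γ = μ.real F := by
  have := hμ.smulInvariantMeasure Γ
  have := hμ.nonempty
  have := hΓ.countable
  rw [covolume, measureReal_def, quotientMeasure_univ hF, measureReal_def]

/-- The probability that the radius is less than `R`, as a quotient of volumes. -/
theorem IsLattice.toReal_quotientProb (hΓ : IsLattice Γ) (hμ : IsInvariantMeasure μ)
    (hF : IsFundamentalDomain Γ F μ) (R : ℝ) :
    (quotientProb Γ μ {x : X | radiusAt Γ x < ENNReal.ofReal R}).toReal =
      μ.real ({x : X | radiusAt Γ x < ENNReal.ofReal R} ∩ F) / μ.real F := by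
  have := hμ.smulInvariantMeasure Γ
  have := hμ.nonempty
  have := hΓ.countable
  rw [quotientProb_eq hF (measurableSet_radiusAt_lt Γ R) (radiusAt_smul_lt Γ R),
    ENNReal.toReal_div, measureReal_def, measureReal_def]

theorem IsLattice.quotientProb_ne_top (hΓ : IsLattice Γ) (hμ : IsInvariantMeasure μ) (R : ℝ) :
    quotientProb Γ μ {x : X | radiusAt Γ x < ENNReal.ofReal R} ≠ ∞ := by
  have := hμ.smulInvariantMeasure Γ
  have := hμ.nonempty
  have := hΓ.countable
  obtain ⟨F, hF⟩ := hΓ.exists_isFundamentalDomain μ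
  rw [quotientProb_eq hF (measurableSet_radiusAt_lt Γ R) (radiusAt_smul_lt Γ R)]
  exact ENNReal.div_ne_top ((measure_mono Set.inter_subset_right).trans_lt
    (hΓ.measure_lt_top hμ hF)).ne (hμ.measure_ne_zero hF)

/-- The normalised trace minus the mean of the kernel on the diagonal is the normalised integral of
the contribution of the nontrivial elements of `Γ`. -/
theorem IsInvariantKernel.trace_sub_mean_eq (hΓ : IsLattice Γ) (hμ : IsInvariantMeasure μ)
    (hF : IsFundamentalDomain Γ F μ) {k : X → X → ℂ} (hk : IsInvariantKernel k) :
    (∫ x in F, periodicKernel Γ k x x ∂μ) / (covolume μ Γ : ℂ) - kernelMean μ Γ k =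
      (∫ x in F, (periodicKernel Γ k x x - k x x) ∂μ) / ((μ.real F : ℝ) : ℂ) := by
  have := hμ.smulInvariantMeasure Γ
  have := hμ.nonempty
  have := hΓ.countable
  have : IsFiniteMeasure (μ.restrict F) := ⟨by simpa using hΓ.measure_lt_top hμ hF⟩
  obtain ⟨M, hM⟩ := hk.exists_bound_of_isLattice hΓ
  obtain ⟨M', hM'⟩ := hk.exists_bound_periodicKernel hΓ
  have hm : Measurable fun x => k x x :=
    (hk.continuous.comp (continuous_id.prodMk continuous_id)).measurable
  have hm' : Measurable fun x => periodicKernel Γ k x x :=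
    hk.measurable_periodicKernel.comp (measurable_id.prodMk measurable_id)
  rw [integral_sub (Integrable.of_bound hm'.aestronglyMeasurable M' (ae_of_all _ fun x => hM' x x))
    (Integrable.of_bound hm.aestronglyMeasurable M (ae_of_all _ fun x => hM x x)),
    hΓ.covolume_eq hμ hF, kernelMean_eq_setIntegral hF hk.continuous hk.invariant, sub_div]

/-- If the kernel vanishes at distances beyond `r < R`, then only the points where some nontrivial
element of `Γ` has displacement less than `R` contribute to the trace. -/
theorem IsInvariantKernel.norm_trace_sub_mean_le (hΓ : IsLattice Γ) (hμ : IsInvariantMeasure μ)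
    (hF : IsFundamentalDomain Γ F μ) {k : X → X → ℂ} (hk : IsInvariantKernel k) {r R M : ℝ}
    (hM : ∀ x y, ‖k x y‖ ≤ M) (hr : ∀ x y, r < dist x y → k x y = 0) (hrR : r < R) {N : ℕ}
    (hN : ∀ x y : X, {γ : Γ | dist x (γ • y) ≤ r}.Finite ∧
      {γ : Γ | dist x (γ • y) ≤ r}.ncard ≤ N) :
    ‖(∫ x in F, periodicKernel Γ k x x ∂μ) / (covolume μ Γ : ℂ) - kernelMean μ Γ k‖ ≤
      (N * M + M) * (quotientProb Γ μ {x : X | radiusAt Γ x < ENNReal.ofReal R}).toReal := by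
  obtain ⟨x₀⟩ := hμ.nonempty
  have : Nonempty X := ⟨x₀⟩
  have := hΓ.countable
  have hM0 : 0 ≤ M := (norm_nonneg _).trans (hM x₀ x₀)
  have : IsFiniteMeasure (μ.restrict F) := ⟨by simpa using hΓ.measure_lt_top hμ hF⟩
  have hB := measurableSet_radiusAt_lt Γ R
  have key : ‖∫ x in F, (periodicKernel Γ k x x - k x x) ∂μ‖ ≤
      (N * M + M) * μ.real ({x : X | radiusAt Γ x < ENNReal.ofReal R} ∩ F) := by
    have hI : ∫ x in F, {x : X | radiusAt Γ x < ENNReal.ofReal R}.indicator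
        (fun _ => N * M + M) x ∂μ =
        (N * M + M) * μ.real ({x : X | radiusAt Γ x < ENNReal.ofReal R} ∩ F) := by
      rw [integral_indicator_const _ hB, measureReal_restrict_apply hB, smul_eq_mul, mul_comm]
    rw [← hI]
    refine norm_integral_le_of_norm_le ((integrable_const _).indicator hB)
      (ae_of_all _ fun x => ?_)
    by_cases hx : x ∈ {x : X | radiusAt Γ x < ENNReal.ofReal R}
    · rw [Set.indicator_of_mem hx]
      refine (norm_sub_le _ _).trans (add_le_add ?_ (hM x x))
      exact norm_tsum_le_of_ncard_le (hN x x).1 (hN x x).2 hM0 (fun γ => hM _ _)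
        fun γ hγ => hr _ _ (not_le.1 hγ)
    · rw [Set.indicator_of_notMem hx]
      have h1 : periodicKernel Γ k x x = k x ((1 : Γ) • x) := by
        refine tsum_eq_single 1 fun γ hγ => hr _ _ (hrR.trans_le (not_lt.1 fun h => hx ?_))
        exact (radiusAt_lt_iff Γ x R).2 ⟨γ, γ.2, fun h => hγ (Subtype.ext h), h⟩
      rw [h1, one_smul, sub_self, norm_zero]
  rw [hk.trace_sub_mean_eq hΓ hμ hF, norm_div, Complex.norm_real,
    Real.norm_of_nonneg measureReal_nonneg, hΓ.toReal_quotientProb hμ hF, ← mul_div_assoc]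
  exact div_le_div_of_nonneg_right key measureReal_nonneg

/-- For a uniformly discrete sequence, Benjamini-Schramm convergence implies spectral
convergence: the number of elements of `Γ n` which contribute to the trace at a point is bounded
independently of `n`. -/
theorem spectrallyConvergesToOne_of_bsConvergesToSpace [μ.IsOpenPosMeasure]
    (hμ : IsInvariantMeasure μ) (η : Measure (X ≃ᵢ X)) [η.IsHaarMeasure]
    {Γ : ℕ → Subgroup (X ≃ᵢ X)} (hΓ : ∀ n, IsLattice (Γ n)) (hud : UniformlyDiscrete Γ)
    (h : BSConvergesToSpace μ Γ) : SpectrallyConvergesToOne μ Γ := by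
  intro A hA
  obtain ⟨x₀⟩ := hμ.nonempty
  obtain ⟨k, hkA, hk, ht⟩ := exists_inducedOperator_hasTrace hμ hA
  choose F hF using fun n => (hΓ n).exists_isFundamentalDomain μ
  choose T hT using fun n => ht (Γ n) (hΓ n) (F n) (hF n)
  refine ⟨k, hkA, T, fun n => ∫ x in F n, periodicKernel (Γ n) k x x ∂μ, hT, fun Λ hΛ => ?_⟩
  obtain ⟨M, hM⟩ := hk.exists_bound_of_isLattice hΛ
  obtain ⟨r, hr⟩ := hk.finite_range
  obtain ⟨D, hD⟩ := hΛ.exists_dist_le x₀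
  obtain ⟨ε, hε, hεΓ⟩ := hud
  obtain ⟨N, hN⟩ := exists_card_le x₀
    (fun x => let ⟨γ, hγ⟩ := hD x; ⟨(γ : X ≃ᵢ X), hγ⟩) hε r
  have hR : r < max r 0 + 1 := (le_max_left r 0).trans_lt (lt_add_one _)
  have hP := (ENNReal.tendsto_toReal_iff
    (fun n => (hΓ n).quotientProb_ne_top hμ (max r 0 + 1)) ENNReal.zero_ne_top).2
    (h (max r 0 + 1) (by positivity))
  rw [tendsto_iff_norm_sub_tendsto_zero]
  refine squeeze_zero (fun n => norm_nonneg _) (fun n => ?_)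
    (by simpa using hP.const_mul (N * M + M))
  rw [kernelMean_eq_kernelMean hμ η hΛ (hΓ n) hk.continuous hk.invariant]
  exact hk.norm_trace_sub_mean_le (hΓ n) hμ (hF n) hM hr hR (hN (Γ n) (hεΓ n))

/-- A function of the distance, equal to `1` up to `S` and to `0` beyond `S + 1`. -/
noncomputable def distCutoff (S : ℝ) (x y : X) : ℝ := max 0 (min 1 (S + 1 - dist x y))

theorem distCutoff_nonneg (S : ℝ) (x y : X) : 0 ≤ distCutoff S x y := le_max_left _ _

theorem distCutoff_eq_one {S : ℝ} {x y : X} (h : dist x y ≤ S) : distCutoff S x y = 1 := by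
  rw [distCutoff, min_eq_left (by linarith), max_eq_right zero_le_one]

theorem continuous_distCutoff (S : ℝ) :
    Continuous (Function.uncurry (distCutoff S : X → X → ℝ)) :=
  continuous_const.max (continuous_const.min (continuous_const.sub continuous_dist))

theorem distCutoff_eq_zero {S : ℝ} {x y : X} (h : S + 1 < dist x y) : distCutoff S x y = 0 :=
  max_eq_left ((min_le_right _ _).trans (by linarith))

theorem isInvariantKernel_distCutoff (S : ℝ) :
    IsInvariantKernel fun x y : X => (distCutoff S x y : ℂ) :=
  ⟨Complex.continuous_ofReal.comp (continuous_distCutoff S),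
    fun g x y => by simp only [distCutoff, g.dist_eq],
    S + 1, fun x y h => by rw [distCutoff_eq_zero h, Complex.ofReal_zero]⟩

/-- The convolution square of the distance cutoff is bounded below at distances at most `R`. -/
theorem le_integral_distCutoff (hμ : IsInvariantMeasure μ) {x₀ : X} {D : ℝ}
    (hD : ∀ x, ∃ g : X ≃ᵢ X, dist (g x₀) x ≤ D) {R : ℝ} (hR : 0 ≤ R) {x y : X}
    (h : dist x y ≤ R) : μ.real (Metric.ball x₀ 1) ≤
      ∫ z, distCutoff (R + D + 1) x z * distCutoff (R + D + 1) z y ∂μ := by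
  have := hμ.finite_on_compacts
  obtain ⟨g, hg⟩ := hD x
  have hint : Integrable (fun z => distCutoff (R + D + 1) x z * distCutoff (R + D + 1) z y) μ := by
    refine Continuous.integrable_of_hasCompactSupport
      (((continuous_distCutoff _).comp (continuous_const.prodMk continuous_id)).mul
        ((continuous_distCutoff _).comp (continuous_id.prodMk continuous_const)))
      (HasCompactSupport.intro (isCompact_closedBall x (R + D + 1 + 1)) fun z hz => ?_)
    rw [Metric.mem_closedBall, not_le, dist_comm] at hz
    rw [distCutoff_eq_zero hz, zero_mul]
  have hball : μ.real (Metric.ball x₀ 1) = μ.real (Metric.ball (g x₀) 1) := by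
    rw [measureReal_def, measureReal_def, hμ.measure_ball_apply]
  rw [hball, ← setIntegral_one_eq_measureReal]
  refine (setIntegral_mono_on (integrableOn_const measure_ball_lt_top.ne) hint.integrableOn
    Metric.isOpen_ball.measurableSet fun z hz => ?_).trans
    (setIntegral_le_integral hint (ae_of_all _ fun z =>
      mul_nonneg (distCutoff_nonneg _ _ _) (distCutoff_nonneg _ _ _)))
  have hz' : dist z (g x₀) < 1 := hz
  have h1 := dist_triangle z (g x₀) x
  have h2 := dist_triangle z x y
  rw [distCutoff_eq_one (by rw [dist_comm]; linarith), distCutoff_eq_one (by linarith), one_mul]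

/-- A positive kernel which is at least `c` at distances less than `R` detects the points where some
nontrivial element of `Γ` has displacement less than `R`. -/
theorem le_norm_trace_sub_mean (hΓ : IsLattice Γ) (hμ : IsInvariantMeasure μ)
    (hF : IsFundamentalDomain Γ F μ) {κ : X → X → ℝ}
    (hk : IsInvariantKernel fun x y => (κ x y : ℂ)) (h0 : ∀ x y, 0 ≤ κ x y) {c R : ℝ}
    (hc : ∀ x y, dist x y < R → c ≤ κ x y) :
    c * (quotientProb Γ μ {x : X | radiusAt Γ x < ENNReal.ofReal R}).toReal ≤
      ‖(∫ x in F, periodicKernel Γ (fun x y => (κ x y : ℂ)) x x ∂μ) / (covolume μ Γ : ℂ) -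
        kernelMean μ Γ fun x y => (κ x y : ℂ)‖ := by
  classical
  have := hμ.nonempty
  have := hΓ.countable
  have : IsFiniteMeasure (μ.restrict F) := ⟨by simpa using hΓ.measure_lt_top hμ hF⟩
  have hB := measurableSet_radiusAt_lt Γ R
  obtain ⟨r, hr⟩ := hk.finite_range
  have hsum : ∀ x : X, Summable fun γ : Γ => κ x (γ • x) := fun x =>
    summable_of_hasFiniteSupport ((hΓ.finite_setOf_dist_le r x x).subset fun γ hγ => by
      by_contra h
      exact hγ (by exact_mod_cast hr _ _ (not_le.1 h)))
  have hper : ∀ x, periodicKernel Γ (fun x y => (κ x y : ℂ)) x x - κ x x =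
      ((∑' γ : Γ, κ x (γ • x) - κ x x : ℝ) : ℂ) := fun x => by
    rw [periodicKernel, Complex.ofReal_sub, Complex.ofReal_tsum]
  obtain ⟨M, hM⟩ := hk.exists_bound_of_isLattice hΓ
  obtain ⟨M', hM'⟩ := hk.exists_bound_periodicKernel hΓ
  have hint : Integrable (fun x => ∑' γ : Γ, κ x (γ • x) - κ x x) (μ.restrict F) := by
    have hm : Measurable fun x => (κ x x : ℂ) :=
      (hk.continuous.comp (continuous_id.prodMk continuous_id)).measurable
    have hm' : Measurable fun x => periodicKernel Γ (fun x y => (κ x y : ℂ)) x x :=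
      hk.measurable_periodicKernel.comp (measurable_id.prodMk measurable_id)
    have := ((Integrable.of_bound (μ := μ.restrict F) hm'.aestronglyMeasurable M'
      (ae_of_all _ fun x => hM' x x)).sub
      (Integrable.of_bound hm.aestronglyMeasurable M (ae_of_all _ fun x => hM x x))).re
    refine this.congr (ae_of_all _ fun x => ?_)
    have h1 := congrArg Complex.re (hper x)
    rwa [Complex.ofReal_re] at h1
  have key : c * μ.real ({x : X | radiusAt Γ x < ENNReal.ofReal R} ∩ F) ≤
      ∫ x in F, (∑' γ : Γ, κ x (γ • x) - κ x x) ∂μ := by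
    have hI : ∫ x in F, {x : X | radiusAt Γ x < ENNReal.ofReal R}.indicator (fun _ => c) x ∂μ =
        c * μ.real ({x : X | radiusAt Γ x < ENNReal.ofReal R} ∩ F) := by
      rw [integral_indicator_const _ hB, measureReal_restrict_apply hB, smul_eq_mul, mul_comm]
    rw [← hI]
    refine integral_mono ((integrable_const _).indicator hB) hint fun x => ?_
    by_cases hx : x ∈ {x : X | radiusAt Γ x < ENNReal.ofReal R}
    · simp only [Set.indicator_of_mem hx]
      obtain ⟨γ, hγ, h1, h2⟩ := (radiusAt_lt_iff Γ x R).1 hx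
      have hne : (1 : Γ) ≠ ⟨γ, hγ⟩ := fun h => h1 (congrArg Subtype.val h).symm
      have h3 := (hsum x).sum_le_tsum {1, ⟨γ, hγ⟩} fun δ _ => h0 _ _
      rw [Finset.sum_pair hne, one_smul] at h3
      have h4 : c ≤ κ x ((⟨γ, hγ⟩ : Γ) • x) := hc _ _ h2
      linarith
    · simp only [Set.indicator_of_notMem hx]
      have h3 := (hsum x).sum_le_tsum {1} fun δ _ => h0 _ _
      rw [Finset.sum_singleton, one_smul] at h3
      linarith
  rw [hk.trace_sub_mean_eq hΓ hμ hF]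
  simp_rw [hper]
  rw [integral_complex_ofReal, norm_div, Complex.norm_real, Complex.norm_real,
    Real.norm_of_nonneg measureReal_nonneg, hΓ.toReal_quotientProb hμ hF, ← mul_div_assoc]
  exact div_le_div_of_nonneg_right (key.trans (le_abs_self _)) measureReal_nonneg

/-- Spectral convergence implies Benjamini-Schramm convergence: apply it to the square of the
operator whose kernel is a cutoff function of the distance. -/
theorem bsConvergesToSpace_of_spectrallyConvergesToOne [μ.IsOpenPosMeasure]
    (hμ : IsInvariantMeasure μ) (η : Measure (X ≃ᵢ X)) [η.IsHaarMeasure]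
    {Γ : ℕ → Subgroup (X ≃ᵢ X)} (hΓ : ∀ n, IsLattice (Γ n))
    (h : SpectrallyConvergesToOne μ Γ) : BSConvergesToSpace μ Γ := by
  have := hμ.finite_on_compacts
  intro R hR
  obtain ⟨x₀⟩ := hμ.nonempty
  obtain ⟨D, hD'⟩ := (hΓ 0).exists_dist_le x₀
  have hD : ∀ x, ∃ g : X ≃ᵢ X, dist (g x₀) x ≤ D := fun x =>
    let ⟨γ, hγ⟩ := hD' x
    ⟨γ, hγ⟩
  -- with this cutoff, the convolution square detects all displacements less than `R`
  have hψ := isInvariantKernel_distCutoff (X := X) (R + D + 1)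
  obtain ⟨B, hB, hBk⟩ := hψ.exists_mem_kernelAlgebra hμ hD
  have hA : B.comp B ∈ kernelAlgebraSq μ := Submodule.subset_span ⟨B, hB, B, hB, rfl⟩
  obtain ⟨k, hkA, T, t, hTt, hlim⟩ := h _ hA
  obtain ⟨k', hk'A, hk', htr⟩ := exists_inducedOperator_hasTrace hμ hA
  obtain rfl := hkA.unique hk'A
  let κ : X → X → ℝ := fun x y =>
    ∫ z, distCutoff (R + D + 1) x z * distCutoff (R + D + 1) z y ∂μ
  have hkκ : k = fun x y => (κ x y : ℂ) := by
    rw [hkA.unique (hBk.comp hμ hBk hψ hψ)]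
    ext x y
    rw [compKernel, ← integral_complex_ofReal]
    simp only [Complex.ofReal_mul]
  choose F hF using fun n => (hΓ n).exists_isFundamentalDomain μ
  have ht : ∀ n, t n = ∫ x in F n, periodicKernel (Γ n) k x x ∂μ := by
    intro n
    obtain ⟨S, hS, hStr⟩ := htr (Γ n) (hΓ n) (F n) (hF n)
    obtain rfl := hS.unique (hΓ n) hμ (hTt n).1
    exact (hTt n).2.unique hStr
  have hlim' := tendsto_iff_norm_sub_tendsto_zero.1 (hlim (Γ 0) (hΓ 0))
  rw [← ENNReal.tendsto_toReal_iff (fun n => (hΓ n).quotientProb_ne_top hμ R)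
    ENNReal.zero_ne_top, ENNReal.toReal_zero]
  have hc : 0 < μ.real (Metric.ball x₀ 1) :=
    ENNReal.toReal_pos (Metric.measure_ball_pos μ x₀ one_pos).ne' measure_ball_lt_top.ne
  have hdiv := hlim'.const_mul (μ.real (Metric.ball x₀ 1))⁻¹
  rw [mul_zero] at hdiv
  refine squeeze_zero (fun n => ENNReal.toReal_nonneg) (fun n => ?_) hdiv
  rw [inv_mul_eq_div, le_div_iff₀ hc, mul_comm,
    kernelMean_eq_kernelMean hμ η (hΓ 0) (hΓ n) hk'.continuous hk'.invariant, ht]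
  subst hkκ
  exact le_norm_trace_sub_mean (hΓ n) hμ (hF n) hk'
    (fun x y => integral_nonneg fun z =>
      mul_nonneg (distCutoff_nonneg _ _ _) (distCutoff_nonneg _ _ _))
    (fun x y hxy => le_integral_distCutoff hμ hD hR.le hxy.le)

end Convergence

end BenjaminiSchramm

theorem mainTheorem3 {X : Type*} [MetricSpace X] [ProperSpace X] [MeasurableSpace X]
    [BorelSpace X] (μ : Measure X) (hμ : BenjaminiSchramm.IsInvariantMeasure μ)
    [μ.IsOpenPosMeasure] (η : Measure (X ≃ᵢ X)) [η.IsHaarMeasure]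
    (Γ : ℕ → Subgroup (X ≃ᵢ X)) (hΓ : ∀ n, BenjaminiSchramm.IsLattice (Γ n)) :
    (BenjaminiSchramm.UniformlyDiscrete Γ →
      [BenjaminiSchramm.SpectrallyConvergesToOne μ Γ,
        BenjaminiSchramm.BSConvergesToOne η Γ,
        BenjaminiSchramm.BSConvergesToSpace μ Γ].TFAE) ∧
    (BenjaminiSchramm.SpectrallyConvergesToOne μ Γ → BenjaminiSchramm.BSConvergesToOne η Γ) ∧
    (BenjaminiSchramm.BSConvergesToOne η Γ ↔ BenjaminiSchramm.BSConvergesToSpace μ Γ) := by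
  have hbc := BenjaminiSchramm.bsConvergesToOne_iff hμ η Γ hΓ
  have hac : BenjaminiSchramm.SpectrallyConvergesToOne μ Γ →
      BenjaminiSchramm.BSConvergesToSpace μ Γ :=
    BenjaminiSchramm.bsConvergesToSpace_of_spectrallyConvergesToOne hμ η hΓ
  refine ⟨fun hud => ?_, fun h => hbc.2 (hac h), hbc⟩
  tfae_have 1 → 3 := hac
  tfae_have 3 → 1 :=
    BenjaminiSchramm.spectrallyConvergesToOne_of_bsConvergesToSpace hμ η hΓ hud
  tfae_have 2 ↔ 3 := hbc
  tfae_finish
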